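/- Let $\mathbb T^2=(-\pi,\pi)^2$ be the torus; functions on it are identified with their $2\pi$-periodic extensions to $\mathbb R^2$, and all functions have zero mean. For $\sigma\ge 0$ put $\|\phi\|_{H^\sigma}^2=\sum_{k\in\mathbb Z^2\setminus\{0\}}|k|^{2\sigma}|\widehat\phi_k|^2$, $\widehat\phi_k=(2\pi)^{-2}\int_{\mathbb T^2}\phi(x)e^{-ik\cdot x}\,dx$; let $\langle\phi,\psi\rangle=(2\pi)^{-2}\int_{\mathbb T^2}\phi\psi\,dx$, let $\Lambda^\sigma$ be the Fourier multiplier $|k|^\sigma$, $\mathcal R_j$ the Riesz transform with multiplier $ik_j/|k|$, $\mathcal R^\perp=(-\mathcal R_2,\mathcal R_1)$, and $[\phi]_{C^\beta}=\sup_{x\ne y}|\phi(x)-\phi(y)|/|x-y|^\beta$. Let $\gamma\in(0,2)$, $\alpha\in(0,1)$ and $\beta\in(\max\{1-\gamma,0\},1)$. There is a constant $c>0$, depending only on $\alpha,\beta,\gamma$, such that the following holds. Let $f\in H^\alpha$ (independent of time), and let $\theta\in L^2_{loc}([0,\infty);H^{\gamma/2})\cap C_w([0,\infty);L^2)$ be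 a weak solution of the SQG equation $$\partial_t\theta+\boldsymbol u\cdot\nabla\theta+\Lambda^\gamma\theta=f,\qquad \boldsymbol u=\mathcal R^\perp\theta,$$ that is, for every $\varphi\in C_0^\infty([0,\infty);C^\infty(\mathbb T^2))$ with zero spatial mean and every $T>0$, $$-\int_0^T\langle\theta,\partial_t\varphi\rangle\,dt-\langle\theta(0),\varphi(0)\rangle+\langle\theta(T),\varphi(T)\rangle-\int_0^T\langle\theta,\boldsymbol u\cdot\nabla\varphi\rangle\,dt+\int_0^T\langle\Lambda^{\gamma/2}\theta,\Lambda^{\gamma/2}\varphi\rangle\,dt=\int_0^T\langle f,\varphi\rangle\,dt.$$ Assume that $\theta\in C([0,\infty);H^{\alpha+\gamma/2})$ and that $[\theta(t)]_{C^\beta}\le K_\beta$ for all $t\ge0$. Then $t\mapsto\|\theta(t)\|_{H^\alpha}^2$ is differentiable on $[0,\infty)$ (one-sidedly at $t=0$), and for every $t\ge0$ $$\frac{d}{dt}\|\theta(t)\|^2_{H^\alpha}+\frac14\|\theta(t)\|^2_{H^{\alpha+\gamma/2}}\le c\,K_\beta^{\frac{4\gamma}{\gamma+\beta-1}}+c\,\|f\|^2_{H^\alpha}.$$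 -/

import Mathlib

open scoped ContDiff ComplexConjugate

noncomputable section

namespace SQG

/-- The Euclidean plane. Functions on the torus `𝕋² = (-π, π)²` are identified with their
`2π`-periodic extensions to the plane. -/
abbrev Plane : Type := EuclideanSpace ℝ (Fin 2)

/-- The fundamental cell `(-π, π)²` of the torus. -/
def cell : Set Plane := {x | ∀ i, x i ∈ Set.Ioo (-Real.pi) Real.pi}

/-- A frequency `k ∈ ℤ²` as a vector of the plane. -/
def freq (k : Fin 2 → ℤ) : Plane := WithLp.toLp 2 (fun i => (k i : ℝ))

/-- The nonzero frequencies `ℤ² \ {0}`. -/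
abbrev Freq0 : Type := {k : Fin 2 → ℤ // k ≠ 0}

/-- `2π`-periodicity in both variables. -/
def Periodic2 (φ : Plane → ℝ) : Prop :=
  ∀ (x : Plane) (k : Fin 2 → ℤ), φ (x + (2 * Real.pi) • freq k) = φ x

/-- The normalized integral `(2π)⁻² ∫_{𝕋²} g dx`. -/
def mean {F : Type*} [NormedAddCommGroup F] [NormedSpace ℝ F] (g : Plane → F) : F :=
  ((2 * Real.pi) ^ 2)⁻¹ • ∫ x in cell, g x

/-- The Fourier coefficient `(2π)⁻² ∫_{𝕋²} φ(x) e^{-i k·x} dx`. -/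
def coeff (φ : Plane → ℝ) (k : Fin 2 → ℤ) : ℂ :=
  mean (fun x => (φ x : ℂ) * Complex.exp (-(Complex.I * ((inner ℝ (freq k) x : ℝ) : ℂ))))

/-- The space `L²` of periodic, square integrable functions of zero mean on the torus. -/
structure MemL2 (φ : Plane → ℝ) : Prop where
  periodic : Periodic2 φ
  memLp : MeasureTheory.MemLp φ 2 (MeasureTheory.volume.restrict cell)
  mean_zero : mean φ = 0

/-- The scalar product of `L²`; it is normalized so that `⟨φ, φ⟩ = ∑_k |φ̂_k|²`. -/
def innerL2 (φ ψ : Plane → ℝ) : ℝ := mean (fun x => φ x * ψ x)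

/-- `‖φ‖²_{H^σ} = ∑_{k ≠ 0} |k|^{2σ} |φ̂_k|²`. -/
def sobolevSq (σ : ℝ) (φ : Plane → ℝ) : ℝ :=
  ∑' k : Freq0, ‖freq k.1‖ ^ (2 * σ) * ‖coeff φ k.1‖ ^ 2

/-- The Sobolev space `H^σ` of zero-mean periodic functions, for `σ ≥ 0`. -/
structure MemSobolev (σ : ℝ) (φ : Plane → ℝ) : Prop where
  memL2 : MemL2 φ
  summable : Summable fun k : Freq0 => ‖freq k.1‖ ^ (2 * σ) * ‖coeff φ k.1‖ ^ 2

/-- `⟨Λ^σ φ, Λ^σ ψ⟩`, where `Λ^σ` is the Fourier multiplier `|k|^σ`. -/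
def innerLambda (σ : ℝ) (φ ψ : Plane → ℝ) : ℝ :=
  ∑' k : Freq0, ‖freq k.1‖ ^ (2 * σ) * (coeff φ k.1 * conj (coeff ψ k.1)).re

/-- `u = R^⊥ φ = (-R₂ φ, R₁ φ)`, where the Riesz transform `R_j` is the Fourier multiplier
`i k_j / |k|`. This determines the `L²` vector field `u` almost everywhere. -/
structure IsRieszPerp (φ : Plane → ℝ) (u : Plane → Plane) : Prop where
  memL2 : ∀ i, MemL2 (fun x => u x i)
  coeff_fst : ∀ k : Freq0, coeff (fun x => u x 0) k.1
    = -(Complex.I * (k.1 1 : ℂ) / (‖freq k.1‖ : ℂ) * coeff φ k.1)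
  coeff_snd : ∀ k : Freq0, coeff (fun x => u x 1) k.1
    = Complex.I * (k.1 0 : ℂ) / (‖freq k.1‖ : ℂ) * coeff φ k.1

/-- Test functions: smooth in time and space, periodic with zero mean in space, and vanishing
for large times (no condition is imposed at the initial time). -/
structure IsTest (φ : ℝ → Plane → ℝ) : Prop where
  smooth : ContDiff ℝ ∞ (fun p : ℝ × Plane => φ p.1 p.2)
  periodic : ∀ t, Periodic2 (φ t)
  mean_zero : ∀ t, mean (φ t) = 0
  compact : ∃ R : ℝ, ∀ t, R ≤ t → φ t = 0

/-- `θ ∈ L²_loc([0,∞); H^{γ/2}) ∩ C_w([0,∞); L²)` is a weak solution of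
`∂ₜθ + u·∇θ + Λ^γ θ = f`, `u = R^⊥ θ`, with initial datum `θ 0`. -/
structure IsWeakSolution (γ : ℝ) (f : Plane → ℝ) (θ : ℝ → Plane → ℝ) : Prop where
  memL2 : ∀ t, 0 ≤ t → MemL2 (θ t)
  weak_continuous : ∀ ψ, MemL2 ψ → ContinuousOn (fun t => innerL2 (θ t) ψ) (Set.Ici 0)
  memSobolev : ∀ᵐ t ∂(MeasureTheory.volume.restrict (Set.Ioi (0 : ℝ))), MemSobolev (γ / 2) (θ t)
  locally_integrable : ∀ T : ℝ, 0 < T →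
    MeasureTheory.IntegrableOn (fun t => sobolevSq (γ / 2) (θ t)) (Set.Ioc 0 T)
  equation : ∃ u : ℝ → Plane → Plane, (∀ t, 0 ≤ t → IsRieszPerp (θ t) (u t)) ∧
    ∀ φ, IsTest φ → ∀ T : ℝ, 0 < T →
      -(∫ t in (0 : ℝ)..T, innerL2 (θ t) (fun x => deriv (fun s => φ s x) t))
        - innerL2 (θ 0) (φ 0) + innerL2 (θ T) (φ T)
        - (∫ t in (0 : ℝ)..T, innerL2 (θ t) (fun x => fderiv ℝ (φ t) x (u t x)))
        + (∫ t in (0 : ℝ)..T, innerLambda (γ / 2) (θ t) (φ t))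
      = ∫ t in (0 : ℝ)..T, innerL2 f (φ t)

/-- `θ ∈ C([0,∞); H^σ)`. -/
structure ContinuousInSobolev (σ : ℝ) (θ : ℝ → Plane → ℝ) : Prop where
  mem : ∀ t, 0 ≤ t → MemSobolev σ (θ t)
  tendsto : ∀ t, 0 ≤ t →
    Filter.Tendsto (fun s => sobolevSq σ (θ s - θ t)) (nhdsWithin t (Set.Ici 0)) (nhds 0)

/-- The Hölder seminorm bound `[φ]_{C^β} ≤ K`. -/
def HolderBound (β K : ℝ) (φ : Plane → ℝ) : Prop :=
  ∀ x y : Plane, |φ x - φ y| ≤ K * ‖x - y‖ ^ β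

end SQG

end

noncomputable section

open MeasureTheory UnitAddTorus

namespace SQG

-- Multiplying the equation for each Fourier coefficient by its conjugate and by `|k|^{2α}`, then
-- summing, gives the `H^α` balance: dissipation `-2‖θ‖²_{H^{α+γ/2}}`, forcing `2⟨Λ^α f, Λ^α θ⟩`,
-- and a nonlinear flux. The whole difficulty is the flux, since `θ` is only Hölder in space and the
-- sum over frequencies has no evident absolute convergence.
--
-- The flux is first viewed through a Gaussian filter of width `r`. For a divergence-free velocity,
-- the Kármán–Howarth–Monin identity (`hasSum_flux`) turns the filtered flux into `(4r)⁻¹` times a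
-- Gaussian average of the cubic increments `δu (δθ)²`. The multiplier `|k|^{2α}` is, up to the
-- constant `filterConst α`, the integral of differences of Gaussian weights of widths `r` and `2r`
-- against `r^{-1-2α} dr`. The nonlinear term is therefore controlled by third moments of increments
-- integrated against `r^{-2-2α} dr`.
--
-- These moments are estimated in two moves. A Marchaud inequality
-- (`BddPeriodic.lintegral_moment_le`) replaces first increments by second increments. Then one of
-- the three factors is bounded by the Hölder seminorm and the other two by Parseval
-- (`BddPeriodic.lintegral_moment2_le`), giving `C K ∑ |k|^{1+2α-β} |θ̂_k|²`. The velocity satisfies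
-- the same Hölder bound up to a constant, because Riesz transforms preserve Hölder classes
-- (`exists_riesz`).
--
-- Since `β > 1-γ`, the exponent `1+2α-β` lies strictly below `2α+γ`. Interpolation by Young's
-- inequality (`exists_mul_rpow_le`) between the dissipation and the norm of order `αβ < β`, itself
-- bounded by `K` (`exists_sobolevENN_le`), absorbs the flux at the price of a power of `K`: this is
-- `exists_limitFlux_le`.
--
-- To justify the balance at every time, scales below `ε` are discarded, which leaves multipliers
-- with Gaussian decay and makes every sum harmless. The same strict gap of exponents gives a rate
-- `ε^{2δ}` for the flux (`exists_abs_filterFlux_sub_le`), locally uniform in time. Hence the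
-- limiting flux is continuous in time, the integrated balance passes to the limit, and the
-- fundamental theorem of calculus gives the derivative (`hasDerivWithinAt_sobolevSq`).

local instance : MeasureSpace UnitAddCircle := ⟨AddCircle.haarAddCircle⟩

local instance : Measure.IsAddHaarMeasure (volume : Measure UnitAddCircle) :=
  inferInstanceAs (Measure.IsAddHaarMeasure AddCircle.haarAddCircle)

local instance : IsProbabilityMeasure (volume : Measure UnitAddCircle) :=
  inferInstanceAs (IsProbabilityMeasure AddCircle.haarAddCircle)

/-! ### Passage between periodic functions on the plane and the unit torus. -/

/-- The normalized Lebesgue measure on the fundamental cell. -/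
def cellMeasure : Measure Plane :=
  ENNReal.ofReal ((2 * Real.pi) ^ 2)⁻¹ • volume.restrict cell

theorem mean_eq_integral {F : Type*} [NormedAddCommGroup F] [NormedSpace ℝ F] (g : Plane → F) :
    mean g = ∫ x, g x ∂cellMeasure := by
  rw [mean, cellMeasure, integral_smul_measure, ENNReal.toReal_ofReal (by positivity)]

/-- The measurable section of the quotient map from the plane to the torus with values in the
closure of the fundamental cell. -/
def torusSection (y : UnitAddTorus (Fin 2)) : Plane :=
  (2 * Real.pi) • WithLp.toLp 2 (fun i => ((AddCircle.equivIoc 1 (-1 / 2) (y i) : ℝ)))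

/-- The quotient map from the plane to the torus. -/
def torusMk (x : Plane) : UnitAddTorus (Fin 2) := fun i => ((x i / (2 * Real.pi) : ℝ) : UnitAddCircle)

theorem torusMk_add (x y : Plane) : torusMk (x + y) = torusMk x + torusMk y := by
  ext i
  simp [torusMk, add_div]

theorem torusMk_torusSection (y : UnitAddTorus (Fin 2)) : torusMk (torusSection y) = y := by
  ext i
  have h : (2 * Real.pi) ≠ 0 := by positivity
  simp only [torusMk, torusSection, PiLp.smul_apply, smul_eq_mul]
  rw [mul_div_cancel_left₀ _ h]
  exact (AddCircle.equivIoc 1 (-1 / 2)).symm_apply_apply (y i)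

theorem exists_eq_add_of_torusMk_eq {x y : Plane} (hxy : torusMk x = torusMk y) :
    ∃ k : Fin 2 → ℤ, x = y + (2 * Real.pi) • freq k := by
  have h : (2 * Real.pi) ≠ 0 := by positivity
  have : ∀ i, ∃ n : ℤ, x i = y i + (2 * Real.pi) * n := by
    intro i
    have hi := congrFun hxy i
    simp only [torusMk] at hi
    rw [← sub_eq_zero, ← AddCircle.coe_sub, AddCircle.coe_eq_zero_iff] at hi
    obtain ⟨n, hn⟩ := hi
    refine ⟨n, ?_⟩
    simp only [zsmul_eq_mul, mul_one] at hn
    rw [hn]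
    field_simp
    ring
  choose k hk using this
  refine ⟨k, ?_⟩
  ext i
  simp [freq, hk i]

theorem measurableEmbedding_torusSection : MeasurableEmbedding torusSection := by
  refine Measurable.measurableEmbedding ?_ ?_
  · have : Measurable fun y : UnitAddTorus (Fin 2) =>
        (fun i => ((AddCircle.equivIoc 1 (-1 / 2) (y i) : ℝ))) := by
      refine measurable_pi_lambda _ fun i => ?_
      exact measurable_subtype_coe.comp
        ((AddCircle.measurableEquivIoc 1 (-1 / 2)).measurable.comp (measurable_pi_apply i))
    exact ((PiLp.continuous_toLp 2 (fun _ : Fin 2 => ℝ)).measurable.comp this).const_smul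
      (2 * Real.pi)
  · intro x y hxy
    rw [← torusMk_torusSection x, hxy, torusMk_torusSection]

/-- The section factors through three maps: coordinates in the half-open box, the replacement of
that box by the open one (a null change), and the dilation by `2π`, whose Jacobian is exactly the
normalizing factor of `cellMeasure`. -/
theorem measurePreserving_torusSection : MeasurePreserving torusSection volume cellMeasure := by
  refine ⟨measurableEmbedding_torusSection.measurable, ?_⟩
  let a : Fin 2 → ℝ := fun _ => -1 / 2
  let S : Set (Fin 2 → ℝ) := {x | ∀ i, x i ∈ Set.Ioc (a i) (a i + 1)}
  let S' : Set (Fin 2 → ℝ) := {x | ∀ i, x i ∈ Set.Ioo (a i) (a i + 1)}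
  have hS : MeasurableSet S := MeasurableSet.univ_pi' fun i => measurableSet_Ioc
  have hSS : S =ᵐ[volume] S' := by
    have h1 : S = Set.univ.pi fun i => Set.Ioc (a i) (a i + 1) := by ext; simp [S]
    have h2 : S' = Set.univ.pi fun i => Set.Ioo (a i) (a i + 1) := by ext; simp [S']
    rw [h1, h2]
    exact (Measure.univ_pi_Ioc_ae_eq_Icc (f := a) (g := fun i => a i + 1)).trans
      (Measure.univ_pi_Ioo_ae_eq_Icc (f := a) (g := fun i => a i + 1)).symm
  have e1 : MeasurePreserving (fun y => ((measurableEquivPiIoc a y : _) : Fin 2 → ℝ))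
      volume (volume.restrict S') := by
    rw [← Measure.restrict_congr_set hSS]
    exact (measurePreserving_subtype_coe hS).comp (measurePreserving_equivPiIoc a)
  let T : Set Plane := {x | ∀ i, x i ∈ Set.Ioo (a i) (a i + 1)}
  have e2 : MeasurePreserving (WithLp.toLp 2 : (Fin 2 → ℝ) → Plane) (volume.restrict S')
      (volume.restrict T) :=
    (PiLp.volume_preserving_toLp (Fin 2)).restrict_preimage_emb
      (MeasurableEquiv.toLp 2 (Fin 2 → ℝ)).measurableEmbedding T
  have h : (2 * Real.pi) ≠ 0 := by positivity
  have e3 : Measure.map (fun x : Plane => (2 * Real.pi) • x) (volume.restrict T) = cellMeasure := by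
    have hT : T = (fun x : Plane => (2 * Real.pi) • x) ⁻¹' cell := by
      ext x
      simp only [T, cell, a, Set.mem_ofPred_eq, Set.mem_preimage, PiLp.smul_apply, smul_eq_mul,
        Set.mem_Ioo]
      refine forall_congr' fun i => ?_
      have := Real.pi_pos
      constructor
      · rintro ⟨h1, h2⟩; constructor <;> nlinarith
      · rintro ⟨h1, h2⟩; constructor <;> nlinarith
    have hemb : MeasurableEmbedding (fun x : Plane => (2 * Real.pi) • x) :=
      (Homeomorph.smulOfNeZero _ h).measurableEmbedding
    rw [hT, ← hemb.restrict_map, Measure.map_addHaar_smul _ h, Measure.restrict_smul, cellMeasure]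
    congr 2
    simp [abs_of_pos Real.pi_pos]
  rw [← e3, ← e2.map_eq, ← e1.map_eq, Measure.map_map, Measure.map_map]
  · rfl
  · exact (measurable_const_smul _).comp e2.measurable
  · exact e1.measurable
  · exact measurable_const_smul _
  · exact e2.measurable

instance : IsProbabilityMeasure cellMeasure :=
  ⟨by
    rw [← measurePreserving_torusSection.measure_preimage MeasurableSet.univ.nullMeasurableSet]
    simp⟩

theorem ae_cellMeasure_of_forall_torusSection {p : Plane → Prop} (h : ∀ y, p (torusSection y)) :
    ∀ᵐ x ∂cellMeasure, p x := by
  rw [← measurePreserving_torusSection.map_eq, measurableEmbedding_torusSection.ae_map_iff]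
  exact Filter.Eventually.of_forall h

theorem mean_eq_integral_torus {F : Type*} [NormedAddCommGroup F] [NormedSpace ℝ F]
    (g : Plane → F) : mean g = ∫ y, g (torusSection y) := by
  rw [mean_eq_integral]
  exact (measurePreserving_torusSection.integral_comp measurableEmbedding_torusSection g).symm

/-- `2π`-periodicity in both variables, for functions with values in any type. -/
def IsPeriodic {F : Type*} (φ : Plane → F) : Prop :=
  ∀ (x : Plane) (k : Fin 2 → ℤ), φ (x + (2 * Real.pi) • freq k) = φ x

theorem IsPeriodic.eq_of_torusMk_eq {F : Type*} {φ : Plane → F} (hφ : IsPeriodic φ) {x y : Plane}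
    (h : torusMk x = torusMk y) : φ x = φ y := by
  obtain ⟨k, rfl⟩ := exists_eq_add_of_torusMk_eq h
  exact hφ y k

theorem IsPeriodic.shift {F : Type*} {φ : Plane → F} (hφ : IsPeriodic φ) (h : Plane) :
    IsPeriodic fun x => φ (x + h) := by
  intro x k
  simp only [add_right_comm x _ h]
  exact hφ _ k

theorem IsPeriodic.shift_torusSection {F : Type*} {φ : Plane → F} (hφ : IsPeriodic φ) (h : Plane)
    (y : UnitAddTorus (Fin 2)) :
    φ (torusSection y + h) = φ (torusSection (y + torusMk h)) := by
  apply hφ.eq_of_torusMk_eq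
  rw [torusMk_add, torusMk_torusSection, torusMk_torusSection]

/-- On the torus a planar translation becomes a group translation, and Haar measure is invariant. -/
theorem mean_shift {F : Type*} [NormedAddCommGroup F] [NormedSpace ℝ F] {φ : Plane → F}
    (hφ : IsPeriodic φ) (h : Plane) : mean (fun x => φ (x + h)) = mean φ := by
  rw [mean_eq_integral_torus, mean_eq_integral_torus]
  simp_rw [hφ.shift_torusSection]
  exact integral_add_right_eq_self (fun y => φ (torusSection y)) (torusMk h)

theorem memLp_comp_torusSection {F : Type*} [NormedAddCommGroup F] {φ : Plane → F} {p : ENNReal} :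
    MemLp (fun y => φ (torusSection y)) p volume ↔ MemLp φ p cellMeasure := by
  rw [← measurePreserving_torusSection.map_eq]
  exact measurableEmbedding_torusSection.memLp_map_measure_iff.symm

theorem memLp_shift {F : Type*} [NormedAddCommGroup F] {φ : Plane → F} {p : ENNReal}
    (hφ : IsPeriodic φ) (h : Plane) (hm : MemLp φ p cellMeasure) :
    MemLp (fun x => φ (x + h)) p cellMeasure := by
  rw [← memLp_comp_torusSection] at hm ⊢
  simp_rw [hφ.shift_torusSection]
  exact hm.comp_measurePreserving (measurePreserving_add_right volume (torusMk h))

theorem memLp_cellMeasure_iff {F : Type*} [NormedAddCommGroup F] {φ : Plane → F} {p : ENNReal} :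
    MemLp φ p cellMeasure ↔ MemLp φ p (volume.restrict cell) := by
  rw [cellMeasure]
  constructor
  · intro h
    have h2 := h.smul_measure (c := ENNReal.ofReal ((2 * Real.pi) ^ 2)) ENNReal.ofReal_ne_top
    rwa [smul_smul, ← ENNReal.ofReal_mul (by positivity), mul_inv_cancel₀ (by positivity),
      ENNReal.ofReal_one, one_smul] at h2
  · intro h
    exact h.smul_measure ENNReal.ofReal_ne_top

theorem MemL2.memLp_cellMeasure {φ : Plane → ℝ} (h : MemL2 φ) : MemLp φ 2 cellMeasure :=
  memLp_cellMeasure_iff.2 h.memLp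

/-! ### Fourier coefficients and Parseval on the cell. -/

/-- The character `e^{i k·x}`. -/
def mode (k : Fin 2 → ℤ) (x : Plane) : ℂ :=
  Complex.exp (((inner ℝ (freq k) x : ℝ) : ℂ) * Complex.I)

theorem inner_freq (k : Fin 2 → ℤ) (x : Plane) :
    inner ℝ (freq k) x = k 0 * x 0 + k 1 * x 1 := by
  simp [freq, PiLp.inner_apply, Fin.sum_univ_two, mul_comm]

theorem norm_mode (k : Fin 2 → ℤ) (x : Plane) : ‖mode k x‖ = 1 :=
  Complex.norm_exp_ofReal_mul_I _

theorem mode_add (k : Fin 2 → ℤ) (x y : Plane) : mode k (x + y) = mode k x * mode k y := by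
  rw [mode, mode, mode, ← Complex.exp_add, inner_add_right]
  push_cast
  ring_nf

theorem conj_mode (k : Fin 2 → ℤ) (x : Plane) :
    conj (mode k x) = Complex.exp (-(Complex.I * ((inner ℝ (freq k) x : ℝ) : ℂ))) := by
  rw [mode, ← Complex.exp_conj]
  simp [mul_comm]

theorem mode_periodic (k : Fin 2 → ℤ) : IsPeriodic (mode k) := by
  intro x l
  rw [mode_add]
  have : mode k ((2 * Real.pi) • freq l) = 1 := by
    rw [mode, Complex.exp_eq_one_iff]
    refine ⟨k 0 * l 0 + k 1 * l 1, ?_⟩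
    rw [inner_freq]
    simp [freq]
    ring
  rw [this, mul_one]

theorem continuous_mode (k : Fin 2 → ℤ) : Continuous (mode k) := by
  unfold mode
  fun_prop

theorem mFourier_torusMk (k : Fin 2 → ℤ) (x : Plane) : mFourier k (torusMk x) = mode k x := by
  rw [mFourier, mode, inner_freq, ContinuousMap.coe_mk, Fin.prod_univ_two]
  simp only [torusMk, fourier_coe_apply, ← Complex.exp_add]
  congr 1
  have : (Real.pi : ℂ) ≠ 0 := by exact_mod_cast Real.pi_ne_zero
  push_cast
  field_simp

theorem coeff_eq_mean (φ : Plane → ℝ) (k : Fin 2 → ℤ) :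
    coeff φ k = mean fun x => (φ x : ℂ) * conj (mode k x) := by
  simp_rw [conj_mode]
  rfl

theorem coeff_eq_mFourierCoeff (φ : Plane → ℝ) (k : Fin 2 → ℤ) :
    coeff φ k = mFourierCoeff (fun y => (φ (torusSection y) : ℂ)) k := by
  rw [coeff_eq_mean, mean_eq_integral_torus, mFourierCoeff]
  congr 1
  ext y
  rw [mFourier_neg, ← mFourier_torusMk, torusMk_torusSection, smul_eq_mul, mul_comm]

theorem mFourierCoeff_congr_ae {f g : UnitAddTorus (Fin 2) → ℂ} (h : f =ᵐ[volume] g)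
    (k : Fin 2 → ℤ) : mFourierCoeff f k = mFourierCoeff g k :=
  integral_congr_ae (h.mono fun y hy => by simp only [hy])

/-- **Parseval's identity** on the cell. -/
theorem hasSum_coeff_mul_conj {a b : Plane → ℝ} (ha : MemLp a 2 cellMeasure)
    (hb : MemLp b 2 cellMeasure) :
    HasSum (fun k => coeff a k * conj (coeff b k)) ((mean fun x => a x * b x : ℝ) : ℂ) := by
  have ha' := (memLp_comp_torusSection.2 ha).ofReal (K := ℂ)
  have hb' := (memLp_comp_torusSection.2 hb).ofReal (K := ℂ)
  have key := hasSum_prod_mFourierCoeff (hb'.toLp _) (ha'.toLp _)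
  have e1 : ∀ k, mFourierCoeff (ha'.toLp _) k = coeff a k := fun k => by
    rw [coeff_eq_mFourierCoeff, mFourierCoeff_congr_ae ha'.coeFn_toLp]; rfl
  have e2 : ∀ k, mFourierCoeff (hb'.toLp _) k = coeff b k := fun k => by
    rw [coeff_eq_mFourierCoeff, mFourierCoeff_congr_ae hb'.coeFn_toLp]; rfl
  simp_rw [e1, e2] at key
  convert key using 1
  · ext k
    rw [mul_comm]
  · rw [mean_eq_integral_torus, ← integral_complex_ofReal]
    refine integral_congr_ae ?_
    filter_upwards [ha'.coeFn_toLp, hb'.coeFn_toLp] with y h1 h2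
    rw [h1, h2]
    simp [mul_comm]

theorem hasSum_sq_coeff {a : Plane → ℝ} (ha : MemLp a 2 cellMeasure) :
    HasSum (fun k => ‖coeff a k‖ ^ 2) (mean fun x => a x ^ 2) := by
  have := Complex.hasSum_re (hasSum_coeff_mul_conj ha ha)
  simp_rw [Complex.mul_conj, Complex.ofReal_re, Complex.normSq_eq_norm_sq, ← sq] at this
  exact this

theorem integrable_of_memLp_two {F : Type*} [NormedAddCommGroup F] {a : Plane → F}
    (ha : MemLp a 2 cellMeasure) : Integrable a cellMeasure :=
  ha.integrable (by norm_num)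

theorem integrable_mul_conj_mode {a : Plane → ℝ} (ha : Integrable a cellMeasure) (k : Fin 2 → ℤ) :
    Integrable (fun x => (a x : ℂ) * conj (mode k x)) cellMeasure := by
  refine ha.ofReal.mul_bdd (c := 1) ?_ ?_
  · exact (Complex.continuous_conj.comp (continuous_mode k)).aestronglyMeasurable
  · exact Filter.Eventually.of_forall fun x => by simp [norm_mode]

theorem coeff_sub {a b : Plane → ℝ} (ha : Integrable a cellMeasure) (hb : Integrable b cellMeasure)
    (k : Fin 2 → ℤ) : coeff (fun x => a x - b x) k = coeff a k - coeff b k := by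
  simp_rw [coeff_eq_mean, mean_eq_integral]
  rw [← integral_sub (integrable_mul_conj_mode ha k) (integrable_mul_conj_mode hb k)]
  congr 1
  ext x
  push_cast
  ring

theorem coeff_add {a b : Plane → ℝ} (ha : Integrable a cellMeasure) (hb : Integrable b cellMeasure)
    (k : Fin 2 → ℤ) : coeff (fun x => a x + b x) k = coeff a k + coeff b k := by
  simp_rw [coeff_eq_mean, mean_eq_integral]
  rw [← integral_add (integrable_mul_conj_mode ha k) (integrable_mul_conj_mode hb k)]
  congr 1
  ext x
  push_cast
  ring

theorem coeff_const_mul (c : ℝ) (a : Plane → ℝ) (k : Fin 2 → ℤ) :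
    coeff (fun x => c * a x) k = c * coeff a k := by
  simp_rw [coeff_eq_mean, mean_eq_integral]
  rw [← integral_const_mul]
  congr 1
  ext x
  push_cast
  ring

theorem coeff_shift {a : Plane → ℝ} (ha : IsPeriodic a) (h : Plane) (k : Fin 2 → ℤ) :
    coeff (fun x => a (x + h)) k = mode k h * coeff a k := by
  rw [coeff_eq_mean, coeff_eq_mean]
  have hp : IsPeriodic fun x => (a x : ℂ) * conj (mode k x) := by
    intro x l
    simp only [ha x l, mode_periodic k x l]
  rw [← mean_shift hp h, mean_eq_integral, mean_eq_integral, ← integral_const_mul]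
  congr 1
  ext x
  rw [mode_add, map_mul]
  have : mode k h * conj (mode k h) = 1 := by
    rw [Complex.mul_conj, Complex.normSq_eq_norm_sq, norm_mode]; simp
  linear_combination (-(a (x + h) : ℂ) * conj (mode k x)) * this

theorem coeff_zero_freq (a : Plane → ℝ) : coeff a 0 = (mean a : ℝ) := by
  rw [coeff_eq_mean, mean_eq_integral, mean_eq_integral, ← integral_complex_ofReal]
  congr 1
  ext x
  simp [mode, inner_freq]

theorem norm_coeff_le {a : Plane → ℝ} {M : ℝ} (h : ∀ x, |a x| ≤ M) (k : Fin 2 → ℤ) :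
    ‖coeff a k‖ ≤ M := by
  rw [coeff_eq_mean, mean_eq_integral]
  refine (norm_integral_le_of_norm_le_const (C := M) (Filter.Eventually.of_forall fun x => ?_)).trans
    (by simp)
  simp [norm_mode, h x]

/-- Parseval for the difference. This identifies an abstract velocity, known only through its
coefficients, with an explicit Hölder representative. -/
theorem ae_eq_of_coeff_eq {a b : Plane → ℝ} (ha : MemLp a 2 cellMeasure)
    (hb : MemLp b 2 cellMeasure) (h : ∀ k, coeff a k = coeff b k) : a =ᵐ[cellMeasure] b := by
  have h1 := hasSum_sq_coeff (ha.sub hb)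
  have h2 : ∀ k, coeff (a - b) k = 0 := fun k => by
    have := coeff_sub (integrable_of_memLp_two ha) (integrable_of_memLp_two hb) k
    rw [h k, sub_self] at this
    exact this
  simp only [h2] at h1
  have h3 : mean (fun x => (a - b) x ^ 2) = 0 := by
    simpa using h1.unique (by simp)
  rw [mean_eq_integral, integral_eq_zero_iff_of_nonneg (fun x => sq_nonneg _)
    (ha.sub hb).integrable_sq] at h3
  filter_upwards [h3] with x hx
  simp only [Pi.sub_apply, Pi.zero_apply, sq_eq_zero_iff, sub_eq_zero] at hx
  exact hx

/-! ### Gaussian integrals. -/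

/-- The standard Gaussian density on the plane. -/
def gauss (z : Plane) : ℝ := (2 * Real.pi)⁻¹ * Real.exp (-(1 / 2) * ‖z‖ ^ 2)

theorem gauss_pos (z : Plane) : 0 < gauss z := by unfold gauss; positivity

theorem continuous_gauss : Continuous gauss := by unfold gauss; fun_prop

theorem integrable_exp_neg_mul_norm_sq {b : ℝ} (hb : 0 < b) :
    Integrable fun z : Plane => Real.exp (-b * ‖z‖ ^ 2) := by
  have := (GaussianFourier.integrable_cexp_neg_mul_sq_norm_add (V := Plane) (b := (b : ℂ))
    (by simpa using hb) 0 0).norm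
  refine this.congr (Filter.Eventually.of_forall fun z => ?_)
  simp only [Complex.norm_exp]
  congr 1
  simp [← Complex.ofReal_pow]

/-- The power is traded for `n! e^s`, and completing the square in `(c+1)s - s²/2` keeps half of the
Gaussian exponent. -/
theorem pow_mul_exp_mul_exp_neg_le (n : ℕ) {c s : ℝ} (hs : 0 ≤ s) :
    s ^ n * Real.exp (c * s) * Real.exp (-(1 / 2) * s ^ 2)
      ≤ n.factorial * Real.exp ((c + 1) ^ 2) * Real.exp (-(1 / 4) * s ^ 2) := by
  have h1 : s ^ n ≤ n.factorial * Real.exp s := by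
    have := Real.pow_div_factorial_le_exp s hs n
    rwa [div_le_iff₀' (by positivity)] at this
  calc s ^ n * Real.exp (c * s) * Real.exp (-(1 / 2) * s ^ 2)
      ≤ n.factorial * Real.exp s * Real.exp (c * s) * Real.exp (-(1 / 2) * s ^ 2) := by gcongr
    _ = n.factorial * Real.exp ((c + 1) * s - 1 / 2 * s ^ 2) := by
        rw [mul_assoc, mul_assoc, ← Real.exp_add, ← Real.exp_add]; ring_nf
    _ ≤ n.factorial * Real.exp ((c + 1) ^ 2 + -(1 / 4) * s ^ 2) := by
        gcongr
        nlinarith [sq_nonneg ((c + 1) - s / 2)]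
    _ = _ := by rw [Real.exp_add]; ring

/-- The exponential factor is there for translated Gaussians: by `gauss_sub` a shift multiplies the
density by an exponential growing at most linearly in the exponent. -/
theorem integrable_pow_mul_exp_mul_gauss (n : ℕ) (c : ℝ) :
    Integrable fun z : Plane => ‖z‖ ^ n * Real.exp (c * ‖z‖) * gauss z := by
  have h := ((integrable_exp_neg_mul_norm_sq (b := 1 / 4) (by norm_num)).const_mul
    (n.factorial * Real.exp ((c + 1) ^ 2))).const_mul ((2 * Real.pi)⁻¹)
  refine h.mono' ?_ (Filter.Eventually.of_forall fun z => ?_)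
  · have := continuous_gauss
    exact Continuous.aestronglyMeasurable (by fun_prop)
  · rw [Real.norm_of_nonneg (by have := gauss_pos z; positivity), gauss]
    have := pow_mul_exp_mul_exp_neg_le n (c := c) (norm_nonneg z)
    calc _ = (2 * Real.pi)⁻¹ *
          (‖z‖ ^ n * Real.exp (c * ‖z‖) * Real.exp (-(1 / 2) * ‖z‖ ^ 2)) := by ring
      _ ≤ _ := by gcongr

theorem integral_gauss_mul_mode (ξ : Plane) :
    ∫ z : Plane, (gauss z : ℂ) * Complex.exp (((inner ℝ ξ z : ℝ) : ℂ) * Complex.I)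
      = Real.exp (-(1 / 2) * ‖ξ‖ ^ 2) := by
  have h := GaussianFourier.integral_cexp_neg_mul_sq_norm_add (V := Plane) (b := (1 / 2 : ℂ))
    (by norm_num) Complex.I ξ
  have e : ∀ z : Plane, (gauss z : ℂ) * Complex.exp (((inner ℝ ξ z : ℝ) : ℂ) * Complex.I)
      = (2 * Real.pi : ℂ)⁻¹ *
        Complex.exp (-(1 / 2) * ‖z‖ ^ 2 + Complex.I * (inner ℝ ξ z : ℝ)) := by
    intro z
    rw [gauss, Complex.exp_add]
    push_cast
    ring_nf
  simp_rw [e]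
  rw [integral_const_mul, h]
  have hpi : (Real.pi : ℂ) ≠ 0 := by exact_mod_cast Real.pi_ne_zero
  simp only [finrank_euclideanSpace, Fintype.card_fin]
  push_cast
  rw [div_self two_ne_zero, Complex.cpow_one, Complex.I_sq]
  field_simp
  ring_nf

theorem hasFDerivAt_gauss (z : Plane) :
    HasFDerivAt gauss (-(gauss z) • (innerSL ℝ z : Plane →L[ℝ] ℝ)) z := by
  have h := (((hasStrictFDerivAt_norm_sq z).hasFDerivAt.const_mul (-(1 / 2) : ℝ)).exp).const_mul
    ((2 * Real.pi)⁻¹)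
  refine h.congr_fderiv ?_
  ext w
  simp [gauss]
  ring

theorem hasFDerivAt_cexp_inner (ξ z : Plane) :
    HasFDerivAt (fun z => Complex.exp (((inner ℝ ξ z : ℝ) : ℂ) * Complex.I))
      (Complex.exp (((inner ℝ ξ z : ℝ) : ℂ) * Complex.I) •
        ((Complex.ofRealCLM.comp (innerSL ℝ ξ)).smulRight Complex.I)) z := by
  have h1 : HasFDerivAt (fun z : Plane => ((inner ℝ ξ z : ℝ) : ℂ))
      (Complex.ofRealCLM.comp (innerSL ℝ ξ)) z :=
    (Complex.ofRealCLM.comp (innerSL ℝ ξ)).hasFDerivAt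
  refine ((h1.mul_const Complex.I).cexp).congr_fderiv ?_
  ext w
  simp [mul_comm]

theorem norm_cexp_inner (ξ z : Plane) :
    ‖Complex.exp (((inner ℝ ξ z : ℝ) : ℂ) * Complex.I)‖ = 1 := Complex.norm_exp_ofReal_mul_I _

theorem abs_apply_le_norm (z : Plane) (j : Fin 2) : |z j| ≤ ‖z‖ := by
  simpa using PiLp.norm_apply_le z j

theorem integrable_gauss : Integrable gauss := by
  simpa using integrable_pow_mul_exp_mul_gauss 0 0

theorem integrable_norm_mul_gauss : Integrable fun z => ‖z‖ * gauss z := by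
  simpa using integrable_pow_mul_exp_mul_gauss 1 0

theorem integrable_apply_mul_gauss (j : Fin 2) : Integrable fun z : Plane => z j * gauss z := by
  refine integrable_norm_mul_gauss.mono' ?_ (Filter.Eventually.of_forall fun z => ?_)
  · have := continuous_gauss
    exact Continuous.aestronglyMeasurable (by fun_prop)
  · rw [norm_mul, Real.norm_of_nonneg (gauss_pos z).le]
    exact mul_le_mul_of_nonneg_right (abs_apply_le_norm z j) (gauss_pos z).le

/-- Since `z_j g = -∂_j g`, integration by parts moves the derivative onto the character, which
brings out `i ξ_j`. -/
theorem integral_apply_mul_gauss_mul_mode (ξ : Plane) (j : Fin 2) :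
    ∫ z : Plane, ((z j * gauss z : ℝ) : ℂ) *
        Complex.exp (((inner ℝ ξ z : ℝ) : ℂ) * Complex.I)
      = Complex.I * ξ j * Real.exp (-(1 / 2) * ‖ξ‖ ^ 2) := by
  let E : Plane → ℂ := fun z => Complex.exp (((inner ℝ ξ z : ℝ) : ℂ) * Complex.I)
  have hE : Continuous E := by fun_prop
  have hbd : ∀ {f : Plane → ℝ}, Integrable f → Integrable fun z => (f z : ℂ) * E z :=
    fun hf => hf.ofReal.mul_bdd (c := 1) hE.aestronglyMeasurable
      (Filter.Eventually.of_forall fun z => (norm_cexp_inner ξ z).le)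
  have key := integral_bilinear_hasFDerivAt_right_eq_neg_left_of_integrable
    (μ := (volume : Measure Plane)) (B := ContinuousLinearMap.lsmul ℝ ℝ)
    (f := gauss) (f' := fun z => -(gauss z) • (innerSL ℝ z : Plane →L[ℝ] ℝ))
    (g := E) (g' := fun z => E z • ((Complex.ofRealCLM.comp (innerSL ℝ ξ)).smulRight Complex.I))
    (v := EuclideanSpace.single j 1) ?_ ?_ ?_ (fun z _ => hasFDerivAt_gauss z)
    (fun z _ => hasFDerivAt_cexp_inner ξ z)
  · simp only [ContinuousLinearMap.lsmul_apply, smul_apply, innerSL_apply_apply,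
      EuclideanSpace.inner_single_right, ContinuousLinearMap.smulRight_apply,
      ContinuousLinearMap.comp_apply] at key
    have e1 : ∀ z, gauss z • E z • Complex.ofRealCLM (1 * conj (ξ j)) • Complex.I
        = (Complex.I * ξ j) * ((gauss z : ℂ) * E z) := by
      intro z
      simp
      ring
    have e2 : ∀ z : Plane, (-gauss z • (1 * conj (z j))) • E z
        = -(((z j * gauss z : ℝ) : ℂ) * E z) := by
      intro z
      simp [mul_comm]
    simp_rw [e1, e2] at key
    rw [integral_const_mul, integral_gauss_mul_mode, integral_neg, neg_neg] at key
    exact key.symm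
  · refine (hbd (integrable_apply_mul_gauss j)).neg.congr (Filter.Eventually.of_forall fun z => ?_)
    simp [E, EuclideanSpace.inner_single_right]
    ring
  · refine ((hbd integrable_gauss).const_mul (Complex.I * ξ j)).congr
      (Filter.Eventually.of_forall fun z => ?_)
    simp [E, EuclideanSpace.inner_single_right]
    ring
  · refine (hbd integrable_gauss).congr (Filter.Eventually.of_forall fun z => ?_)
    simp [E]

/-! ### Two-point correlations and the third-order identity for the flux. -/

/-- `∫ z_j g(z) ⟨a(x), b(x + r z)⟩ dz`, the Gaussian average of a two-point correlation. -/
def corr (a b : Plane → ℝ) (r : ℝ) (j : Fin 2) : ℝ :=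
  ∫ z : Plane, z j * gauss z * mean fun x => a x * b (x + r • z)

theorem hasSum_mean_mul_shift {a b : Plane → ℝ} (ha : MemLp a 2 cellMeasure)
    (hb : MemLp b 2 cellMeasure) (hbp : IsPeriodic b) (h : Plane) :
    HasSum (fun k => coeff a k * conj (coeff b k) * conj (mode k h))
      ((mean fun x => a x * b (x + h) : ℝ) : ℂ) := by
  have := hasSum_coeff_mul_conj ha (memLp_shift hbp h hb)
  simp_rw [coeff_shift hbp] at this
  convert this using 2 with k
  rw [map_mul]
  ring

theorem summable_norm_coeff_mul {a b : Plane → ℝ} (ha : MemLp a 2 cellMeasure)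
    (hb : MemLp b 2 cellMeasure) : Summable fun k => ‖coeff a k‖ * ‖coeff b k‖ := by
  refine Summable.of_nonneg_of_le (fun k => by positivity) (fun k => ?_)
    (((hasSum_sq_coeff ha).summable.add (hasSum_sq_coeff hb).summable))
  nlinarith [sq_nonneg (‖coeff a k‖ - ‖coeff b k‖), sq_nonneg (‖coeff a k‖), sq_nonneg (‖coeff b k‖)]

/-- Parseval at each shift `r z`, followed by termwise integration in `z`. The exchange is
legitimate because the products `|â_k| |b̂_k|` are summable and the characters have modulus one. -/
theorem hasSum_corr {a b : Plane → ℝ} (ha : MemLp a 2 cellMeasure)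
    (hb : MemLp b 2 cellMeasure) (hbp : IsPeriodic b) (r : ℝ) (j : Fin 2) :
    HasSum (fun k : Fin 2 → ℤ => -(Complex.I * r * k j * Real.exp (-(1 / 2) * (r * ‖freq k‖) ^ 2)) *
      (coeff a k * conj (coeff b k))) (corr a b r j : ℂ) := by
  let F : (Fin 2 → ℤ) → Plane → ℂ := fun k z =>
    ((z j * gauss z : ℝ) : ℂ) * (coeff a k * conj (coeff b k) * conj (mode k (r • z)))
  have hconj : ∀ (k : Fin 2 → ℤ) (z : Plane), conj (mode k (r • z)) =
      Complex.exp (((inner ℝ (-(r • freq k)) z : ℝ) : ℂ) * Complex.I) := by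
    intro k z
    rw [conj_mode, inner_neg_left, real_inner_smul_left, real_inner_smul_right]
    push_cast
    ring_nf
  have hF : ∀ k, Integrable (F k) := by
    intro k
    refine (integrable_apply_mul_gauss j).ofReal.mul_bdd (c := ‖coeff a k‖ * ‖coeff b k‖) ?_ ?_
    · have := continuous_mode k
      exact Continuous.aestronglyMeasurable (by fun_prop)
    · exact Filter.Eventually.of_forall fun z => by simp [norm_mode]
  have hnorm : ∀ k z, ‖F k z‖ = ‖coeff a k‖ * ‖coeff b k‖ * ‖z j * gauss z‖ := by
    intro k z
    simp [F, norm_mode]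
    ring
  have hS : Summable fun k => ∫ z, ‖F k z‖ := by
    simp_rw [hnorm, integral_const_mul]
    exact (summable_norm_coeff_mul ha hb).mul_right _
  have key := hasSum_integral_of_summable_integral_norm hF hS
  have e1 : ∀ z, ∑' k, F k z = ((z j * gauss z * mean fun x => a x * b (x + r • z) : ℝ) : ℂ) := by
    intro z
    rw [tsum_mul_left, (hasSum_mean_mul_shift ha hb hbp (r • z)).tsum_eq]
    push_cast
    ring
  have e2 : ∀ k, ∫ z, F k z = -(Complex.I * r * k j * Real.exp (-(1 / 2) * (r * ‖freq k‖) ^ 2)) *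
      (coeff a k * conj (coeff b k)) := by
    intro k
    have : ∀ z, F k z = (coeff a k * conj (coeff b k)) * (((z j * gauss z : ℝ) : ℂ) *
        Complex.exp (((inner ℝ (-(r • freq k)) z : ℝ) : ℂ) * Complex.I)) := by
      intro z
      rw [← hconj]
      simp only [F]
      ring
    simp_rw [this]
    rw [integral_const_mul, integral_apply_mul_gauss_mul_mode, norm_neg, norm_smul,
      Real.norm_eq_abs, mul_pow, sq_abs, ← mul_pow]
    simp [freq]
    ring
  simp_rw [e1, e2] at key
  rw [integral_complex_ofReal] at key
  exact key

/-- The kernel `z_j g(z)` is odd, so its multiplier is purely imaginary: exchanging the functions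
conjugates every term of the series up to a sign, and the sum is real. -/
theorem corr_swap {a b : Plane → ℝ} (ha : MemLp a 2 cellMeasure)
    (hb : MemLp b 2 cellMeasure) (hap : IsPeriodic a) (hbp : IsPeriodic b) (r : ℝ) (j : Fin 2) :
    corr a b r j = -corr b a r j := by
  have h1 := ((hasSum_corr hb ha hap r j).map (starRingEnd ℂ) Complex.continuous_conj).neg
  have h2 := hasSum_corr ha hb hbp r j
  have h3 : (fun k : Fin 2 → ℤ => -(Complex.I * r * k j *
        Real.exp (-(1 / 2) * (r * ‖freq k‖) ^ 2)) * (coeff a k * conj (coeff b k))) =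
      fun k : Fin 2 → ℤ => -((starRingEnd ℂ) ∘ fun k : Fin 2 → ℤ => -(Complex.I * r * k j *
        Real.exp (-(1 / 2) * (r * ‖freq k‖) ^ 2)) * (coeff b k * conj (coeff a k))) k := by
    funext k
    simp only [Function.comp, map_mul, map_neg, Complex.conj_ofReal, Complex.conj_I,
      Complex.conj_conj, map_intCast]
    ring
  rw [← h3, Complex.conj_ofReal] at h1
  exact_mod_cast h2.unique h1

/-- Bounded, continuous and periodic functions. -/
structure BddPeriodic (a : Plane → ℝ) : Prop where
  cont : Continuous a
  periodic : IsPeriodic a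
  bdd : ∃ M : ℝ, ∀ x, |a x| ≤ M

theorem BddPeriodic.mul {a b : Plane → ℝ} (ha : BddPeriodic a) (hb : BddPeriodic b) :
    BddPeriodic fun x => a x * b x := by
  obtain ⟨M, hM⟩ := ha.bdd
  obtain ⟨N, hN⟩ := hb.bdd
  refine ⟨ha.cont.mul hb.cont, fun x k => by simp only [ha.periodic x k, hb.periodic x k],
    M * N, fun x => ?_⟩
  rw [abs_mul]
  exact mul_le_mul (hM x) (hN x) (abs_nonneg _) ((abs_nonneg _).trans (hM x))

theorem BddPeriodic.sub {a b : Plane → ℝ} (ha : BddPeriodic a) (hb : BddPeriodic b) :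
    BddPeriodic fun x => a x - b x := by
  obtain ⟨M, hM⟩ := ha.bdd
  obtain ⟨N, hN⟩ := hb.bdd
  exact ⟨ha.cont.sub hb.cont, fun x k => by simp only [ha.periodic x k, hb.periodic x k],
    M + N, fun x => (abs_sub _ _).trans (add_le_add (hM x) (hN x))⟩

theorem BddPeriodic.shift {a : Plane → ℝ} (ha : BddPeriodic a) (h : Plane) :
    BddPeriodic fun x => a (x + h) := by
  obtain ⟨M, hM⟩ := ha.bdd
  exact ⟨ha.cont.comp (by fun_prop), ha.periodic.shift h, M, fun x => hM _⟩

theorem BddPeriodic.memLp {a : Plane → ℝ} (ha : BddPeriodic a) (p : ENNReal) :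
    MemLp a p cellMeasure := by
  obtain ⟨M, hM⟩ := ha.bdd
  exact MemLp.of_bound ha.cont.aestronglyMeasurable M (Filter.Eventually.of_forall hM)

theorem BddPeriodic.integrable {a : Plane → ℝ} (ha : BddPeriodic a) :
    Integrable a cellMeasure := memLp_one_iff_integrable.1 (ha.memLp 1)

theorem BddPeriodic.integrable_mean {a b : Plane → ℝ} (ha : BddPeriodic a) (hb : BddPeriodic b)
    (r : ℝ) (j : Fin 2) :
    Integrable fun z : Plane => z j * gauss z * mean fun x => a x * b (x + r • z) := by
  obtain ⟨M, hM⟩ := ha.bdd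
  obtain ⟨N, hN⟩ := hb.bdd
  simp_rw [mean_eq_integral]
  refine (integrable_apply_mul_gauss j).mul_bdd (c := M * N) ?_
    (Filter.Eventually.of_forall fun z => ?_)
  · have := ha.cont
    have := hb.cont
    have h : Continuous fun p : Plane × Plane => a p.2 * b (p.2 + r • p.1) := by fun_prop
    exact h.stronglyMeasurable.integral_prod_right.aestronglyMeasurable
  · refine (norm_integral_le_of_norm_le_const (C := M * N)
      (Filter.Eventually.of_forall fun x => ?_)).trans (by simp)
    rw [norm_mul]
    exact mul_le_mul (hM x) (hN _) (abs_nonneg _) ((abs_nonneg _).trans (hM x))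

theorem integral_sum_const_mul {X ι : Type*} [MeasurableSpace X] [Fintype ι] {μ : Measure X}
    (c : ι → ℝ) {f : ι → X → ℝ} (hf : ∀ i, Integrable (f i) μ) :
    ∫ x, ∑ i, c i * f i x ∂μ = ∑ i, c i * ∫ x, f i x ∂μ := by
  rw [integral_finsetSum _ fun i _ => (hf i).const_mul (c i)]
  simp_rw [integral_const_mul]

/-- The flux of `|φ̂_k|²` produced by the transport term `u·∇φ`. -/
def flux (φ : Plane → ℝ) (u : Plane → Plane) (k : Fin 2 → ℤ) : ℝ :=
  (-(Complex.I * ∑ j, (k j : ℂ) * coeff (fun x => φ x * u x j) k) * conj (coeff φ k)).re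

/-- The Gaussian weight `e^{-(rκ)²/2}`. -/
def gaussWeight (r κ : ℝ) : ℝ := Real.exp (-(1 / 2) * (r * κ) ^ 2)

/-- The divergence in the flux contributes `i k_j`, which is the multiplier of the odd Gaussian
kernel of width `r` up to the Gaussian weight and one factor of `r`; hence the `r⁻¹`. -/
theorem hasSum_flux_eq_corr {φ : Plane → ℝ} {u : Plane → Plane} (hφ : BddPeriodic φ)
    (hu : ∀ j, BddPeriodic fun x => u x j) {r : ℝ} (hr : 0 < r) :
    HasSum (fun k => gaussWeight r ‖freq k‖ * flux φ u k)
      (r⁻¹ * ∑ j, corr (fun x => φ x * u x j) φ r j) := by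
  have h := fun j => Complex.hasSum_re (hasSum_corr ((hφ.mul (hu j)).memLp 2) (hφ.memLp 2)
    hφ.periodic r j)
  have h2 := (hasSum_sum fun j (_ : j ∈ Finset.univ) => h j).mul_left r⁻¹
  simp only [Complex.ofReal_re] at h2
  refine h2.congr_fun fun k => ?_
  have hr' : (r : ℂ) ≠ 0 := by exact_mod_cast hr.ne'
  rw [flux, gaussWeight, ← Complex.re_sum, ← Complex.re_ofReal_mul, ← Complex.re_ofReal_mul]
  congr 1
  simp only [Fin.sum_univ_two]
  push_cast
  field_simp
  ring

theorem BddPeriodic.mean_shift_mul_shift {a b : Plane → ℝ} (ha : BddPeriodic a)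
    (hb : BddPeriodic b) (h : Plane) :
    mean (fun x => a (x + h) * b (x + h)) = mean fun x => a x * b x :=
  mean_shift (ha.mul hb).periodic h

/-- The Kármán–Howarth–Monin relation: the flux in terms of third-order increments. -/
theorem hasSum_flux {φ : Plane → ℝ} {u : Plane → Plane} (hφ : BddPeriodic φ)
    (hu : ∀ j, BddPeriodic fun x => u x j)
    (hdiv : ∀ k : Fin 2 → ℤ, ∑ j, (k j : ℂ) * coeff (fun x => u x j) k = 0) {r : ℝ} (hr : 0 < r) :
    HasSum (fun k => gaussWeight r ‖freq k‖ * flux φ u k)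
      ((4 * r)⁻¹ * ∑ j, ∫ z : Plane, z j * gauss z * mean fun x =>
        (u (x + r • z) j - u x j) * (φ (x + r • z) - φ x) ^ 2) := by
  have hφφ := hφ.mul hφ
  have huφ := fun j => hφ.mul (hu j)
  -- Of the six monomials in the expanded cubic increment, the two with all factors at the same
  -- point cancel by translation invariance. The mixed terms carrying `φ u` combine through
  -- antisymmetry into four times one correlation.
  have e1 : ∀ j, (∫ z : Plane, z j * gauss z * mean fun x =>
        (u (x + r • z) j - u x j) * (φ (x + r • z) - φ x) ^ 2) =
      4 * corr (fun x => φ x * u x j) φ r j + corr (fun x => φ x * φ x) (fun x => u x j) r j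
        - corr (fun x => u x j) (fun x => φ x * φ x) r j := by
    intro j
    have hm : ∀ h : Plane, (mean fun x => (u (x + h) j - u x j) * (φ (x + h) - φ x) ^ 2) =
        (mean fun x => (φ x * φ x) * u (x + h) j) - (mean fun x => u x j * (φ (x + h) * φ (x + h)))
        + 2 * (mean fun x => (φ x * u x j) * φ (x + h))
        - 2 * (mean fun x => φ x * (φ (x + h) * u (x + h) j)) := by
      intro h
      have hc := BddPeriodic.mean_shift_mul_shift hφφ (hu j) h
      have i1 := (hφφ.mul ((hu j).shift h)).integrable
      have i2 := ((hu j).mul (hφφ.shift h)).integrable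
      have i3 := ((huφ j).mul (hφ.shift h)).integrable
      have i4 := (hφ.mul ((huφ j).shift h)).integrable
      have i5 := ((hφφ.mul (hu j)).shift h).integrable
      have i6 := (hφφ.mul (hu j)).integrable
      simp only [mean_eq_integral] at hc ⊢
      have key := integral_sum_const_mul (μ := cellMeasure) ![1, -1, 2, -2, 1, -1]
        (f := ![_, _, _, _, _, _]) (by
          intro i
          fin_cases i
          exacts [i1, i2, i3, i4, i5, i6])
      simp only [Fin.sum_univ_six, Matrix.cons_val] at key
      rw [hc] at key
      refine Eq.trans ?_ (key.trans (by ring))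
      congr 1
      funext x
      ring
    simp_rw [hm]
    have c1 := hφφ.integrable_mean (hu j) r j
    have c2 := (hu j).integrable_mean hφφ r j
    have c3 := (huφ j).integrable_mean hφ r j
    have c4 := hφ.integrable_mean (huφ j) r j
    have hs := corr_swap (hφ.memLp 2) ((huφ j).memLp 2) hφ.periodic (huφ j).periodic r j
    have : 4 * corr (fun x => φ x * u x j) φ r j = 2 * corr (fun x => φ x * u x j) φ r j
        - 2 * corr φ (fun x => φ x * u x j) r j := by rw [hs]; ring
    rw [this]
    simp only [corr]
    have key := integral_sum_const_mul (μ := (volume : Measure Plane)) ![1, -1, 2, -2]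
      (f := ![_, _, _, _]) (by
        intro i
        fin_cases i
        exacts [c1, c2, c3, c4])
    simp only [Fin.sum_univ_four, Matrix.cons_val] at key
    refine Eq.trans ?_ (key.trans (by ring))
    congr 1
    funext z
    ring
  -- Summed over `j`, the correlation of `φ²` with `u` contains `k · û_k`, which vanishes.
  have e2 : ∑ j, corr (fun x => φ x * φ x) (fun x => u x j) r j = 0 := by
    have h := hasSum_sum fun j (_ : j ∈ Finset.univ) =>
      hasSum_corr (hφφ.memLp 2) ((hu j).memLp 2) (hu j).periodic r j
    have h0 : ∀ k : Fin 2 → ℤ, ∑ j, -(Complex.I * r * k j *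
        Real.exp (-(1 / 2) * (r * ‖freq k‖) ^ 2)) *
        (coeff (fun x => φ x * φ x) k * conj (coeff (fun x => u x j) k)) = 0 := by
      intro k
      have := congrArg conj (hdiv k)
      simp only [Fin.sum_univ_two, map_add, map_mul, map_intCast, map_zero] at this ⊢
      linear_combination (-(Complex.I * r * Real.exp (-(1 / 2) * (r * ‖freq k‖) ^ 2)) *
        coeff (fun x => φ x * φ x) k) * this
    simp_rw [h0] at h
    exact_mod_cast h.unique hasSum_zero
  have e3 : ∑ j, corr (fun x => u x j) (fun x => φ x * φ x) r j = 0 := by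
    have : ∀ j, corr (fun x => u x j) (fun x => φ x * φ x) r j =
        -corr (fun x => φ x * φ x) (fun x => u x j) r j := fun j =>
      corr_swap ((hu j).memLp 2) (hφφ.memLp 2) (hu j).periodic hφφ.periodic r j
    simp_rw [this]
    rw [Finset.sum_neg_distrib, e2, neg_zero]
  convert hasSum_flux_eq_corr hφ hu hr using 1
  simp_rw [e1]
  rw [Finset.sum_sub_distrib, Finset.sum_add_distrib, e2, e3, ← Finset.mul_sum]
  field_simp
  ring

/-! ### Third moments of increments and the Marchaud inequality. -/

theorem lintegral_Ioi_comp_mul {c : ℝ} (hc : 0 < c) (ε : ℝ) (G : ℝ → ENNReal) :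
    ∫⁻ r in Set.Ioi (c * ε), G r = ENNReal.ofReal c * ∫⁻ r in Set.Ioi ε, G (c * r) := by
  have himg : (fun r => c * r) '' Set.Ioi ε = Set.Ioi (c * ε) := by
    rw [Set.image_mul_left_Ioi hc]
  rw [← himg, lintegral_image_eq_lintegral_abs_deriv_mul measurableSet_Ioi (f' := fun _ => c)
    (fun x _ => by simpa using ((hasDerivAt_id x).const_mul c).hasDerivWithinAt)
    (mul_right_injective₀ hc.ne').injOn, ← lintegral_const_mul' _ _ ENNReal.ofReal_ne_top,
    abs_of_pos hc]

theorem lintegral_Ioi_rpow_mul_comp_two_mul {ε : ℝ} (hε : 0 ≤ ε) (p : ℝ) (F : ℝ → ENNReal) :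
    ∫⁻ r in Set.Ioi ε, ENNReal.ofReal (r ^ (-p)) * F (2 * r) =
      ENNReal.ofReal (2 ^ (p - 1)) *
        ∫⁻ r in Set.Ioi (2 * ε), ENNReal.ofReal (r ^ (-p)) * F r := by
  rw [lintegral_Ioi_comp_mul two_pos, ← mul_assoc, ← ENNReal.ofReal_mul (by positivity),
    ← lintegral_const_mul' _ _ ENNReal.ofReal_ne_top]
  refine setLIntegral_congr_fun measurableSet_Ioi fun r hr => ?_
  have hr0 : 0 < r := hε.trans_lt hr
  rw [← mul_assoc, ← ENNReal.ofReal_mul (by positivity), Real.mul_rpow two_pos.le hr0.le]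
  congr 2
  have : (2 : ℝ) ^ (p - 1) * 2 * 2 ^ (-p) = 1 := by
    rw [Real.rpow_sub_one two_ne_zero, Real.rpow_neg two_pos.le]
    field_simp
  rw [← mul_assoc, this, one_mul]

/-- Convexity of the cube with unequal weights `s` and `1-s`. Taking `s` close to one brings the
coefficient of `a³` close to `1/8`, at the expense of that of `b³`. -/
theorem half_add_cube_le {s a b : ℝ} (hs : 0 < s) (hs1 : s < 1) (ha : 0 ≤ a) (hb : 0 ≤ b) :
    ((a + b) / 2) ^ 3 ≤ s⁻¹ ^ 2 / 8 * a ^ 3 + (1 - s)⁻¹ ^ 2 / 8 * b ^ 3 := by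
  have h1s : 0 < 1 - s := by linarith
  have := (convexOn_pow 3).2 (x := a / (2 * s)) (y := b / (2 * (1 - s))) (by simp; positivity)
    (by simp; positivity) hs.le h1s.le (by ring)
  simp only [smul_eq_mul] at this
  have e1 : s * (a / (2 * s)) + (1 - s) * (b / (2 * (1 - s))) = (a + b) / 2 := by field_simp
  have e2 : s * (a / (2 * s)) ^ 3 = s⁻¹ ^ 2 / 8 * a ^ 3 := by field_simp; norm_num
  have e3 : (1 - s) * (b / (2 * (1 - s))) ^ 3 = (1 - s)⁻¹ ^ 2 / 8 * b ^ 3 := by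
    field_simp; norm_num
  rwa [e1, e2, e3] at this

/-- The first increment. -/
def inc (a : Plane → ℝ) (h x : Plane) : ℝ := a (x + h) - a x

/-- The second increment. -/
def inc2 (a : Plane → ℝ) (h x : Plane) : ℝ := inc a h (x + h) - inc a h x

/-- A first increment of step `h` is half the difference between the increment of step `2h` and the
second increment of step `h`. -/
theorem abs_inc_cube_le (a : Plane → ℝ) (h x : Plane) {s : ℝ} (hs : 0 < s) (hs1 : s < 1) :
    |inc a h x| ^ 3 ≤ s⁻¹ ^ 2 / 8 * |inc a ((2 : ℝ) • h) x| ^ 3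
      + (1 - s)⁻¹ ^ 2 / 8 * |inc2 a h x| ^ 3 := by
  refine le_trans ?_ (half_add_cube_le hs hs1 (abs_nonneg _) (abs_nonneg _))
  gcongr
  have : inc a h x = (inc a ((2 : ℝ) • h) x - inc2 a h x) / 2 := by
    simp only [inc, inc2, two_smul, add_assoc]
    ring
  rw [this, abs_div, abs_two]
  gcongr
  exact abs_sub _ _

theorem BddPeriodic.continuous_inc {a : Plane → ℝ} (ha : BddPeriodic a) {X : Type*}
    [TopologicalSpace X] {h x : X → Plane} (hh : Continuous h) (hx : Continuous x) :
    Continuous fun t => inc a (h t) (x t) := by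
  have := ha.cont
  unfold inc
  fun_prop

/-- The third absolute moment of the first increment. -/
def moment (a : Plane → ℝ) (h : Plane) : ENNReal :=
  ∫⁻ x, ENNReal.ofReal (|inc a h x| ^ 3) ∂cellMeasure

/-- The third absolute moment of the second increment. -/
def moment2 (a : Plane → ℝ) (h : Plane) : ENNReal :=
  ∫⁻ x, ENNReal.ofReal (|inc2 a h x| ^ 3) ∂cellMeasure

theorem BddPeriodic.moment_le {a : Plane → ℝ} (ha : BddPeriodic a) (h : Plane) {s : ℝ}
    (hs : 0 < s) (hs1 : s < 1) :
    moment a h ≤ ENNReal.ofReal (s⁻¹ ^ 2 / 8) * moment a ((2 : ℝ) • h)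
      + ENNReal.ofReal ((1 - s)⁻¹ ^ 2 / 8) * moment2 a h := by
  unfold moment moment2
  have c1 : Continuous fun x => inc a ((2 : ℝ) • h) x :=
    ha.continuous_inc continuous_const continuous_id
  rw [← lintegral_const_mul' _ _ ENNReal.ofReal_ne_top,
    ← lintegral_const_mul' _ _ ENNReal.ofReal_ne_top, ← lintegral_add_left (by fun_prop)]
  refine lintegral_mono fun x => ?_
  have : 0 < 1 - s := by linarith
  rw [← ENNReal.ofReal_mul (by positivity), ← ENNReal.ofReal_mul (by positivity),
    ← ENNReal.ofReal_add (by positivity) (by positivity)]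
  exact ENNReal.ofReal_le_ofReal (abs_inc_cube_le a h x hs hs1)

theorem BddPeriodic.exists_moment_le {a : Plane → ℝ} (ha : BddPeriodic a) :
    ∃ M : ℝ, ∀ h, moment a h ≤ ENNReal.ofReal M := by
  obtain ⟨M, hM⟩ := ha.bdd
  refine ⟨(M + M) ^ 3, fun h => ?_⟩
  refine (lintegral_mono (g := fun _ => ENNReal.ofReal ((M + M) ^ 3)) fun x => ?_).trans (by simp)
  refine ENNReal.ofReal_le_ofReal ?_
  have : |inc a h x| ≤ M + M := (abs_sub _ _).trans (add_le_add (hM _) (hM _))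
  gcongr

theorem BddPeriodic.measurable_moment {a : Plane → ℝ} (ha : BddPeriodic a) :
    Measurable (moment a) := by
  have h : Continuous fun p : Plane × Plane => inc a p.1 p.2 :=
    ha.continuous_inc continuous_fst continuous_snd
  have h2 : Measurable fun p : Plane × Plane => ENNReal.ofReal (|inc a p.1 p.2| ^ 3) := by
    fun_prop
  exact h2.lintegral_prod_right' (ν := cellMeasure)

theorem lintegral_Ioi_rpow_ne_top {ε p : ℝ} (hε : 0 < ε) (hp : 1 < p) :
    ∫⁻ r in Set.Ioi ε, ENNReal.ofReal (r ^ (-p)) ≠ ⊤ :=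
  ((integrableOn_Ioi_rpow_of_lt (by linarith) hε).lintegral_lt_top).ne

/-- A Marchaud type inequality: weighted third moments of first increments are controlled by those
of second increments. -/
theorem BddPeriodic.lintegral_moment_le {α : ℝ} (hα : α ∈ Set.Ioo (0 : ℝ) 1) :
    ∃ C : ℝ, 0 < C ∧ ∀ a, BddPeriodic a → ∀ z : Plane,
      ∫⁻ r in Set.Ioi (0 : ℝ), ENNReal.ofReal (r ^ (-(2 + 2 * α))) * moment a (r • z) ≤
        ENNReal.ofReal C *
          ∫⁻ r in Set.Ioi (0 : ℝ), ENNReal.ofReal (r ^ (-(2 + 2 * α))) * moment2 a (r • z) := by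
  obtain ⟨hα0, hα1⟩ := hα
  -- With this `s`, the coefficient `s⁻²/8` times the factor `2^{1+2α}` from the dilation `r ↦ 2r`
  -- equals `2^{α-1} < 1`. This contraction is where `α < 1` is used.
  set s : ℝ := 2 ^ ((α - 1) / 2) with hs
  have hs0 : 0 < s := by positivity
  have hs1 : s < 1 := Real.rpow_lt_one_of_one_lt_of_neg one_lt_two (by linarith)
  set L : ℝ := s⁻¹ ^ 2 / 8 * 2 ^ (2 + 2 * α - 1) with hL
  have hLeq : L = 2 ^ (α - 1) := by
    have h8 : (8 : ℝ) = 2 ^ (3 : ℝ) := by norm_num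
    rw [hL, hs, ← Real.rpow_neg two_pos.le, ← Real.rpow_natCast, ← Real.rpow_mul two_pos.le, h8,
      ← Real.rpow_sub two_pos, ← Real.rpow_add two_pos]
    congr 1
    push_cast
    ring
  have hL1 : L < 1 := by
    rw [hLeq]; exact Real.rpow_lt_one_of_one_lt_of_neg one_lt_two (by linarith)
  have hL0 : 0 ≤ L := by rw [hLeq]; positivity
  have h1s : 0 < 1 - s := by linarith
  set B : ℝ := (1 - s)⁻¹ ^ 2 / 8 with hB
  have hB0 : 0 < B := by positivity
  refine ⟨B / (1 - L), div_pos hB0 (by linarith), fun a ha z => ?_⟩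
  set D := ∫⁻ r in Set.Ioi (0 : ℝ), ENNReal.ofReal (r ^ (-(2 + 2 * α))) * moment2 a (r • z)
  set I : ℝ → ENNReal := fun ε =>
    ∫⁻ r in Set.Ioi ε, ENNReal.ofReal (r ^ (-(2 + 2 * α))) * moment a (r • z) with hI
  have hmeas : Measurable fun r : ℝ => moment a (r • z) :=
    ha.measurable_moment.comp (by fun_prop)
  have key : ∀ ε : ℝ, 0 < ε → I ε ≤ ENNReal.ofReal (B / (1 - L)) * D := by
    intro ε hε
    -- The truncation makes `I ε` finite, so that `L * I ε` can be subtracted from both sides; the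
    -- resulting bound does not depend on `ε`.
    have hfin : I ε ≠ ⊤ := by
      obtain ⟨M, hM⟩ := ha.exists_moment_le
      refine ne_top_of_le_ne_top (b := (∫⁻ r in Set.Ioi ε, ENNReal.ofReal (r ^ (-(2 + 2 * α)))) *
        ENNReal.ofReal M) ?_ ?_
      · exact ENNReal.mul_ne_top (lintegral_Ioi_rpow_ne_top hε (by linarith)) ENNReal.ofReal_ne_top
      · rw [← lintegral_mul_const' _ _ ENNReal.ofReal_ne_top]
        exact lintegral_mono fun r => by gcongr; exact hM _
    have step : I ε ≤ ENNReal.ofReal L * I ε + ENNReal.ofReal B * D := by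
      calc I ε ≤ ∫⁻ r in Set.Ioi ε, (ENNReal.ofReal (s⁻¹ ^ 2 / 8) *
            (ENNReal.ofReal (r ^ (-(2 + 2 * α))) * moment a ((2 * r) • z)) +
            ENNReal.ofReal B * (ENNReal.ofReal (r ^ (-(2 + 2 * α))) * moment2 a (r • z))) := by
            refine lintegral_mono fun r => ?_
            calc _ ≤ ENNReal.ofReal (r ^ (-(2 + 2 * α))) *
                  (ENNReal.ofReal (s⁻¹ ^ 2 / 8) * moment a ((2 : ℝ) • r • z)
                    + ENNReal.ofReal B * moment2 a (r • z)) := by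
                  gcongr
                  exact ha.moment_le _ hs0 hs1
              _ = _ := by rw [smul_smul]; ring
        _ = ENNReal.ofReal (s⁻¹ ^ 2 / 8) * (ENNReal.ofReal (2 ^ (2 + 2 * α - 1)) * I (2 * ε)) +
            ENNReal.ofReal B * ∫⁻ r in Set.Ioi ε,
              (ENNReal.ofReal (r ^ (-(2 + 2 * α))) * moment2 a (r • z)) := by
            rw [lintegral_add_left, lintegral_const_mul' _ _ ENNReal.ofReal_ne_top,
              lintegral_const_mul' _ _ ENNReal.ofReal_ne_top,
              lintegral_Ioi_rpow_mul_comp_two_mul hε.le (2 + 2 * α) fun r => moment a (r • z)]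
            have : Measurable fun r : ℝ => moment a ((2 * r) • z) :=
              ha.measurable_moment.comp (by fun_prop)
            fun_prop
        _ ≤ _ := by
            rw [← mul_assoc, ← ENNReal.ofReal_mul (by positivity), ← hL]
            gcongr
            · exact lintegral_mono_set (Set.Ioi_subset_Ioi (by linarith))
            · exact lintegral_mono_set (Set.Ioi_subset_Ioi hε.le)
    have hsub : ENNReal.ofReal (1 - L) * I ε ≤ ENNReal.ofReal B * D := by
      rw [ENNReal.ofReal_sub _ hL0, ENNReal.ofReal_one,
        ENNReal.sub_mul fun _ _ => hfin, one_mul]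
      exact tsub_le_iff_left.2 step
    have h1L : 0 < 1 - L := by linarith
    calc I ε = ENNReal.ofReal (1 - L)⁻¹ * (ENNReal.ofReal (1 - L) * I ε) := by
          rw [← mul_assoc, ← ENNReal.ofReal_mul (by positivity), inv_mul_cancel₀ h1L.ne',
            ENNReal.ofReal_one, one_mul]
      _ ≤ ENNReal.ofReal (1 - L)⁻¹ * (ENNReal.ofReal B * D) := by gcongr
      _ = _ := by
          rw [← mul_assoc, ← ENNReal.ofReal_mul (by positivity)]
          congr 2
          ring
  have hunion : Set.Ioi (0 : ℝ) = ⋃ n : ℕ, Set.Ioi (1 / ((n : ℝ) + 1)) := by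
    ext r
    simp only [Set.mem_Ioi, Set.mem_iUnion]
    exact ⟨fun hr => exists_nat_one_div_lt hr, fun ⟨n, hn⟩ => lt_trans (by positivity) hn⟩
  rw [hunion, setLIntegral_iUnion_of_directed]
  · exact iSup_le fun n => key _ (by positivity)
  · exact directed_of_isDirected_le fun m n hmn =>
      Set.Ioi_subset_Ioi (one_div_le_one_div_of_le (by positivity) (by gcongr))

/-! ### Second increments in Fourier variables. -/

/-- Scale invariant integral bounding the second increments of a single mode. -/
theorem lintegral_Ioi_rpow_mul_min_le {μ : ℝ} (h1 : 1 < μ) (h5 : μ < 5) {t : ℝ} (ht : 0 ≤ t) :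
    ∫⁻ r in Set.Ioi (0 : ℝ), ENNReal.ofReal (r ^ (-μ)) * ENNReal.ofReal (min 16 ((r * t) ^ 4)) ≤
      ENNReal.ofReal ((1 / (5 - μ) + 16 / (μ - 1)) * t ^ (μ - 1)) := by
  have h51 : 0 < 5 - μ := by linarith
  have h11 : 0 < μ - 1 := by linarith
  rcases ht.eq_or_lt with rfl | ht
  · simp
  -- The split is at the wavelength scale: below `t⁻¹` the fourth power is integrable since `μ < 5`,
  -- above it the constant suffices since `μ > 1`, and both pieces scale like `t^{μ-1}`.
  have hu : Set.Ioi (0 : ℝ) = Set.Ioc 0 t⁻¹ ∪ Set.Ioi t⁻¹ :=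
    (Set.Ioc_union_Ioi_eq_Ioi (by positivity)).symm
  rw [hu]
  refine (lintegral_union_le _ _ _).trans ?_
  rw [add_mul, ENNReal.ofReal_add (by positivity) (by positivity)]
  refine add_le_add ?_ ?_
  · have hint : IntegrableOn (fun r : ℝ => t ^ 4 * r ^ (4 - μ)) (Set.Ioc 0 t⁻¹) := by
      refine Integrable.const_mul ?_ _
      exact (intervalIntegrable_iff_integrableOn_Ioc_of_le (by positivity)).1
        (intervalIntegral.intervalIntegrable_rpow' (by linarith))
    calc _ ≤ ∫⁻ r in Set.Ioc 0 t⁻¹, ENNReal.ofReal (t ^ 4 * r ^ (4 - μ)) := by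
          refine setLIntegral_mono' measurableSet_Ioc fun r hr => ?_
          have hr0 : 0 < r := hr.1
          rw [← ENNReal.ofReal_mul (by positivity)]
          refine ENNReal.ofReal_le_ofReal ?_
          calc _ ≤ r ^ (-μ) * (r * t) ^ 4 := by gcongr; exact min_le_right _ _
            _ = _ := by
              have : r ^ (4 - μ) = r ^ 4 * r ^ (-μ) := by
                rw [sub_eq_add_neg, Real.rpow_add hr0]; norm_cast
              rw [this]; ring
      _ = ENNReal.ofReal (∫ r in Set.Ioc 0 t⁻¹, t ^ 4 * r ^ (4 - μ)) := by
          rw [ofReal_integral_eq_lintegral_ofReal hint]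
          refine (ae_restrict_iff' measurableSet_Ioc).2 (Filter.Eventually.of_forall fun r hr => ?_)
          have hr0 : 0 < r := hr.1
          simp only [Pi.zero_apply]
          positivity
      _ ≤ _ := by
          refine ENNReal.ofReal_le_ofReal (le_of_eq ?_)
          rw [integral_const_mul, ← intervalIntegral.integral_of_le (by positivity),
            integral_rpow (Or.inl (by linarith)), Real.zero_rpow (by linarith), sub_zero,
            Real.inv_rpow ht.le, ← Real.rpow_neg ht.le, mul_div_assoc']
          have : t ^ 4 * t ^ (-(4 - μ + 1)) = t ^ (μ - 1) := by
            rw [← Real.rpow_natCast, ← Real.rpow_add ht]; congr 1; push_cast; ring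
          rw [this]
          ring
  · have hint : IntegrableOn (fun r : ℝ => 16 * r ^ (-μ)) (Set.Ioi t⁻¹) :=
      (integrableOn_Ioi_rpow_of_lt (by linarith) (by positivity)).const_mul _
    calc _ ≤ ∫⁻ r in Set.Ioi t⁻¹, ENNReal.ofReal (16 * r ^ (-μ)) := by
          refine setLIntegral_mono' measurableSet_Ioi fun r hr => ?_
          have hr0 : 0 < r := lt_trans (by positivity) hr
          rw [← ENNReal.ofReal_mul (by positivity), mul_comm]
          gcongr
          exact min_le_left _ _
      _ = ENNReal.ofReal (∫ r in Set.Ioi t⁻¹, 16 * r ^ (-μ)) := by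
          rw [ofReal_integral_eq_lintegral_ofReal hint]
          refine (ae_restrict_iff' measurableSet_Ioi).2 (Filter.Eventually.of_forall fun r hr => ?_)
          have hr0 : 0 < r := lt_trans (by positivity) hr
          simp only [Pi.zero_apply]
          positivity
      _ ≤ _ := by
          refine ENNReal.ofReal_le_ofReal (le_of_eq ?_)
          rw [integral_const_mul, integral_Ioi_rpow_of_lt (by linarith) (by positivity),
            Real.inv_rpow ht.le, ← Real.rpow_neg ht.le]
          have : t ^ (-(-μ + 1)) = t ^ (μ - 1) := by congr 1; ring
          rw [this, show -μ + 1 = -(μ - 1) by ring]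
          field_simp

theorem norm_mode_sub_one_pow_le (k : Fin 2 → ℤ) (z : Plane) {r : ℝ} (hr : 0 < r) :
    ‖mode k (r • z) - 1‖ ^ 4 ≤ min 16 ((r * (‖freq k‖ * ‖z‖)) ^ 4) := by
  have h1 : ‖mode k (r • z) - 1‖ ≤ 2 := by
    refine (norm_sub_le _ _).trans ?_
    rw [norm_mode]
    norm_num
  have h2 : ‖mode k (r • z) - 1‖ ≤ r * (‖freq k‖ * ‖z‖) := by
    rw [mode, mul_comm]
    refine (Real.norm_exp_I_mul_ofReal_sub_one_le).trans ?_
    rw [real_inner_smul_right, norm_mul, Real.norm_of_nonneg hr.le]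
    gcongr
    exact abs_real_inner_le_norm _ _
  refine le_min ?_ ?_
  · calc _ ≤ (2 : ℝ) ^ 4 := by gcongr
      _ = 16 := by norm_num
  · gcongr

theorem BddPeriodic.inc {a : Plane → ℝ} (ha : BddPeriodic a) (h : Plane) : BddPeriodic (inc a h) :=
  (ha.shift h).sub ha

theorem BddPeriodic.inc2 {a : Plane → ℝ} (ha : BddPeriodic a) (h : Plane) :
    BddPeriodic (inc2 a h) := (ha.inc h).inc h

theorem BddPeriodic.coeff_inc {a : Plane → ℝ} (ha : BddPeriodic a) (h : Plane) (k : Fin 2 → ℤ) :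
    coeff (SQG.inc a h) k = (mode k h - 1) * coeff a k := by
  have := coeff_sub (ha.shift h).integrable ha.integrable k
  rw [coeff_shift ha.periodic] at this
  exact this.trans (by ring)

theorem BddPeriodic.lintegral_sq_inc2 {a : Plane → ℝ} (ha : BddPeriodic a) (h : Plane) :
    ∫⁻ x, ENNReal.ofReal (SQG.inc2 a h x ^ 2) ∂cellMeasure =
      ∑' k, ENNReal.ofReal (‖mode k h - 1‖ ^ 4) * ENNReal.ofReal (‖coeff a k‖ ^ 2) := by
  have hs := hasSum_sq_coeff ((ha.inc2 h).memLp 2)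
  rw [← ofReal_integral_eq_lintegral_ofReal ((ha.inc2 h).memLp 2).integrable_sq
    (Filter.Eventually.of_forall fun x => sq_nonneg _), ← mean_eq_integral, ← hs.tsum_eq,
    ENNReal.ofReal_tsum_of_nonneg (fun k => sq_nonneg _) hs.summable]
  refine tsum_congr fun k => ?_
  have : coeff (SQG.inc2 a h) k = (mode k h - 1) * ((mode k h - 1) * coeff a k) := by
    rw [← ha.coeff_inc h k, ← (ha.inc h).coeff_inc h k]
    rfl
  rw [this, ← ENNReal.ofReal_mul (by positivity), norm_mul, norm_mul]
  congr 1
  ring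

theorem HolderBound.nonneg {β K : ℝ} {a : Plane → ℝ} (h : HolderBound β K a) : 0 ≤ K := by
  have := h (EuclideanSpace.single 0 1) 0
  simp only [sub_zero, PiLp.norm_single, norm_one, Real.one_rpow, mul_one] at this
  exact (abs_nonneg _).trans this

theorem HolderBound.abs_inc2_le {β K : ℝ} {a : Plane → ℝ} (h : HolderBound β K a) (v x : Plane) :
    |inc2 a v x| ≤ 2 * K * ‖v‖ ^ β := by
  have h1 := h (x + v + v) (x + v)
  have h2 := h (x + v) x
  rw [add_sub_cancel_left] at h1 h2
  refine (abs_sub _ _).trans ?_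
  unfold inc
  linarith

/-- One factor of the cube is bounded by the Hölder seminorm, and the remaining square is computed
by Parseval. The multiplier of a second increment is `(e^{ik·v} - 1)²`, hence the fourth power. -/
theorem BddPeriodic.moment2_le {a : Plane → ℝ} (ha : BddPeriodic a) {β K : ℝ}
    (h : HolderBound β K a) (v : Plane) :
    moment2 a v ≤ ENNReal.ofReal (2 * K * ‖v‖ ^ β) *
      ∑' k, ENNReal.ofReal (‖mode k v - 1‖ ^ 4) * ENNReal.ofReal (‖coeff a k‖ ^ 2) := by
  rw [← ha.lintegral_sq_inc2, ← lintegral_const_mul' _ _ ENNReal.ofReal_ne_top]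
  refine lintegral_mono fun x => ?_
  have := h.nonneg
  rw [← ENNReal.ofReal_mul (by positivity)]
  refine ENNReal.ofReal_le_ofReal ?_
  calc |SQG.inc2 a v x| ^ 3 = |SQG.inc2 a v x| * SQG.inc2 a v x ^ 2 := by
        rw [← sq_abs (SQG.inc2 a v x)]; ring
    _ ≤ _ := by gcongr; exact h.abs_inc2_le v x

/-- The square of the homogeneous Sobolev norm of order `σ / 2`, as an extended real. -/
def sobolevENN (σ : ℝ) (φ : Plane → ℝ) : ENNReal :=
  ∑' k, ENNReal.ofReal (‖freq k‖ ^ σ * ‖coeff φ k‖ ^ 2)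

/-- The Hölder factor lowers the power of `r` to `μ = 2+2α-β`, and the single-mode integral
converges for `1 < μ < 5`. With first increments the range would end at `μ = 3`, which fails when
`2α ≥ 1+β`; this is the reason for the detour through second increments. -/
theorem BddPeriodic.lintegral_moment2_le {α β : ℝ} (hα : α ∈ Set.Ioo (0 : ℝ) 1)
    (hβ : β ∈ Set.Ioo (0 : ℝ) 1) :
    ∃ C : ℝ, 0 < C ∧ ∀ a K, BddPeriodic a → HolderBound β K a → ∀ z : Plane,
      ∫⁻ r in Set.Ioi (0 : ℝ), ENNReal.ofReal (r ^ (-(2 + 2 * α))) * moment2 a (r • z) ≤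
        ENNReal.ofReal (C * K * ‖z‖ ^ (1 + 2 * α)) * sobolevENN (1 + 2 * α - β) a := by
  obtain ⟨hα0, hα1⟩ := hα
  obtain ⟨hβ0, hβ1⟩ := hβ
  set μ : ℝ := 2 + 2 * α - β with hμ
  have h1 : 1 < μ := by linarith
  have h5 : μ < 5 := by linarith
  have h51 : 0 < 5 - μ := by linarith
  have h11 : 0 < μ - 1 := by linarith
  refine ⟨2 * (1 / (5 - μ) + 16 / (μ - 1)), by positivity, fun a K ha hK z => ?_⟩
  have hK0 := hK.nonneg
  calc _ ≤ ∫⁻ r in Set.Ioi (0 : ℝ), ENNReal.ofReal (2 * K * ‖z‖ ^ β) *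
        ∑' k, (ENNReal.ofReal (r ^ (-μ)) *
          ENNReal.ofReal (min 16 ((r * (‖freq k‖ * ‖z‖)) ^ 4))) *
          ENNReal.ofReal (‖coeff a k‖ ^ 2) := by
        refine setLIntegral_mono' measurableSet_Ioi fun r hr => ?_
        have hr0 : 0 < r := hr
        calc _ ≤ ENNReal.ofReal (r ^ (-(2 + 2 * α))) * (ENNReal.ofReal (2 * K * ‖r • z‖ ^ β) *
              ∑' k, ENNReal.ofReal (‖mode k (r • z) - 1‖ ^ 4) *
                ENNReal.ofReal (‖coeff a k‖ ^ 2)) := by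
              gcongr
              exact ha.moment2_le hK _
          _ = ENNReal.ofReal (2 * K * ‖z‖ ^ β) * ∑' k, ENNReal.ofReal (r ^ (-μ)) *
              (ENNReal.ofReal (‖mode k (r • z) - 1‖ ^ 4) * ENNReal.ofReal (‖coeff a k‖ ^ 2)) := by
              rw [ENNReal.tsum_mul_left, ← mul_assoc, ← mul_assoc,
                ← ENNReal.ofReal_mul (by positivity), ← ENNReal.ofReal_mul (by positivity)]
              congr 2
              rw [norm_smul, Real.norm_of_nonneg hr0.le, Real.mul_rpow hr0.le (norm_nonneg _)]
              have : r ^ (-μ) = r ^ (-(2 + 2 * α)) * r ^ β := by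
                rw [← Real.rpow_add hr0]; congr 1; rw [hμ]; ring
              rw [this]
              ring
          _ ≤ _ := by
              simp only [mul_assoc]
              gcongr with k
              exact norm_mode_sub_one_pow_le k z hr0
    _ = ENNReal.ofReal (2 * K * ‖z‖ ^ β) * ∑' k, (∫⁻ r in Set.Ioi (0 : ℝ),
          ENNReal.ofReal (r ^ (-μ)) * ENNReal.ofReal (min 16 ((r * (‖freq k‖ * ‖z‖)) ^ 4))) *
          ENNReal.ofReal (‖coeff a k‖ ^ 2) := by
        rw [lintegral_const_mul' _ _ ENNReal.ofReal_ne_top, lintegral_tsum]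
        · simp_rw [lintegral_mul_const' _ _ ENNReal.ofReal_ne_top]
        · intro k
          fun_prop
    _ ≤ ENNReal.ofReal (2 * K * ‖z‖ ^ β) * ∑' k, ENNReal.ofReal ((1 / (5 - μ) + 16 / (μ - 1)) *
          (‖freq k‖ * ‖z‖) ^ (μ - 1)) * ENNReal.ofReal (‖coeff a k‖ ^ 2) := by
        gcongr with k
        exact lintegral_Ioi_rpow_mul_min_le h1 h5 (by positivity)
    _ = _ := by
        rw [sobolevENN, ← ENNReal.tsum_mul_left, ← ENNReal.tsum_mul_left]
        refine tsum_congr fun k => ?_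
        rw [← ENNReal.ofReal_mul (by positivity), ← ENNReal.ofReal_mul (by positivity),
          ← ENNReal.ofReal_mul (by positivity), Real.mul_rpow (norm_nonneg _) (norm_nonneg _)]
        congr 1
        have : ‖z‖ ^ (1 + 2 * α) = ‖z‖ ^ β * ‖z‖ ^ (μ - 1) := by
          rw [← Real.rpow_add_of_nonneg (norm_nonneg _) hβ0.le h11.le]; congr 1; rw [hμ]; ring
        rw [this, show 1 + 2 * α - β = μ - 1 by rw [hμ]; ring]
        ring

/-! ### The flux through Gaussian filters. -/

/-- The total flux through the Gaussian filter of width `r`. -/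
def gaussFlux (φ : Plane → ℝ) (u : Plane → Plane) (r : ℝ) : ℝ :=
  ∑' k, gaussWeight r ‖freq k‖ * flux φ u k

theorem ofReal_abs_integral_le {X : Type*} [MeasurableSpace X] {μ : Measure X} (f : X → ℝ) :
    ENNReal.ofReal |∫ x, f x ∂μ| ≤ ∫⁻ x, ENNReal.ofReal |f x| ∂μ := by
  have := ENNReal.ofReal_le_ofReal (norm_integral_le_lintegral_norm (μ := μ) f)
  exact this.trans ENNReal.ofReal_toReal_le

theorem mul_sq_le_cube_add_cube {A B : ℝ} (hA : 0 ≤ A) (hB : 0 ≤ B) :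
    A * B ^ 2 ≤ A ^ 3 + B ^ 3 := by
  have h1 : 0 ≤ A ^ 3 := by positivity
  have h2 : 0 ≤ B ^ 3 := by positivity
  rcases le_total A B with h | h
  · nlinarith [mul_le_mul_of_nonneg_right h (sq_nonneg B)]
  · nlinarith [mul_le_mul_of_nonneg_left (pow_le_pow_left₀ hB h 2) hA]

/-- The elementary bound `A B² ≤ A³ + B³` decouples the velocity from the scalar in the third-order
identity, so that each is handled by the same moment estimate. -/
theorem ofReal_abs_gaussFlux_le {φ : Plane → ℝ} {u : Plane → Plane} (hφ : BddPeriodic φ)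
    (hu : ∀ j, BddPeriodic fun x => u x j)
    (hdiv : ∀ k : Fin 2 → ℤ, ∑ j, (k j : ℂ) * coeff (fun x => u x j) k = 0) {r : ℝ} (hr : 0 < r) :
    ENNReal.ofReal |gaussFlux φ u r| ≤ ENNReal.ofReal r⁻¹ * ∑ j, ∫⁻ z : Plane,
      ENNReal.ofReal (‖z‖ * gauss z) * (moment (fun x => u x j) (r • z) + moment φ (r • z)) := by
  rw [gaussFlux, (hasSum_flux hφ hu hdiv hr).tsum_eq, abs_mul, abs_of_pos (by positivity),
    ENNReal.ofReal_mul (by positivity)]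
  gcongr ?_ * ?_
  · refine ENNReal.ofReal_le_ofReal (inv_anti₀ hr (by linarith))
  refine (ENNReal.ofReal_le_ofReal (Finset.abs_sum_le_sum_abs _ _)).trans ?_
  rw [ENNReal.ofReal_sum_of_nonneg fun j _ => abs_nonneg _]
  refine Finset.sum_le_sum fun j _ => ?_
  refine (ofReal_abs_integral_le _).trans (lintegral_mono fun z => ?_)
  rw [abs_mul, ENNReal.ofReal_mul (abs_nonneg _), abs_mul, abs_of_pos (gauss_pos z)]
  gcongr ?_ * ?_
  · refine ENNReal.ofReal_le_ofReal ?_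
    gcongr
    · exact (gauss_pos z).le
    · exact abs_apply_le_norm z j
  · rw [mean_eq_integral]
    refine (ofReal_abs_integral_le _).trans ?_
    have c := hφ.continuous_inc (h := fun _ : Plane => r • z) (x := id) continuous_const
      continuous_id
    rw [moment, moment, ← lintegral_add_right _ (by simp only [id] at c; fun_prop)]
    refine lintegral_mono fun x => ?_
    rw [← ENNReal.ofReal_add (by positivity) (by positivity)]
    refine ENNReal.ofReal_le_ofReal ?_
    simp only [inc]
    rw [abs_mul, abs_pow]
    exact mul_sq_le_cube_add_cube (abs_nonneg _) (abs_nonneg _)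

/-- The flux estimate. -/
theorem lintegral_gaussFlux_le {α β : ℝ} (hα : α ∈ Set.Ioo (0 : ℝ) 1)
    (hβ : β ∈ Set.Ioo (0 : ℝ) 1) :
    ∃ C : ℝ, 0 < C ∧ ∀ (φ : Plane → ℝ) (u : Plane → Plane) (K : ℝ), BddPeriodic φ →
      (∀ j, BddPeriodic fun x => u x j) →
      (∀ k : Fin 2 → ℤ, ∑ j, (k j : ℂ) * coeff (fun x => u x j) k = 0) →
      (∀ j k, ‖coeff (fun x => u x j) k‖ ≤ ‖coeff φ k‖) →
      HolderBound β K φ → (∀ j, HolderBound β K fun x => u x j) →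
      ∫⁻ r in Set.Ioi (0 : ℝ), ENNReal.ofReal (r ^ (-(1 + 2 * α))) *
          ENNReal.ofReal |gaussFlux φ u r| ≤
        ENNReal.ofReal (C * K) * sobolevENN (1 + 2 * α - β) φ := by
  obtain ⟨C1, hC1, h1⟩ := BddPeriodic.lintegral_moment_le hα
  obtain ⟨C2, hC2, h2⟩ := BddPeriodic.lintegral_moment2_le hα hβ
  obtain ⟨hα0, hα1⟩ := hα
  -- After exchanging the integrals in `r` and `z`, the moment estimate leaves the homogeneous
  -- factor `‖z‖^{1+2α}`; `J` is its Gaussian average.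
  set J : ENNReal := ∫⁻ z : Plane, ENNReal.ofReal (‖z‖ * gauss z) *
    ENNReal.ofReal (‖z‖ ^ (1 + 2 * α)) with hJ
  have hJfin : J ≠ ⊤ := by
    have hint := (integrable_pow_mul_exp_mul_gauss 1 0).add (integrable_pow_mul_exp_mul_gauss 4 0)
    refine ne_top_of_le_ne_top hint.lintegral_lt_top.ne (lintegral_mono fun z => ?_)
    have := gauss_pos z
    rw [← ENNReal.ofReal_mul (by positivity)]
    refine ENNReal.ofReal_le_ofReal ?_
    simp only [Pi.add_apply, zero_mul, Real.exp_zero, mul_one, pow_one]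
    have h3 : ‖z‖ ^ (1 + 2 * α) ≤ 1 + ‖z‖ ^ 3 := by
      rcases le_total ‖z‖ 1 with h | h
      · exact (Real.rpow_le_one (norm_nonneg _) h (by linarith)).trans (by simp)
      · calc ‖z‖ ^ (1 + 2 * α) ≤ ‖z‖ ^ (3 : ℝ) := Real.rpow_le_rpow_of_exponent_le h (by linarith)
          _ ≤ _ := by norm_cast; linarith
    calc _ ≤ ‖z‖ * gauss z * (1 + ‖z‖ ^ 3) := by gcongr
      _ = _ := by ring
  -- The factor `4` counts two components times two moments, and the `+ 1` only ensures positivity.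
  refine ⟨4 * C1 * C2 * (J.toReal + 1), by positivity,
    fun φ u K hφ hu hdiv hcoeff hK hKu => ?_⟩
  have hK0 := hK.nonneg
  have hm : ∀ a, BddPeriodic a → HolderBound β K a → (∀ k, ‖coeff a k‖ ≤ ‖coeff φ k‖) → ∀ z,
      ∫⁻ r in Set.Ioi (0 : ℝ), ENNReal.ofReal (r ^ (-(2 + 2 * α))) * moment a (r • z) ≤
        ENNReal.ofReal (C1 * C2 * K) * sobolevENN (1 + 2 * α - β) φ *
          ENNReal.ofReal (‖z‖ ^ (1 + 2 * α)) := by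
    intro a ha hKa hca z
    calc _ ≤ ENNReal.ofReal C1 * (ENNReal.ofReal (C2 * K * ‖z‖ ^ (1 + 2 * α)) *
          sobolevENN (1 + 2 * α - β) a) := (h1 a ha z).trans (by gcongr; exact h2 a K ha hKa z)
      _ ≤ ENNReal.ofReal C1 * (ENNReal.ofReal (C2 * K * ‖z‖ ^ (1 + 2 * α)) *
          sobolevENN (1 + 2 * α - β) φ) := by
          unfold sobolevENN
          gcongr with k
          exact hca k
      _ = _ := by
          rw [mul_right_comm (ENNReal.ofReal (C1 * C2 * K)), ← ENNReal.ofReal_mul (by positivity),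
            ← mul_assoc, ← ENNReal.ofReal_mul (by positivity)]
          congr 2
          ring
  have hmz : ∀ a, BddPeriodic a → Measurable fun p : ℝ × Plane => moment a (p.1 • p.2) :=
    fun a ha => ha.measurable_moment.comp (by fun_prop)
  calc _ ≤ ∫⁻ r in Set.Ioi (0 : ℝ), ∑ j, ∫⁻ z : Plane, ENNReal.ofReal (‖z‖ * gauss z) *
        (ENNReal.ofReal (r ^ (-(2 + 2 * α))) * moment (fun x => u x j) (r • z) +
          ENNReal.ofReal (r ^ (-(2 + 2 * α))) * moment φ (r • z)) := by
        refine setLIntegral_mono' measurableSet_Ioi fun r hr => ?_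
        have hr0 : 0 < r := hr
        calc _ ≤ ENNReal.ofReal (r ^ (-(1 + 2 * α))) * (ENNReal.ofReal r⁻¹ * ∑ j, ∫⁻ z : Plane,
              ENNReal.ofReal (‖z‖ * gauss z) *
                (moment (fun x => u x j) (r • z) + moment φ (r • z))) := by
              gcongr
              exact ofReal_abs_gaussFlux_le hφ hu hdiv hr0
          _ = _ := by
              rw [← mul_assoc, ← ENNReal.ofReal_mul (by positivity)]
              have : r ^ (-(1 + 2 * α)) * r⁻¹ = r ^ (-(2 + 2 * α)) := by
                rw [← Real.rpow_neg_one, ← Real.rpow_add hr0]; congr 1; ring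
              rw [this, Finset.mul_sum]
              refine Finset.sum_congr rfl fun j _ => ?_
              rw [← lintegral_const_mul' _ _ ENNReal.ofReal_ne_top]
              congr 1
              funext z
              ring
    _ = ∑ j, ∫⁻ z : Plane, ENNReal.ofReal (‖z‖ * gauss z) *
        ((∫⁻ r in Set.Ioi (0 : ℝ), ENNReal.ofReal (r ^ (-(2 + 2 * α))) *
          moment (fun x => u x j) (r • z)) +
        ∫⁻ r in Set.Ioi (0 : ℝ), ENNReal.ofReal (r ^ (-(2 + 2 * α))) * moment φ (r • z)) := by
        have hg := continuous_gauss
        have hφm := hmz φ hφ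
        rw [lintegral_finsetSum]
        · refine Finset.sum_congr rfl fun j _ => ?_
          have hum := hmz _ (hu j)
          rw [lintegral_lintegral_swap]
          · congr 1
            funext z
            rw [lintegral_const_mul' _ _ ENNReal.ofReal_ne_top, lintegral_add_left]
            have : Measurable fun r : ℝ => moment (fun x => u x j) (r • z) :=
              (hu j).measurable_moment.comp (by fun_prop)
            fun_prop
          · refine Measurable.aemeasurable ?_
            unfold Function.uncurry
            fun_prop
        · intro j _
          have hum := hmz _ (hu j)
          have : Measurable fun p : ℝ × Plane => ENNReal.ofReal (‖p.2‖ * gauss p.2) *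
              (ENNReal.ofReal (p.1 ^ (-(2 + 2 * α))) * moment (fun x => u x j) (p.1 • p.2) +
              ENNReal.ofReal (p.1 ^ (-(2 + 2 * α))) * moment φ (p.1 • p.2)) := by
            fun_prop
          exact this.lintegral_prod_right'
    _ ≤ ∑ j : Fin 2, ∫⁻ z : Plane, ENNReal.ofReal (‖z‖ * gauss z) *
        (ENNReal.ofReal (C1 * C2 * K) * sobolevENN (1 + 2 * α - β) φ *
          ENNReal.ofReal (‖z‖ ^ (1 + 2 * α)) + ENNReal.ofReal (C1 * C2 * K) *
          sobolevENN (1 + 2 * α - β) φ * ENNReal.ofReal (‖z‖ ^ (1 + 2 * α))) := by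
        gcongr with j _ z
        · exact hm _ (hu j) (hKu j) (hcoeff j) z
        · exact hm _ hφ hK (fun k => le_rfl) z
    _ = ENNReal.ofReal (C1 * C2 * K) * sobolevENN (1 + 2 * α - β) φ * (4 * J) := by
        have : ∀ z : Plane, ENNReal.ofReal (‖z‖ * gauss z) *
            (ENNReal.ofReal (C1 * C2 * K) * sobolevENN (1 + 2 * α - β) φ *
            ENNReal.ofReal (‖z‖ ^ (1 + 2 * α)) + ENNReal.ofReal (C1 * C2 * K) *
            sobolevENN (1 + 2 * α - β) φ * ENNReal.ofReal (‖z‖ ^ (1 + 2 * α))) =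
            (2 * (ENNReal.ofReal (C1 * C2 * K) * sobolevENN (1 + 2 * α - β) φ)) *
            (ENNReal.ofReal (‖z‖ * gauss z) * ENNReal.ofReal (‖z‖ ^ (1 + 2 * α))) := by
          intro z
          ring
        simp_rw [this]
        have hg := continuous_gauss
        rw [lintegral_const_mul _ (by fun_prop), ← hJ, Fin.sum_univ_two]
        ring
    _ ≤ _ := by
        have h4 : (4 : ENNReal) * J ≤ ENNReal.ofReal (4 * (J.toReal + 1)) := by
          rw [ENNReal.ofReal_mul (by norm_num), ENNReal.ofReal_ofNat]
          gcongr
          exact ENNReal.le_ofReal_iff_toReal_le hJfin (by positivity) |>.2 (by linarith)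
        calc _ ≤ ENNReal.ofReal (C1 * C2 * K) * sobolevENN (1 + 2 * α - β) φ *
              ENNReal.ofReal (4 * (J.toReal + 1)) := by gcongr
          _ = _ := by
            rw [mul_right_comm, ← ENNReal.ofReal_mul (by positivity)]
            congr 2
            ring

/-! ### Riesz transforms of Hölder functions. -/

theorem lintegral_Ioc_const_mul_rpow {c p T : ℝ} (hc : 0 ≤ c) (hp : -1 < p) (hT : 0 ≤ T) :
    ∫⁻ r in Set.Ioc 0 T, ENNReal.ofReal (c * r ^ p) =
      ENNReal.ofReal (c * (T ^ (p + 1) / (p + 1))) := by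
  have hint : IntegrableOn (fun r : ℝ => c * r ^ p) (Set.Ioc 0 T) :=
    ((intervalIntegrable_iff_integrableOn_Ioc_of_le hT).1
      (intervalIntegral.intervalIntegrable_rpow' hp)).const_mul c
  rw [← ofReal_integral_eq_lintegral_ofReal hint, integral_const_mul,
    ← intervalIntegral.integral_of_le hT, integral_rpow (Or.inl hp),
    Real.zero_rpow (by linarith), sub_zero]
  refine (ae_restrict_iff' measurableSet_Ioc).2 (Filter.Eventually.of_forall fun r hr => ?_)
  have := hr.1
  simp only [Pi.zero_apply]
  positivity

theorem lintegral_Ioi_const_mul_rpow {c p T : ℝ} (hc : 0 ≤ c) (hp : p < -1) (hT : 0 < T) :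
    ∫⁻ r in Set.Ioi T, ENNReal.ofReal (c * r ^ p) =
      ENNReal.ofReal (c * (-T ^ (p + 1) / (p + 1))) := by
  have hint : IntegrableOn (fun r : ℝ => c * r ^ p) (Set.Ioi T) :=
    (integrableOn_Ioi_rpow_of_lt hp hT).const_mul c
  rw [← ofReal_integral_eq_lintegral_ofReal hint, integral_const_mul,
    integral_Ioi_rpow_of_lt hp hT]
  refine (ae_restrict_iff' measurableSet_Ioi).2 (Filter.Eventually.of_forall fun r hr => ?_)
  have : 0 < r := hT.trans hr
  simp only [Pi.zero_apply]
  positivity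

/-- The usual two-regime estimate of a singular integral: size bounds up to scale `t`, smoothness
bounds beyond it. Both pieces scale like `t^β`, the first converging because `β > 0` and the second
because `β < 1`. -/
theorem lintegral_Ioi_min_rpow_le {β A B t : ℝ} (hβ : β ∈ Set.Ioo (0 : ℝ) 1) (hA : 0 ≤ A)
    (hB : 0 ≤ B) (ht : 0 < t) {F : ℝ → ℝ}
    (h1 : ∀ r ∈ Set.Ioc 0 t, F r ≤ A * r ^ (β - 1))
    (h2 : ∀ r ∈ Set.Ioi t, F r ≤ B * t * r ^ (β - 2)) :
    ∫⁻ r in Set.Ioi (0 : ℝ), ENNReal.ofReal (F r) ≤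
      ENNReal.ofReal ((A / β + B / (1 - β)) * t ^ β) := by
  have hβ0 := hβ.1
  have hβ1 : 0 < 1 - β := by linarith [hβ.2]
  rw [← Set.Ioc_union_Ioi_eq_Ioi ht.le]
  refine (lintegral_union_le _ _ _).trans ?_
  rw [add_mul, ENNReal.ofReal_add (by positivity) (by positivity)]
  refine add_le_add ?_ ?_
  · refine (setLIntegral_mono' measurableSet_Ioc fun r hr =>
      ENNReal.ofReal_le_ofReal (h1 r hr)).trans (le_of_eq ?_)
    rw [lintegral_Ioc_const_mul_rpow hA (by linarith) ht.le, sub_add_cancel]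
    congr 1
    ring
  · refine (setLIntegral_mono' measurableSet_Ioi fun r hr =>
      ENNReal.ofReal_le_ofReal (h2 r hr)).trans (le_of_eq ?_)
    rw [lintegral_Ioi_const_mul_rpow (by positivity) (by linarith) ht]
    congr 1
    rw [show β - 2 + 1 = β - 1 by ring, Real.rpow_sub_one ht.ne', show β - 1 = -(1 - β) by ring]
    field_simp

theorem freq_apply (k : Fin 2 → ℤ) (j : Fin 2) : freq k j = k j := rfl

theorem one_le_norm_freq {k : Fin 2 → ℤ} (hk : k ≠ 0) : 1 ≤ ‖freq k‖ := by
  obtain ⟨i, hi⟩ := Function.ne_iff.1 hk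
  refine le_trans ?_ (abs_apply_le_norm (freq k) i)
  rw [freq_apply]
  rw [← Int.cast_abs]
  exact_mod_cast Int.one_le_abs hi

/-- Translation by half a wavelength reverses the sign of a nontrivial character; translation
invariance then forces its mean to vanish. -/
theorem mode_ne_one {k : Fin 2 → ℤ} (hk : k ≠ 0) :
    mode k ((Real.pi / ‖freq k‖ ^ 2) • freq k) = -1 := by
  have : ‖freq k‖ ≠ 0 := by linarith [one_le_norm_freq hk]
  rw [mode, real_inner_smul_right, real_inner_self_eq_norm_sq, div_mul_cancel₀ _ (by positivity),
    Complex.exp_pi_mul_I]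

theorem mean_mode {k : Fin 2 → ℤ} (hk : k ≠ 0) : mean (mode k) = 0 := by
  have h := mean_shift (mode_periodic k) ((Real.pi / ‖freq k‖ ^ 2) • freq k)
  simp_rw [mode_add, mode_ne_one hk] at h
  rw [mean_eq_integral, integral_mul_const, ← mean_eq_integral] at h
  linear_combination (-1 / 2 : ℂ) * h

theorem mode_zero_freq (x : Plane) : mode 0 x = 1 := by
  simp [mode, inner_freq]

theorem mode_mul_conj_mode (l k : Fin 2 → ℤ) (x : Plane) :
    mode l x * conj (mode k x) = mode (l - k) x := by
  rw [conj_mode, mode, mode, ← Complex.exp_add, inner_freq, inner_freq, inner_freq]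
  congr 1
  push_cast [Pi.sub_apply]
  ring

theorem mode_neg_freq (k : Fin 2 → ℤ) (x : Plane) : mode (-k) x = conj (mode k x) := by
  rw [← zero_sub, ← mode_mul_conj_mode, mode_zero_freq, one_mul]

theorem mean_mode_mul_conj_mode (l k : Fin 2 → ℤ) :
    (mean fun x => mode l x * conj (mode k x)) = if l = k then 1 else 0 := by
  simp_rw [mode_mul_conj_mode]
  split_ifs with h
  · simp [h, mode_zero_freq, mean_eq_integral]
  · exact mean_mode (sub_ne_zero.2 h)

theorem coeff_neg_freq (a : Plane → ℝ) (k : Fin 2 → ℤ) : coeff a (-k) = conj (coeff a k) := by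
  rw [coeff_eq_mean, coeff_eq_mean, mean_eq_integral, mean_eq_integral, ← integral_conj]
  congr 1
  funext x
  rw [mode_neg_freq]
  simp

theorem norm_mode_sub_mode_le (k : Fin 2 → ℤ) (x y : Plane) :
    ‖mode k x - mode k y‖ ≤ ‖freq k‖ * ‖x - y‖ := by
  have h : mode k x - mode k y = mode k y * (mode k (x - y) - 1) := by
    rw [mul_sub, ← mode_add, add_sub_cancel, mul_one]
  rw [h, norm_mul, norm_mode, one_mul, mode, mul_comm]
  exact Real.norm_exp_I_mul_ofReal_sub_one_le.trans (norm_inner_le_norm _ _)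

/-- A real trigonometric series with rapidly decaying Hermitian coefficients. -/
theorem exists_trigSeries {c : (Fin 2 → ℤ) → ℂ} (hc : ∀ k, c (-k) = conj (c k))
    (h0 : Summable fun k => ‖c k‖) (h1 : Summable fun k => ‖freq k‖ * ‖c k‖) :
    ∃ V : Plane → ℝ, BddPeriodic V ∧ (∀ k, coeff V k = c k) ∧ (∀ x, |V x| ≤ ∑' k, ‖c k‖) ∧
      ∀ x y, |V x - V y| ≤ (∑' k, ‖freq k‖ * ‖c k‖) * ‖x - y‖ := by
  have hn : ∀ x k, ‖c k * mode k x‖ = ‖c k‖ := fun x k => by rw [norm_mul, norm_mode, mul_one]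
  have hsum : ∀ x, Summable fun k => c k * mode k x := fun x =>
    Summable.of_norm (by simpa only [hn] using h0)
  set T : Plane → ℂ := fun x => ∑' k, c k * mode k x with hT
  have hreal : ∀ x, conj (T x) = T x := by
    intro x
    rw [hT]
    simp only
    rw [Complex.conj_tsum, ← (Equiv.neg (Fin 2 → ℤ)).tsum_eq]
    refine tsum_congr fun k => ?_
    rw [Equiv.neg_apply, hc, mode_neg_freq, map_mul, Complex.conj_conj, Complex.conj_conj]
  have hVT : ∀ x, (((T x).re : ℝ) : ℂ) = T x := fun x => Complex.conj_eq_iff_re.1 (hreal x)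
  have hcont : Continuous T := continuous_tsum
    (fun k => continuous_const.mul (continuous_mode k)) h0 fun k x => (hn x k).le
  have hbd : ∀ x, |(T x).re| ≤ ∑' k, ‖c k‖ := fun x =>
    (Complex.abs_re_le_norm _).trans ((norm_tsum_le_tsum_norm (by simpa only [hn] using h0)).trans
      (le_of_eq (tsum_congr fun k => hn x k)))
  refine ⟨fun x => (T x).re, ⟨Complex.continuous_re.comp hcont, fun x k => ?_, _, hbd⟩, fun k => ?_,
    hbd, fun x y => ?_⟩
  · simp only [hT, mode_periodic _ x k]
  · rw [coeff_eq_mean]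
    simp_rw [hVT]
    have hF : ∀ l, Integrable (fun x => c l * (mode l x * conj (mode k x))) cellMeasure := by
      intro l
      have h1 := continuous_mode l
      have h2 := continuous_mode k
      have h3 : Continuous fun x => c l * (mode l x * conj (mode k x)) := by fun_prop
      refine Integrable.of_bound h3.aestronglyMeasurable ‖c l‖
        (Filter.Eventually.of_forall fun x => by simp [norm_mode])
    have hsm : Summable fun l => ∫ x, ‖c l * (mode l x * conj (mode k x))‖ ∂cellMeasure := by
      simpa [norm_mode] using h0
    have key := hasSum_integral_of_summable_integral_norm hF hsm
    simp_rw [integral_const_mul, ← mean_eq_integral, mean_mode_mul_conj_mode] at key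
    have key2 := key.unique (hasSum_single k fun l hl => by simp [hl])
    simp only [if_true, mul_one] at key2
    rw [← key2]
    congr 1
    funext x
    rw [hT]
    simp only [← mul_assoc]
    exact tsum_mul_right.symm
  · simp only
    rw [← Complex.sub_re]
    refine (Complex.abs_re_le_norm _).trans ?_
    rw [hT]
    simp only
    rw [← (hsum x).tsum_sub (hsum y), ← tsum_mul_right]
    have hle : ∀ k, ‖c k * mode k x - c k * mode k y‖ ≤ ‖freq k‖ * ‖c k‖ * ‖x - y‖ := by
      intro k
      rw [← mul_sub, norm_mul]
      calc _ ≤ ‖c k‖ * (‖freq k‖ * ‖x - y‖) := by gcongr; exact norm_mode_sub_mode_le k x y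
        _ = _ := by ring
    exact (norm_tsum_le_tsum_norm (.of_nonneg_of_le (fun k => norm_nonneg _) hle
      (h1.mul_right _))).trans (Summable.tsum_le_tsum hle (.of_nonneg_of_le
        (fun k => norm_nonneg _) hle (h1.mul_right _)) (h1.mul_right _))

theorem summable_norm_freq_rpow {p : ℝ} (hp : 2 < p) :
    Summable fun k : Fin 2 → ℤ => ‖freq k‖ ^ (-p) := by
  refine Summable.of_nonneg_of_le (fun k => by positivity) (fun k => ?_)
    (EisensteinSeries.summable_one_div_norm_rpow hp)
  rcases eq_or_ne k 0 with rfl | hk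
  · have : freq 0 = 0 := by ext; simp [freq]
    simp [this]
  have h1 : ‖k‖ ≤ ‖freq k‖ := by
    refine (pi_norm_le_iff_of_nonneg (norm_nonneg _)).2 fun i => ?_
    have := abs_apply_le_norm (freq k) i
    rwa [freq_apply, ← Int.norm_eq_abs] at this
  have h2 : 0 < ‖k‖ := norm_pos_iff.2 hk
  exact Real.rpow_le_rpow_of_nonpos h2 h1 (by linarith)

theorem norm_freq_zero : ‖freq 0‖ = 0 := by
  have : freq 0 = 0 := by ext; simp [freq]
  simp [this]

/-- `10` is a round upper bound for the diameter `2π√2` of the closed cell. -/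
theorem norm_torusSection_sub_le (x y : UnitAddTorus (Fin 2)) :
    ‖torusSection x - torusSection y‖ ≤ 10 := by
  have h : ∀ i, |(torusSection x - torusSection y) i| ≤ 2 * Real.pi := by
    intro i
    simp only [torusSection, PiLp.sub_apply, PiLp.smul_apply, smul_eq_mul]
    have h1 := (AddCircle.equivIoc 1 (-1 / 2) (x i)).2
    have h2 := (AddCircle.equivIoc 1 (-1 / 2) (y i)).2
    rw [← mul_sub, abs_mul, abs_of_pos (by positivity)]
    have : |((AddCircle.equivIoc 1 (-1 / 2) (x i)) : ℝ) - (AddCircle.equivIoc 1 (-1 / 2) (y i))|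
        ≤ 1 := by
      rw [abs_le]
      constructor <;> linarith [h1.1, h1.2, h2.1, h2.2]
    nlinarith [Real.pi_pos]
  rw [EuclideanSpace.norm_eq, Fin.sum_univ_two, Real.sqrt_le_left (by norm_num)]
  have hpi := Real.pi_lt_d2
  have h0 := h 0
  have h1 := h 1
  simp only [Real.norm_eq_abs]
  nlinarith [abs_nonneg ((torusSection x - torusSection y) 0),
    abs_nonneg ((torusSection x - torusSection y) 1), Real.pi_pos]

/-- A function of zero mean is the average of its own differences, which by periodicity may be taken
between points of one closed cell. -/
theorem HolderBound.abs_le {β K : ℝ} {a : Plane → ℝ} (hβ : β ∈ Set.Ioo (0 : ℝ) 1)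
    (h : HolderBound β K a) (hp : IsPeriodic a) (hi : Integrable a cellMeasure)
    (hm : mean a = 0) (x : Plane) : |a x| ≤ 10 * K := by
  have hK := h.nonneg
  have key : ∀ y y', |a (torusSection y) - a (torusSection y')| ≤ 10 * K := by
    intro y y'
    refine (h _ _).trans ?_
    calc K * ‖torusSection y - torusSection y'‖ ^ β ≤ K * 10 ^ β := by
          gcongr
          · exact hβ.1.le
          · exact norm_torusSection_sub_le y y'
      _ ≤ K * 10 ^ (1 : ℝ) := by
          gcongr
          · norm_num
          · exact hβ.2.le
      _ = 10 * K := by rw [Real.rpow_one]; ring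
  have hx : a x = a (torusSection (torusMk x)) :=
    hp.eq_of_torusMk_eq (torusMk_torusSection _).symm
  have e : a x = ∫ y, (a x - a y) ∂cellMeasure := by
    rw [mean_eq_integral] at hm
    rw [integral_sub (integrable_const _) hi, hm]
    simp
  rw [e, ← Real.norm_eq_abs]
  refine le_trans (b := 10 * K * cellMeasure.real Set.univ)
    (norm_integral_le_of_norm_le_const (ae_cellMeasure_of_forall_torusSection fun y => ?_))
    (by simp)
  rw [Real.norm_eq_abs, hx]
  exact key _ _

theorem HolderBound.continuous {β K : ℝ} {a : Plane → ℝ} (hβ : 0 < β)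
    (h : HolderBound β K a) : Continuous a := by
  rw [continuous_iff_continuousAt]
  intro x
  rw [ContinuousAt, tendsto_iff_dist_tendsto_zero]
  have hlim : Filter.Tendsto (fun y : Plane => K * ‖y - x‖ ^ β) (nhds x) (nhds 0) := by
    have : Continuous fun y : Plane => K * ‖y - x‖ ^ β :=
      continuous_const.mul ((continuous_id.sub continuous_const).norm.rpow_const
        fun _ => Or.inr hβ.le)
    simpa [Real.zero_rpow hβ.ne'] using this.tendsto x
  exact squeeze_zero (fun _ => dist_nonneg) (fun y => h y x) hlim

theorem MemL2.bddPeriodic {β K : ℝ} {a : Plane → ℝ} (hβ : β ∈ Set.Ioo (0 : ℝ) 1)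
    (ha : MemL2 a) (h : HolderBound β K a) : BddPeriodic a :=
  ⟨h.continuous hβ.1, ha.periodic, 10 * K,
    h.abs_le hβ ha.periodic (integrable_of_memLp_two ha.memLp_cellMeasure) ha.mean_zero⟩

/-- The Gaussian derivative filter `∫ z_l g(z) φ(x + r z) dz` of width `r`. -/
def gaussDeriv (φ : Plane → ℝ) (l : Fin 2) (r : ℝ) (x : Plane) : ℝ :=
  ∫ z : Plane, z l * gauss z * φ (x + r • z)

theorem integral_apply_mul_gauss (l : Fin 2) : ∫ z : Plane, z l * gauss z = 0 := by
  have h := integral_apply_mul_gauss_mul_mode 0 l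
  simp only [inner_zero_left, Complex.ofReal_zero, zero_mul, Complex.exp_zero, mul_one,
    PiLp.zero_apply, mul_zero] at h
  rw [integral_complex_ofReal] at h
  exact Complex.ofReal_eq_zero.1 h

theorem BddPeriodic.integrable_gaussDeriv {φ : Plane → ℝ} (hφ : BddPeriodic φ) (l : Fin 2) (r : ℝ)
    (x : Plane) : Integrable fun z : Plane => z l * gauss z * φ (x + r • z) := by
  obtain ⟨M, hM⟩ := hφ.bdd
  have := hφ.cont
  exact (integrable_apply_mul_gauss l).mul_bdd (c := M)
    (Continuous.aestronglyMeasurable (by fun_prop)) (Filter.Eventually.of_forall fun z => hM _)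

/-- Control of averages against a kernel with vanishing integral. -/
theorem abs_integral_kernel_le {β K : ℝ} (hβ : β ∈ Set.Ioo (0 : ℝ) 1) {φ : Plane → ℝ}
    (hφ : BddPeriodic φ) (hK : HolderBound β K φ) {P : Plane → ℝ} {Q : Plane → ℝ} (hP : Integrable P)
    (hP0 : ∫ z, P z = 0) (hPQ : ∀ z, |P z| * (1 + ‖z‖) ≤ Q z) (hQ : Integrable Q) {r : ℝ}
    (hr : 0 < r) (x : Plane) :
    |∫ z : Plane, P z * φ (x + r • z)| ≤ K * r ^ β * ∫ z, Q z := by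
  have hK0 := hK.nonneg
  obtain ⟨M, hM⟩ := hφ.bdd
  have hc := hφ.cont
  have hi : Integrable fun z : Plane => P z * φ (x + r • z) :=
    hP.mul_bdd (c := M) (Continuous.aestronglyMeasurable (by fun_prop))
      (Filter.Eventually.of_forall fun z => hM _)
  have e : ∫ z : Plane, P z * φ (x + r • z) = ∫ z : Plane, P z * (φ (x + r • z) - φ x) := by
    simp_rw [mul_sub]
    rw [integral_sub hi (hP.mul_const _), integral_mul_const, hP0, zero_mul, sub_zero]
  rw [e, ← integral_const_mul, ← Real.norm_eq_abs]
  refine norm_integral_le_of_norm_le (hQ.const_mul _) (Filter.Eventually.of_forall fun z => ?_)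
  rw [norm_mul, Real.norm_eq_abs, Real.norm_eq_abs]
  have h1 := hK (x + r • z) x
  rw [add_sub_cancel_left, norm_smul, Real.norm_of_nonneg hr.le,
    Real.mul_rpow hr.le (norm_nonneg _)] at h1
  have h2 : ‖z‖ ^ β ≤ 1 + ‖z‖ := by
    rcases le_total ‖z‖ 1 with h | h
    · exact (Real.rpow_le_one (norm_nonneg _) h hβ.1.le).trans (by simp)
    · calc ‖z‖ ^ β ≤ ‖z‖ ^ (1 : ℝ) := Real.rpow_le_rpow_of_exponent_le h hβ.2.le
        _ ≤ _ := by rw [Real.rpow_one]; linarith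
  calc |P z| * |φ (x + r • z) - φ x| ≤ |P z| * (K * (r ^ β * (1 + ‖z‖))) := by
        gcongr
        exact h1.trans (by gcongr)
    _ = K * r ^ β * (|P z| * (1 + ‖z‖)) := by ring
    _ ≤ _ := by gcongr; exact hPQ z

theorem gauss_sub (z v : Plane) :
    gauss (z - v) = gauss z * Real.exp (inner ℝ z v - ‖v‖ ^ 2 / 2) := by
  rw [gauss, gauss, mul_assoc, ← Real.exp_add, norm_sub_sq_real]
  congr 2
  ring

theorem abs_exp_sub_one_le (q : ℝ) : |Real.exp q - 1| ≤ |q| * Real.exp |q| := by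
  rcases le_total 0 q with h | h
  · rw [abs_of_nonneg h, abs_of_nonneg (by linarith [Real.add_one_le_exp q])]
    have h1 := Real.add_one_le_exp (-q)
    have h2 : Real.exp (-q) * Real.exp q = 1 := by rw [← Real.exp_add]; simp
    nlinarith [Real.exp_pos q]
  · rw [abs_of_nonpos h, abs_of_nonpos (by linarith [Real.exp_le_one_iff.2 h])]
    have h1 := Real.add_one_le_exp q
    have h2 : 1 ≤ Real.exp (-q) := Real.one_le_exp (by linarith)
    nlinarith

/-- The shifted Gaussian differs from the original by the factor `e^q` with `|q| ≤ ‖v‖ (1 + ‖z‖)`,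
which makes the kernel Lipschitz in the shift with an integrable majorant. -/
theorem abs_kernel_sub_le (l : Fin 2) {z v : Plane} (hv : ‖v‖ ≤ 1) :
    |(z - v) l * gauss (z - v) - z l * gauss z| ≤
      ‖v‖ * ((1 + ‖z‖) ^ 2 * Real.exp (1 + ‖z‖) * gauss z) := by
  set q : ℝ := inner ℝ z v - ‖v‖ ^ 2 / 2 with hq
  have hz := norm_nonneg z
  have hv0 := norm_nonneg v
  have hg := gauss_pos z
  have hin : |inner ℝ z v| ≤ ‖z‖ * ‖v‖ := abs_real_inner_le_norm _ _
  have hq1 : |q| ≤ ‖v‖ * (1 + ‖z‖) := by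
    rw [abs_le] at hin ⊢
    constructor <;> nlinarith
  have hq2 : |q| ≤ 1 + ‖z‖ := hq1.trans (by nlinarith)
  have h1 : |Real.exp q - 1| ≤ ‖v‖ * (1 + ‖z‖) * Real.exp (1 + ‖z‖) :=
    (abs_exp_sub_one_le q).trans (by gcongr)
  have h2 : Real.exp q ≤ Real.exp (1 + ‖z‖) := Real.exp_le_exp.2 ((le_abs_self q).trans hq2)
  have e : (z - v) l * gauss (z - v) - z l * gauss z
      = gauss z * (z l * (Real.exp q - 1) - v l * Real.exp q) := by
    rw [gauss_sub, PiLp.sub_apply]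
    ring
  rw [e, abs_mul, abs_of_pos hg]
  have h3 : |z l * (Real.exp q - 1) - v l * Real.exp q| ≤
      ‖z‖ * (‖v‖ * (1 + ‖z‖) * Real.exp (1 + ‖z‖)) + ‖v‖ * Real.exp (1 + ‖z‖) := by
    refine (abs_sub _ _).trans ?_
    rw [abs_mul, abs_mul, abs_of_pos (Real.exp_pos q)]
    gcongr
    · exact abs_apply_le_norm z l
    · exact abs_apply_le_norm v l
  calc _ ≤ gauss z * (‖z‖ * (‖v‖ * (1 + ‖z‖) * Real.exp (1 + ‖z‖)) + ‖v‖ * Real.exp (1 + ‖z‖)) := by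
        gcongr
    _ = gauss z * ‖v‖ * Real.exp (1 + ‖z‖) * (‖z‖ * (1 + ‖z‖) + 1) := by ring
    _ ≤ gauss z * ‖v‖ * Real.exp (1 + ‖z‖) * (1 + ‖z‖) ^ 2 := by
        gcongr
        nlinarith
    _ = _ := by ring

theorem integrable_cube_mul_exp_mul_gauss :
    Integrable fun z : Plane => (1 + ‖z‖) ^ 3 * Real.exp (1 + ‖z‖) * gauss z := by
  have h := (((integrable_pow_mul_exp_mul_gauss 0 1).add
    ((integrable_pow_mul_exp_mul_gauss 1 1).const_mul 3)).add
    ((integrable_pow_mul_exp_mul_gauss 2 1).const_mul 3)).add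
    (integrable_pow_mul_exp_mul_gauss 3 1)
  refine (h.const_mul (Real.exp 1)).congr (Filter.Eventually.of_forall fun z => ?_)
  simp only [Pi.add_apply, Real.exp_add, one_mul]
  ring

/-- The constant controlling Gaussian averages of Hölder functions. -/
def gaussConst : ℝ := ∫ z : Plane, (1 + ‖z‖) ^ 3 * Real.exp (1 + ‖z‖) * gauss z

theorem gaussConst_nonneg : 0 ≤ gaussConst :=
  integral_nonneg fun z => by have := gauss_pos z; positivity

theorem abs_gaussDeriv_le {β K : ℝ} (hβ : β ∈ Set.Ioo (0 : ℝ) 1) {φ : Plane → ℝ}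
    (hφ : BddPeriodic φ) (hK : HolderBound β K φ) (l : Fin 2) {r : ℝ} (hr : 0 < r) (x : Plane) :
    |gaussDeriv φ l r x| ≤ K * gaussConst * r ^ β := by
  refine (abs_integral_kernel_le hβ hφ hK (integrable_apply_mul_gauss l)
    (integral_apply_mul_gauss l) (fun z => ?_) integrable_cube_mul_exp_mul_gauss hr x).trans
    (le_of_eq (by rw [gaussConst]; ring))
  have hz := norm_nonneg z
  have hg := gauss_pos z
  have h1 : 1 ≤ Real.exp (1 + ‖z‖) := Real.one_le_exp (by positivity)
  rw [abs_mul, abs_of_pos hg]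
  calc |z l| * gauss z * (1 + ‖z‖) ≤ (1 + ‖z‖) ^ 2 * gauss z * (1 + ‖z‖) := by
        gcongr
        have := abs_apply_le_norm z l
        nlinarith
    _ = (1 + ‖z‖) ^ 3 * 1 * gauss z := by ring
    _ ≤ _ := by gcongr

/-- A translation of the point by `h` is a translation of the kernel by `h / r`. The difference of
the two kernels still has vanishing integral and has size `‖h‖ / r`, so the gain `r^β` from the
Hölder bound survives. -/
theorem abs_gaussDeriv_sub_le {β K : ℝ} (hβ : β ∈ Set.Ioo (0 : ℝ) 1) {φ : Plane → ℝ}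
    (hφ : BddPeriodic φ) (hK : HolderBound β K φ) (l : Fin 2) {r : ℝ} (hr : 0 < r) (x h : Plane)
    (hh : ‖h‖ ≤ r) :
    |gaussDeriv φ l r (x + h) - gaussDeriv φ l r x| ≤ K * gaussConst * ‖h‖ * r ^ (β - 1) := by
  set v : Plane := r⁻¹ • h with hv
  have hvn : ‖v‖ = r⁻¹ * ‖h‖ := by rw [hv, norm_smul, Real.norm_of_nonneg (by positivity)]
  have hv1 : ‖v‖ ≤ 1 := by rw [hvn, inv_mul_le_iff₀ hr]; simpa using hh
  have e1 : gaussDeriv φ l r (x + h) =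
      ∫ z : Plane, (z - v) l * gauss (z - v) * φ (x + r • z) := by
    rw [gaussDeriv, ← integral_sub_right_eq_self _ v]
    congr 1
    funext z
    congr 2
    rw [smul_sub, hv, smul_inv_smul₀ hr.ne']
    abel
  have hPs : Integrable fun z : Plane => (z - v) l * gauss (z - v) :=
    (integrable_apply_mul_gauss l).comp_sub_right v
  have hi : Integrable fun z : Plane => (z - v) l * gauss (z - v) * φ (x + r • z) := by
    obtain ⟨M, hM⟩ := hφ.bdd
    have := hφ.cont
    exact hPs.mul_bdd (c := M) (Continuous.aestronglyMeasurable (by fun_prop))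
      (Filter.Eventually.of_forall fun z => hM _)
  rw [e1, gaussDeriv, ← integral_sub hi (hφ.integrable_gaussDeriv l r x)]
  simp_rw [← sub_mul]
  refine (abs_integral_kernel_le hβ hφ hK (hPs.sub (integrable_apply_mul_gauss l)) ?_
    (Q := fun z => ‖v‖ * ((1 + ‖z‖) ^ 3 * Real.exp (1 + ‖z‖) * gauss z)) (fun z => ?_)
    (integrable_cube_mul_exp_mul_gauss.const_mul _) hr x).trans (le_of_eq ?_)
  · rw [integral_sub' hPs (integrable_apply_mul_gauss l),
      integral_sub_right_eq_self (fun z : Plane => z l * gauss z) v, sub_self]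
  · calc _ ≤ ‖v‖ * ((1 + ‖z‖) ^ 2 * Real.exp (1 + ‖z‖) * gauss z) * (1 + ‖z‖) := by
          gcongr
          exact abs_kernel_sub_le l hv1
      _ = _ := by ring
  · rw [integral_const_mul, ← gaussConst, hvn, Real.rpow_sub_one hr.ne']
    field_simp

theorem BddPeriodic.stronglyMeasurable_gaussDeriv {φ : Plane → ℝ} (hφ : BddPeriodic φ)
    (l : Fin 2) : StronglyMeasurable fun p : ℝ × Plane => gaussDeriv φ l p.1 p.2 := by
  have := hφ.cont
  have := continuous_gauss
  have h : Continuous fun p : (ℝ × Plane) × Plane =>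
      p.2 l * gauss p.2 * φ (p.1.2 + p.1.1 • p.2) := by fun_prop
  exact h.stronglyMeasurable.integral_prod_right

theorem BddPeriodic.coeff_gaussDeriv {φ : Plane → ℝ} (hφ : BddPeriodic φ) (l : Fin 2) (r : ℝ)
    (k : Fin 2 → ℤ) :
    coeff (gaussDeriv φ l r) k =
      Complex.I * r * k l * gaussWeight r ‖freq k‖ * coeff φ k := by
  obtain ⟨M, hM⟩ := hφ.bdd
  have hc := hφ.cont
  have hg := continuous_gauss
  have hm := continuous_mode k
  have e1 : ∀ x, (gaussDeriv φ l r x : ℂ) * conj (mode k x) = ∫ z : Plane,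
      ((z l * gauss z : ℝ) : ℂ) * ((φ (x + r • z) : ℂ) * conj (mode k x)) := by
    intro x
    rw [gaussDeriv, ← integral_complex_ofReal, ← integral_mul_const]
    congr 1
    funext z
    push_cast
    ring
  rw [coeff_eq_mean, mean_eq_integral]
  simp_rw [e1]
  rw [integral_integral_swap]
  · have e2 : ∀ z : Plane, ∫ x, ((z l * gauss z : ℝ) : ℂ) *
        ((φ (x + r • z) : ℂ) * conj (mode k x)) ∂cellMeasure =
        ((z l * gauss z : ℝ) : ℂ) * Complex.exp (((inner ℝ (r • freq k) z : ℝ) : ℂ) * Complex.I) *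
          coeff φ k := by
      intro z
      rw [integral_const_mul, ← mean_eq_integral, ← coeff_eq_mean (fun x => φ (x + r • z)),
        coeff_shift hφ.periodic, mode, real_inner_smul_left, real_inner_smul_right, mul_assoc]
    simp_rw [e2]
    rw [integral_mul_const, integral_apply_mul_gauss_mul_mode, norm_smul, Real.norm_eq_abs,
      mul_pow, sq_abs, ← mul_pow, ← gaussWeight, PiLp.smul_apply, freq_apply, smul_eq_mul]
    push_cast
    ring
  · have hb : Integrable (fun p : Plane × Plane => ((p.2 l * gauss p.2 : ℝ) : ℂ))
        (cellMeasure.prod volume) := 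
      Integrable.comp_snd (f := fun z : Plane => ((z l * gauss z : ℝ) : ℂ))
        (integrable_apply_mul_gauss l).ofReal cellMeasure
    refine hb.mul_bdd (c := M) ?_ (Filter.Eventually.of_forall fun p => ?_)
    · exact Continuous.aestronglyMeasurable (by fun_prop)
    · rw [norm_mul, RCLike.norm_conj, norm_mode, mul_one, Complex.norm_real]
      exact hM _

theorem integrableOn_rpow_sub_one {β : ℝ} (hβ : 0 < β) (T : ℝ) :
    IntegrableOn (fun r : ℝ => r ^ (β - 1)) (Set.Ioc 0 T) := by
  rcases le_total 0 T with h | h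
  · exact (intervalIntegrable_iff_integrableOn_Ioc_of_le h).1
      (intervalIntegral.intervalIntegrable_rpow' (by linarith))
  · rw [Set.Ioc_eq_empty (not_lt.2 h)]
    exact integrableOn_empty

theorem abs_inv_mul_gaussDeriv_le {β K : ℝ} (hβ : β ∈ Set.Ioo (0 : ℝ) 1) {φ : Plane → ℝ}
    (hφ : BddPeriodic φ) (hK : HolderBound β K φ) (l : Fin 2) {r : ℝ} (hr : 0 < r) (x : Plane) :
    |r⁻¹ * gaussDeriv φ l r x| ≤ K * gaussConst * r ^ (β - 1) := by
  rw [abs_mul, abs_of_pos (by positivity), Real.rpow_sub_one hr.ne']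
  calc _ ≤ r⁻¹ * (K * gaussConst * r ^ β) := by
        gcongr
        exact abs_gaussDeriv_le hβ hφ hK l hr x
    _ = _ := by ring

theorem integrableOn_inv_mul_gaussDeriv {β K : ℝ} (hβ : β ∈ Set.Ioo (0 : ℝ) 1) {φ : Plane → ℝ}
    (hφ : BddPeriodic φ) (hK : HolderBound β K φ) (l : Fin 2) (x : Plane) :
    IntegrableOn (fun r => r⁻¹ * gaussDeriv φ l r x) (Set.Ioc 0 1) := by
  refine ((integrableOn_rpow_sub_one hβ.1 1).const_mul (K * gaussConst)).mono' ?_ ?_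
  · have := (hφ.stronglyMeasurable_gaussDeriv l).measurable
    have h : Measurable fun r : ℝ => gaussDeriv φ l r x :=
      this.comp (measurable_id.prodMk measurable_const)
    exact (measurable_inv.mul h).aestronglyMeasurable
  · exact (ae_restrict_iff' measurableSet_Ioc).2 (Filter.Eventually.of_forall fun r hr =>
      abs_inv_mul_gaussDeriv_le hβ hφ hK l hr.1 x)

/-- The part of the Riesz transform coming from scales below one. -/
def smallScaleRiesz (φ : Plane → ℝ) (l : Fin 2) (x : Plane) : ℝ :=
  ∫ r in Set.Ioc (0 : ℝ) 1, r⁻¹ * gaussDeriv φ l r x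

/-- With `h = x - y`, scales below `‖h‖` are bounded term by term, and larger scales by the
regularity of the kernel. -/
theorem holderBound_smallScaleRiesz {β K : ℝ} (hβ : β ∈ Set.Ioo (0 : ℝ) 1) {φ : Plane → ℝ}
    (hφ : BddPeriodic φ) (hK : HolderBound β K φ) (l : Fin 2) :
    HolderBound β ((2 * gaussConst / β + gaussConst / (1 - β)) * K) (smallScaleRiesz φ l) := by
  have hK0 := hK.nonneg
  have hG := gaussConst_nonneg
  have hβ0 := hβ.1
  have hβ1 : 0 < 1 - β := by linarith [hβ.2]
  intro x y
  rcases eq_or_ne x y with rfl | hxy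
  · simp only [sub_self, abs_zero]
    positivity
  set h := x - y with hh
  have hh0 : 0 < ‖h‖ := norm_pos_iff.2 (sub_ne_zero.2 hxy)
  have hx : x = y + h := by rw [hh]; abel
  rw [hx, smallScaleRiesz, smallScaleRiesz, ← integral_sub
    (integrableOn_inv_mul_gaussDeriv hβ hφ hK l (y + h))
    (integrableOn_inv_mul_gaussDeriv hβ hφ hK l y)]
  have key : ENNReal.ofReal |∫ r in Set.Ioc (0 : ℝ) 1,
      (r⁻¹ * gaussDeriv φ l r (y + h) - r⁻¹ * gaussDeriv φ l r y)| ≤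
      ENNReal.ofReal ((2 * K * gaussConst / β + K * gaussConst / (1 - β)) * ‖h‖ ^ β) := by
    refine (ofReal_abs_integral_le _).trans ?_
    refine (lintegral_mono_set Set.Ioc_subset_Ioi_self).trans ?_
    refine lintegral_Ioi_min_rpow_le hβ (by positivity) (by positivity) hh0 (fun r hr => ?_)
      fun r hr => ?_
    · refine (abs_sub _ _).trans ?_
      linarith [abs_inv_mul_gaussDeriv_le hβ hφ hK l hr.1 (y + h),
        abs_inv_mul_gaussDeriv_le hβ hφ hK l hr.1 y]
    · have hr0 : 0 < r := hh0.trans hr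
      rw [← mul_sub, abs_mul, abs_of_pos (inv_pos.2 hr0)]
      calc _ ≤ r⁻¹ * (K * gaussConst * ‖h‖ * r ^ (β - 1)) := by
            gcongr
            exact abs_gaussDeriv_sub_le hβ hφ hK l hr0 y h (le_of_lt hr)
        _ = _ := by
            rw [show β - 2 = β - 1 - 1 by ring, Real.rpow_sub_one hr0.ne' (β - 1)]
            ring
  refine ((ENNReal.ofReal_le_ofReal_iff (by positivity)).1 key).trans (le_of_eq ?_)
  ring

theorem BddPeriodic.smallScaleRiesz {β K : ℝ} (hβ : β ∈ Set.Ioo (0 : ℝ) 1) {φ : Plane → ℝ}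
    (hφ : BddPeriodic φ) (hK : HolderBound β K φ) (l : Fin 2) :
    BddPeriodic (smallScaleRiesz φ l) := by
  refine ⟨(holderBound_smallScaleRiesz hβ hφ hK l).continuous hβ.1, fun x k => ?_,
    ∫ r in Set.Ioc (0 : ℝ) 1, K * gaussConst * r ^ (β - 1), fun x => ?_⟩
  · unfold SQG.smallScaleRiesz gaussDeriv
    congr 1
    funext r
    congr 2
    funext z
    rw [add_right_comm, hφ.periodic]
  · rw [← Real.norm_eq_abs]
    exact norm_integral_le_of_norm_le ((integrableOn_rpow_sub_one hβ.1 1).const_mul _)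
      ((ae_restrict_iff' measurableSet_Ioc).2 (Filter.Eventually.of_forall fun r hr =>
        abs_inv_mul_gaussDeriv_le hβ hφ hK l hr.1 x))

/-- The `r⁻¹` cancels the factor `r` in the multiplier of `gaussDeriv`, leaving `i k_l` times an
integral of Gaussian weights, which is the part of `1/|k|` coming from scales below one. -/
theorem coeff_smallScaleRiesz {β K : ℝ} (hβ : β ∈ Set.Ioo (0 : ℝ) 1) {φ : Plane → ℝ}
    (hφ : BddPeriodic φ) (hK : HolderBound β K φ) (l : Fin 2) (k : Fin 2 → ℤ) :
    coeff (smallScaleRiesz φ l) k =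
      Complex.I * k l * (∫ r in Set.Ioc (0 : ℝ) 1, gaussWeight r ‖freq k‖ : ℝ) * coeff φ k := by
  have hm := continuous_mode k
  have e1 : ∀ x, (smallScaleRiesz φ l x : ℂ) * conj (mode k x) = ∫ r in Set.Ioc (0 : ℝ) 1,
      (r : ℂ)⁻¹ * ((gaussDeriv φ l r x : ℂ) * conj (mode k x)) := by
    intro x
    rw [smallScaleRiesz, ← integral_complex_ofReal, ← integral_mul_const]
    congr 1
    funext r
    push_cast
    ring
  rw [coeff_eq_mean, mean_eq_integral]
  simp_rw [e1]
  rw [integral_integral_swap]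
  · have e2 : ∀ r ∈ Set.Ioc (0 : ℝ) 1, ∫ x, (r : ℂ)⁻¹ * ((gaussDeriv φ l r x : ℂ) *
        conj (mode k x)) ∂cellMeasure =
        ((gaussWeight r ‖freq k‖ : ℝ) : ℂ) * (Complex.I * k l * coeff φ k) := by
      intro r hr
      have hr0 : (r : ℂ) ≠ 0 := by exact_mod_cast hr.1.ne'
      rw [integral_const_mul, ← mean_eq_integral, ← coeff_eq_mean, hφ.coeff_gaussDeriv]
      field_simp
    rw [setIntegral_congr_fun measurableSet_Ioc e2, integral_mul_const, integral_complex_ofReal]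
    ring
  · have hb : Integrable (fun p : Plane × ℝ => K * gaussConst * p.2 ^ (β - 1))
        (cellMeasure.prod (volume.restrict (Set.Ioc 0 1))) :=
      Integrable.comp_snd (f := fun r : ℝ => K * gaussConst * r ^ (β - 1))
        ((integrableOn_rpow_sub_one hβ.1 1).const_mul (K * gaussConst)) cellMeasure
    refine hb.mono' ?_ ?_
    · have h := (hφ.stronglyMeasurable_gaussDeriv l).measurable.comp
        (measurable_snd.prodMk measurable_fst : Measurable fun p : Plane × ℝ => (p.2, p.1))
      have h' : Measurable fun p : Plane × ℝ => gaussDeriv φ l p.2 p.1 := h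
      have h2 := hm.measurable
      refine Measurable.aestronglyMeasurable ?_
      unfold Function.uncurry
      exact (Complex.measurable_ofReal.comp measurable_snd).inv.mul
        ((Complex.measurable_ofReal.comp h').mul
          (Complex.continuous_conj.measurable.comp (h2.comp measurable_fst)))
    · have : ∀ᵐ p : Plane × ℝ ∂(cellMeasure.prod (volume.restrict (Set.Ioc 0 1))),
          p.2 ∈ Set.Ioc (0 : ℝ) 1 :=
        Measure.quasiMeasurePreserving_snd.ae (ae_restrict_mem measurableSet_Ioc)
      filter_upwards [this] with p hp
      have := abs_inv_mul_gaussDeriv_le hβ hφ hK l hp.1 p.1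
      rw [abs_mul] at this
      simpa [Function.uncurry, norm_mode] using this

/-- From `e^x ≥ x³/3!` at `x = (rκ)²/2`; thus `48 = 6 · 8`. -/
theorem gaussWeight_le {r κ : ℝ} (hr : 0 < r) (hκ : 0 < κ) :
    gaussWeight r κ ≤ 48 * κ ^ (-6 : ℝ) * r ^ (-6 : ℝ) := by
  have h := Real.pow_div_factorial_le_exp ((1 / 2) * (r * κ) ^ 2) (by positivity) 3
  have h2 : 0 < ((1 / 2) * (r * κ) ^ 2) ^ 3 / (Nat.factorial 3 : ℝ) := by positivity
  have h3 := inv_anti₀ h2 h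
  rw [gaussWeight, show -(1 / 2) * (r * κ) ^ 2 = -((1 / 2) * (r * κ) ^ 2) by ring, Real.exp_neg]
  refine h3.trans (le_of_eq ?_)
  rw [Real.rpow_neg hκ.le, Real.rpow_neg hr.le]
  norm_cast
  simp [Nat.factorial]
  field_simp
  norm_num

theorem gaussWeight_pos (r κ : ℝ) : 0 < gaussWeight r κ := Real.exp_pos _

theorem integrableOn_gaussWeight {κ : ℝ} (hκ : 0 < κ) (s : Set ℝ) :
    IntegrableOn (fun r => gaussWeight r κ) s := by
  have := integrable_exp_neg_mul_sq (b := κ ^ 2 / 2) (by positivity)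
  refine (this.congr (Filter.Eventually.of_forall fun r => ?_)).integrableOn
  simp only [gaussWeight]
  congr 1
  ring

theorem integral_gaussWeight_Ioi_one_le {κ : ℝ} (hκ : 0 < κ) :
    ∫ r in Set.Ioi (1 : ℝ), gaussWeight r κ ≤ 10 * κ ^ (-6 : ℝ) := by
  have h1 : IntegrableOn (fun r : ℝ => 48 * κ ^ (-6 : ℝ) * r ^ (-6 : ℝ)) (Set.Ioi 1) :=
    (integrableOn_Ioi_rpow_of_lt (by norm_num) one_pos).const_mul _
  calc _ ≤ ∫ r in Set.Ioi (1 : ℝ), 48 * κ ^ (-6 : ℝ) * r ^ (-6 : ℝ) :=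
        setIntegral_mono_on (integrableOn_gaussWeight hκ _) h1 measurableSet_Ioi
          fun r hr => gaussWeight_le (one_pos.trans hr) hκ
    _ ≤ _ := by
        rw [integral_const_mul, integral_Ioi_rpow_of_lt (by norm_num) one_pos]
        have : 0 < (κ ^ 6)⁻¹ := by positivity
        norm_num
        linarith

/-- The half-line Gaussian integral writes `1/κ` as a superposition of Gaussian weights. Cutting it
at scale one splits the Riesz transform into a singular part and a smooth part. -/
theorem integral_gaussWeight_add {κ : ℝ} (hκ : 0 < κ) :
    Real.sqrt (2 / Real.pi) * ((∫ r in Set.Ioc (0 : ℝ) 1, gaussWeight r κ) +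
      ∫ r in Set.Ioi (1 : ℝ), gaussWeight r κ) = κ⁻¹ := by
  rw [← setIntegral_union (Set.Ioc_disjoint_Ioi le_rfl) measurableSet_Ioi
    (integrableOn_gaussWeight hκ _) (integrableOn_gaussWeight hκ _),
    Set.Ioc_union_Ioi_eq_Ioi zero_le_one]
  have h := integral_gaussian_Ioi (κ ^ 2 / 2)
  have e : ∀ r : ℝ, gaussWeight r κ = Real.exp (-(κ ^ 2 / 2) * r ^ 2) := fun r => by
    rw [gaussWeight]; congr 1; ring
  simp_rw [e]
  have hpi := Real.pi_pos
  rw [h, mul_div_assoc', ← Real.sqrt_mul (by positivity)]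
  rw [show 2 / Real.pi * (Real.pi / (κ ^ 2 / 2)) = (2 / κ) ^ 2 by field_simp,
    Real.sqrt_sq (by positivity)]
  field_simp

/-- The Riesz transforms preserve Hölder continuity. -/
theorem exists_riesz {β : ℝ} (hβ : β ∈ Set.Ioo (0 : ℝ) 1) :
    ∃ C : ℝ, 0 < C ∧ ∀ (φ : Plane → ℝ) (K : ℝ), MemL2 φ → HolderBound β K φ → ∀ l : Fin 2,
      ∃ V : Plane → ℝ, BddPeriodic V ∧ HolderBound β (C * K) V ∧
        ∀ k, coeff V k = Complex.I * k l / ‖freq k‖ * coeff φ k := by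
  set S4 : ℝ := ∑' k : Fin 2 → ℤ, ‖freq k‖ ^ (-4 : ℝ) with hS4
  set S5 : ℝ := ∑' k : Fin 2 → ℤ, ‖freq k‖ ^ (-5 : ℝ) with hS5
  have hS40 : 0 ≤ S4 := tsum_nonneg fun k => by positivity
  have hS50 : 0 ≤ S5 := tsum_nonneg fun k => by positivity
  have hs4 : Summable fun k : Fin 2 → ℤ => ‖freq k‖ ^ (-4 : ℝ) :=
    summable_norm_freq_rpow (by norm_num)
  have hs5 : Summable fun k : Fin 2 → ℤ => ‖freq k‖ ^ (-5 : ℝ) :=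
    summable_norm_freq_rpow (by norm_num)
  set κ : ℝ := Real.sqrt (2 / Real.pi) with hκ
  have hκ0 : 0 ≤ κ := Real.sqrt_nonneg _
  have hκ1 : κ ≤ 1 := by
    rw [hκ, Real.sqrt_le_one, div_le_one Real.pi_pos]
    linarith [Real.pi_gt_three]
  have hG := gaussConst_nonneg
  have hβ0 := hβ.1
  have hβ1 : 0 < 1 - β := by linarith [hβ.2]
  refine ⟨(2 * gaussConst / β + gaussConst / (1 - β)) + 200 * S5 + 100 * S4 + 1, by positivity,
    fun φ K hφ hK l => ?_⟩
  have hb := hφ.bddPeriodic hβ hK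
  have hK0 := hK.nonneg
  set m : (Fin 2 → ℤ) → ℝ := fun k => ∫ r in Set.Ioi (1 : ℝ), gaussWeight r ‖freq k‖ with hm
  -- These are the coefficients of the part of the Riesz transform from scales above one. The
  -- Gaussian tail makes them decay like `|k|^{-5}`, fast enough for a Lipschitz trigonometric
  -- series.
  set c : (Fin 2 → ℤ) → ℂ := fun k => (κ * m k : ℝ) * (Complex.I * k l) * coeff φ k with hc
  have hcle : ∀ k, ‖c k‖ ≤ 100 * K * ‖freq k‖ ^ (-5 : ℝ) := by
    intro k
    rcases eq_or_ne k 0 with rfl | hk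
    · simp only [hc, Pi.zero_apply, Int.cast_zero, mul_zero, zero_mul, norm_zero]
      positivity
    have hk1 := one_le_norm_freq hk
    have hk0 : 0 < ‖freq k‖ := by linarith
    have hm0 : 0 ≤ m k := integral_nonneg fun r => (gaussWeight_pos _ _).le
    have h1 : ‖coeff φ k‖ ≤ 10 * K := norm_coeff_le
      (hK.abs_le hβ hφ.periodic hb.integrable hφ.mean_zero) k
    have h2 : |(k l : ℝ)| ≤ ‖freq k‖ := abs_apply_le_norm (freq k) l
    have h3 : ‖c k‖ = κ * m k * |(k l : ℝ)| * ‖coeff φ k‖ := by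
      simp only [hc, norm_mul, Complex.norm_I, one_mul, Complex.norm_real, Complex.norm_intCast,
        Real.norm_eq_abs, abs_of_nonneg hm0, abs_of_nonneg hκ0]
    rw [h3]
    calc _ ≤ 1 * (10 * ‖freq k‖ ^ (-6 : ℝ)) * ‖freq k‖ * (10 * K) := by
          gcongr
          exact integral_gaussWeight_Ioi_one_le hk0
      _ = _ := by
          rw [show (-6 : ℝ) = -5 - 1 by norm_num, Real.rpow_sub_one hk0.ne']
          field_simp
          ring
  have hcle' : ∀ k, ‖freq k‖ * ‖c k‖ ≤ 100 * K * ‖freq k‖ ^ (-4 : ℝ) := by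
    intro k
    rcases eq_or_ne k 0 with rfl | hk
    · rw [norm_freq_zero, zero_mul]
      positivity
    have hk1 := one_le_norm_freq hk
    have hk0 : 0 < ‖freq k‖ := by linarith
    calc _ ≤ ‖freq k‖ * (100 * K * ‖freq k‖ ^ (-5 : ℝ)) := by gcongr; exact hcle k
      _ = _ := by
          rw [show (-5 : ℝ) = -4 - 1 by norm_num, Real.rpow_sub_one hk0.ne']
          field_simp
  have h0 : Summable fun k => ‖c k‖ :=
    .of_nonneg_of_le (fun k => norm_nonneg _) hcle (hs5.mul_left _)
  have h1 : Summable fun k => ‖freq k‖ * ‖c k‖ :=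
    .of_nonneg_of_le (fun k => by positivity) hcle' (hs4.mul_left _)
  have hfneg : ∀ k, ‖freq (-k)‖ = ‖freq k‖ := fun k => by
    rw [← norm_neg]; congr 1; ext i; simp [freq]
  obtain ⟨W, hW, hWc, hWb, hWl⟩ := exists_trigSeries (c := c) (fun k => by
    simp only [hc, hm, hfneg, coeff_neg_freq, Pi.neg_apply, map_mul, Complex.conj_ofReal,
      Complex.conj_I, map_intCast]
    push_cast
    ring) h0 h1
  have hT0 : ∑' k, ‖c k‖ ≤ 100 * K * S5 := by
    rw [hS5, ← tsum_mul_left]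
    exact h0.tsum_le_tsum hcle (hs5.mul_left _)
  have hT1 : ∑' k, ‖freq k‖ * ‖c k‖ ≤ 100 * K * S4 := by
    rw [hS4, ← tsum_mul_left]
    exact h1.tsum_le_tsum hcle' (hs4.mul_left _)
  have hU := BddPeriodic.smallScaleRiesz hβ hb hK l
  have hUh := holderBound_smallScaleRiesz hβ hb hK l
  -- The Lipschitz bound serves at distances up to one, and the uniform bound beyond.
  have hWh : ∀ x y, |W x - W y| ≤ (200 * S5 + 100 * S4) * K * ‖x - y‖ ^ β := by
    intro x y
    rcases le_total ‖x - y‖ 1 with h | h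
    · have h2 : ‖x - y‖ ≤ ‖x - y‖ ^ β := by
        nth_rewrite 1 [← Real.rpow_one ‖x - y‖]
        exact Real.rpow_le_rpow_of_exponent_ge' (norm_nonneg _) h hβ.1.le hβ.2.le
      calc _ ≤ (100 * K * S4) * ‖x - y‖ ^ β := (hWl x y).trans (by gcongr)
        _ ≤ _ := mul_le_mul_of_nonneg_right (by nlinarith [mul_nonneg hS50 hK0]) (by positivity)
    · have h2 : 1 ≤ ‖x - y‖ ^ β := Real.one_le_rpow h hβ.1.le
      calc _ ≤ (200 * K * S5) * 1 := by
            refine (abs_sub _ _).trans ?_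
            linarith [hWb x, hWb y]
        _ ≤ (200 * S5 + 100 * S4) * K * ‖x - y‖ ^ β := by
            refine mul_le_mul ?_ h2 zero_le_one (by positivity)
            nlinarith [mul_nonneg hS40 hK0]
  refine ⟨fun x => κ * smallScaleRiesz φ l x - (-1) * W x, ?_, fun x y => ?_, fun k => ?_⟩
  · have hconst : ∀ t : ℝ, BddPeriodic fun _ => t := fun t =>
      ⟨continuous_const, fun _ _ => rfl, |t|, fun _ => le_rfl⟩
    exact ((hconst κ).mul hU).sub ((hconst (-1)).mul hW)
  · have e : κ * smallScaleRiesz φ l x - (-1) * W x - (κ * smallScaleRiesz φ l y - (-1) * W y) =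
        κ * (smallScaleRiesz φ l x - smallScaleRiesz φ l y) + (W x - W y) := by ring
    rw [e]
    refine (abs_add_le _ _).trans ?_
    rw [abs_mul, abs_of_nonneg hκ0]
    have h2 : κ * |smallScaleRiesz φ l x - smallScaleRiesz φ l y| ≤
        (2 * gaussConst / β + gaussConst / (1 - β)) * K * ‖x - y‖ ^ β :=
      (mul_le_of_le_one_left (abs_nonneg _) hκ1).trans (hUh x y)
    have h3 := hWh x y
    have h4 : 0 ≤ K * ‖x - y‖ ^ β := by positivity
    nlinarith
  · rw [coeff_sub (hU.integrable.const_mul κ) (hW.integrable.const_mul (-1)), coeff_const_mul,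
      coeff_const_mul, hWc, coeff_smallScaleRiesz hβ hb hK]
    rcases eq_or_ne k 0 with rfl | hk
    · simp [hc]
    have hk1 := one_le_norm_freq hk
    have hk0 : 0 < ‖freq k‖ := by linarith
    have key := integral_gaussWeight_add hk0
    rw [← hκ] at key
    have key' : (κ : ℂ) * ((∫ r in Set.Ioc (0 : ℝ) 1, gaussWeight r ‖freq k‖ : ℝ) + (m k : ℝ)) =
        (‖freq k‖ : ℂ)⁻¹ := by
      rw [← Complex.ofReal_inv, ← key]
      push_cast
      rfl
    simp only [hc]
    push_cast
    rw [div_eq_mul_inv, ← key']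
    ring

/-! ### The velocity field. -/

theorem coeff_congr_ae {a b : Plane → ℝ} (h : a =ᵐ[cellMeasure] b) (k : Fin 2 → ℤ) :
    coeff a k = coeff b k := by
  rw [coeff_eq_mean, coeff_eq_mean, mean_eq_integral, mean_eq_integral]
  refine integral_congr_ae ?_
  filter_upwards [h] with x hx
  rw [hx]

theorem norm_int_le_norm_freq (k : Fin 2 → ℤ) (j : Fin 2) : ‖(k j : ℂ)‖ ≤ ‖freq k‖ := by
  rw [Complex.norm_intCast]
  exact abs_apply_le_norm (freq k) j

theorem IsRieszPerp.coeff_zero {φ : Plane → ℝ} {u : Plane → Plane} (hu : IsRieszPerp φ u)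
    (j : Fin 2) : coeff (fun x => u x j) 0 = 0 := by
  rw [coeff_zero_freq, (hu.memL2 j).mean_zero, Complex.ofReal_zero]

theorem IsRieszPerp.norm_coeff_le {φ : Plane → ℝ} {u : Plane → Plane} (hu : IsRieszPerp φ u)
    (j : Fin 2) (k : Fin 2 → ℤ) : ‖coeff (fun x => u x j) k‖ ≤ ‖coeff φ k‖ := by
  rcases eq_or_ne k 0 with rfl | hk
  · rw [hu.coeff_zero, norm_zero]
    exact norm_nonneg _
  have h0 : 0 < ‖freq k‖ := by linarith [one_le_norm_freq hk]
  have key : ∀ i, ‖Complex.I * (k i : ℂ) / (‖freq k‖ : ℂ) * coeff φ k‖ ≤ ‖coeff φ k‖ := by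
    intro i
    rw [norm_mul, norm_div, norm_mul, Complex.norm_I, one_mul, Complex.norm_real, norm_norm]
    exact mul_le_of_le_one_left (norm_nonneg _) ((div_le_one h0).2 (norm_int_le_norm_freq k i))
  fin_cases j
  · refine (le_of_eq ?_).trans (key 1)
    exact (congrArg norm (hu.coeff_fst ⟨k, hk⟩)).trans (norm_neg _)
  · exact (le_of_eq (congrArg norm (hu.coeff_snd ⟨k, hk⟩))).trans (key 0)

theorem IsRieszPerp.divergence_free {φ : Plane → ℝ} {u : Plane → Plane} (hu : IsRieszPerp φ u)
    (k : Fin 2 → ℤ) : ∑ j, (k j : ℂ) * coeff (fun x => u x j) k = 0 := by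
  rcases eq_or_ne k 0 with rfl | hk
  · simp
  rw [Fin.sum_univ_two, hu.coeff_fst ⟨k, hk⟩, hu.coeff_snd ⟨k, hk⟩]
  ring

/-- The velocity has a Hölder continuous representative. -/
theorem exists_velocity {β : ℝ} (hβ : β ∈ Set.Ioo (0 : ℝ) 1) :
    ∃ C : ℝ, 0 < C ∧ ∀ (φ : Plane → ℝ) (u : Plane → Plane) (K : ℝ), MemL2 φ →
      HolderBound β K φ → IsRieszPerp φ u → ∃ U : Plane → Plane,
        (∀ j, BddPeriodic fun x => U x j) ∧ (∀ j, HolderBound β (C * K) fun x => U x j) ∧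
        ∀ j, (fun x => u x j) =ᵐ[cellMeasure] fun x => U x j := by
  obtain ⟨C, hC, h⟩ := exists_riesz hβ
  refine ⟨C, hC, fun φ u K hφ hK hu => ?_⟩
  obtain ⟨V0, hV0, hV0K, hV0c⟩ := h φ K hφ hK 0
  obtain ⟨V1, hV1, hV1K, hV1c⟩ := h φ K hφ hK 1
  have hneg : BddPeriodic fun x => -V1 x := by
    obtain ⟨M, hM⟩ := hV1.bdd
    exact ⟨hV1.cont.neg, fun x k => by simp only [hV1.periodic x k], M, fun x => by
      rw [abs_neg]; exact hM x⟩
  refine ⟨fun x => !₂[-V1 x, V0 x], ?_, ?_, ?_⟩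
  · rw [Fin.forall_fin_two]
    exact ⟨hneg, hV0⟩
  · rw [Fin.forall_fin_two]
    refine ⟨fun x y => ?_, hV0K⟩
    have := hV1K y x
    rw [norm_sub_rev] at this
    simpa [neg_add_eq_sub] using this
  · rw [Fin.forall_fin_two]
    constructor
    · refine ae_eq_of_coeff_eq (hu.memL2 0).memLp_cellMeasure (hneg.memLp 2) fun k => ?_
      have e : coeff (fun x => -V1 x) k = -coeff V1 k := by
        have := coeff_const_mul (-1) V1 k
        simpa using this
      change _ = coeff (fun x => -V1 x) k
      rw [e, hV1c]
      rcases eq_or_ne k 0 with rfl | hk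
      · rw [hu.coeff_zero]; simp
      · exact hu.coeff_fst ⟨k, hk⟩
    · refine ae_eq_of_coeff_eq (hu.memL2 1).memLp_cellMeasure (hV0.memLp 2) fun k => ?_
      refine Eq.trans ?_ (hV0c k).symm
      rcases eq_or_ne k 0 with rfl | hk
      · rw [hu.coeff_zero]; simp
      · exact hu.coeff_snd ⟨k, hk⟩

theorem flux_congr_ae {φ : Plane → ℝ} {u U : Plane → Plane}
    (h : ∀ j, (fun x => u x j) =ᵐ[cellMeasure] fun x => U x j) (k : Fin 2 → ℤ) :
    flux φ u k = flux φ U k := by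
  unfold flux
  congr 4
  refine Finset.sum_congr rfl fun j _ => ?_
  congr 1
  exact coeff_congr_ae ((h j).mono fun x hx => by simp only at hx ⊢; rw [hx]) k

/-- The flux estimate for the velocity of the surface quasi-geostrophic equation. -/
theorem lintegral_gaussFlux_riesz_le {α β : ℝ} (hα : α ∈ Set.Ioo (0 : ℝ) 1)
    (hβ : β ∈ Set.Ioo (0 : ℝ) 1) :
    ∃ C : ℝ, 0 < C ∧ ∀ (φ : Plane → ℝ) (u : Plane → Plane) (K : ℝ), MemL2 φ →
      HolderBound β K φ → IsRieszPerp φ u →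
      ∫⁻ r in Set.Ioi (0 : ℝ), ENNReal.ofReal (r ^ (-(1 + 2 * α))) *
          ENNReal.ofReal |gaussFlux φ u r| ≤
        ENNReal.ofReal (C * K) * sobolevENN (1 + 2 * α - β) φ := by
  obtain ⟨C1, hC1, h1⟩ := exists_velocity hβ
  obtain ⟨C2, hC2, h2⟩ := lintegral_gaussFlux_le hα hβ
  refine ⟨C2 * (C1 + 1), by positivity, fun φ u K hφ hK hu => ?_⟩
  obtain ⟨U, hU, hUK, hUu⟩ := h1 φ u K hφ hK hu
  have hK0 := hK.nonneg
  have e : gaussFlux φ u = gaussFlux φ U := by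
    funext r
    simp only [gaussFlux, flux_congr_ae hUu]
  have hc : ∀ j k, coeff (fun x => U x j) k = coeff (fun x => u x j) k := fun j k =>
    (coeff_congr_ae (hUu j) k).symm
  -- `(C1 + 1) * K` is a common Hölder bound for the scalar and for the velocity.
  have := h2 φ U ((C1 + 1) * K) (hφ.bddPeriodic hβ hK) hU
    (fun k => by simp_rw [hc]; exact hu.divergence_free k)
    (fun j k => by rw [hc]; exact hu.norm_coeff_le j k)
    (fun x y => (hK x y).trans (by gcongr; nlinarith))
    (fun j x y => (hUK j x y).trans (by gcongr; linarith))
  rwa [← e, ← mul_assoc] at this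

/-- A crude bound from the sup norms, whose only role is to make sums against Gaussian weights
converge absolutely and uniformly in time. The constant is `2 · 10³`: two components and three sup
norms. -/
theorem exists_abs_flux_le {β : ℝ} (hβ : β ∈ Set.Ioo (0 : ℝ) 1) :
    ∃ C : ℝ, 0 < C ∧ ∀ (φ : Plane → ℝ) (u : Plane → Plane) (K : ℝ), MemL2 φ →
      HolderBound β K φ → IsRieszPerp φ u → ∀ k, |flux φ u k| ≤ C * K ^ 3 * ‖freq k‖ := by
  obtain ⟨C1, hC1, h1⟩ := exists_velocity hβ
  refine ⟨2000 * C1, by positivity, fun φ u K hφ hK hu k => ?_⟩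
  obtain ⟨U, hU, hUK, hUu⟩ := h1 φ u K hφ hK hu
  have hK0 := hK.nonneg
  have hb := hφ.bddPeriodic hβ hK
  have hφb := hK.abs_le hβ hφ.periodic hb.integrable hφ.mean_zero
  have hUb : ∀ j x, |U x j| ≤ 10 * (C1 * K) := fun j =>
    (hUK j).abs_le hβ (hU j).periodic (hU j).integrable (by
      have := hu.coeff_zero j
      rw [coeff_congr_ae (hUu j), coeff_zero_freq] at this
      exact_mod_cast this)
  have h2 : ∀ j, ‖coeff (fun x => φ x * U x j) k‖ ≤ 10 * K * (10 * (C1 * K)) := fun j =>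
    norm_coeff_le (fun x => by
      rw [abs_mul]
      exact mul_le_mul (hφb x) (hUb j x) (abs_nonneg _) (by positivity)) k
  rw [flux_congr_ae hUu, flux]
  refine (Complex.abs_re_le_norm _).trans ?_
  rw [norm_mul, norm_neg, norm_mul, Complex.norm_I, one_mul, RCLike.norm_conj]
  have h3 : ‖∑ j, (k j : ℂ) * coeff (fun x => φ x * U x j) k‖ ≤
      ∑ _j : Fin 2, ‖freq k‖ * (10 * K * (10 * (C1 * K))) := by
    refine norm_sum_le_of_le _ fun j _ => ?_
    rw [norm_mul]
    exact mul_le_mul (norm_int_le_norm_freq k j) (h2 j) (norm_nonneg _) (norm_nonneg _)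
  calc _ ≤ (∑ _j : Fin 2, ‖freq k‖ * (10 * K * (10 * (C1 * K)))) * (10 * K) := by
        gcongr
        exact norm_coeff_le hφb k
    _ = _ := by
        rw [Fin.sum_univ_two]
        ring

/-! ### From Gaussian filters to the multiplier `|k|^{2α}`. -/

/-- The difference of two Gaussian weights. -/
def weightDiff (r κ : ℝ) : ℝ := gaussWeight r κ - gaussWeight (2 * r) κ

theorem weightDiff_nonneg (r κ : ℝ) : 0 ≤ weightDiff r κ := by
  rw [weightDiff, gaussWeight, gaussWeight, sub_nonneg, Real.exp_le_exp]
  nlinarith [sq_nonneg (r * κ)]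

theorem weightDiff_le_gaussWeight (r κ : ℝ) : weightDiff r κ ≤ gaussWeight r κ := by
  rw [weightDiff]
  linarith [gaussWeight_pos (2 * r) κ]

theorem gaussWeight_le_one (r κ : ℝ) : gaussWeight r κ ≤ 1 := by
  rw [gaussWeight, Real.exp_le_one_iff]
  nlinarith [sq_nonneg (r * κ)]

theorem weightDiff_le_sq (r κ : ℝ) : weightDiff r κ ≤ 2 * κ ^ 2 * r ^ 2 := by
  have h1 := Real.add_one_le_exp (-(1 / 2) * (2 * r * κ) ^ 2)
  rw [weightDiff]
  have h2 := gaussWeight_le_one r κ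
  have h3 : gaussWeight (2 * r) κ = Real.exp (-(1 / 2) * (2 * r * κ) ^ 2) := rfl
  rw [h3]
  nlinarith

theorem weightDiff_mul (r s κ : ℝ) : weightDiff (r * s) κ = weightDiff r (s * κ) := by
  simp only [weightDiff, gaussWeight, mul_assoc]

theorem continuous_weightDiff (κ : ℝ) : Continuous fun r => weightDiff r κ := by
  unfold weightDiff gaussWeight
  fun_prop

/-- A single Gaussian weight would diverge at `r = 0`. The difference vanishes quadratically there,
which suffices since `α < 1`; at infinity boundedness suffices since `α > 0`. -/
theorem integrableOn_weightDiff {α : ℝ} (hα : α ∈ Set.Ioo (0 : ℝ) 1) (κ : ℝ) :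
    IntegrableOn (fun r => weightDiff r κ * r ^ (-(1 + 2 * α))) (Set.Ioi 0) := by
  have hm : Measurable fun r : ℝ => weightDiff r κ * r ^ (-(1 + 2 * α)) :=
    (continuous_weightDiff κ).measurable.mul (by fun_prop)
  rw [← Set.Ioc_union_Ioi_eq_Ioi zero_le_one]
  refine IntegrableOn.union ?_ ?_
  · have h := (integrableOn_rpow_sub_one (β := 2 - 2 * α) (by linarith [hα.2]) 1).const_mul
      (2 * κ ^ 2)
    refine h.mono' hm.aestronglyMeasurable ((ae_restrict_iff' measurableSet_Ioc).2
      (Filter.Eventually.of_forall fun r hr => ?_))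
    have hr0 : 0 < r := hr.1
    rw [Real.norm_of_nonneg (mul_nonneg (weightDiff_nonneg _ _) (by positivity))]
    calc _ ≤ 2 * κ ^ 2 * r ^ 2 * r ^ (-(1 + 2 * α)) := by gcongr; exact weightDiff_le_sq r κ
      _ = 2 * κ ^ 2 * r ^ (2 - 2 * α - 1) := by
        have : r ^ (2 - 2 * α - 1) = r ^ 2 * r ^ (-(1 + 2 * α)) := by
          rw [← Real.rpow_natCast, ← Real.rpow_add hr0]; congr 1; push_cast; ring
        rw [this]; ring
  · refine (integrableOn_Ioi_rpow_of_lt (a := -(1 + 2 * α)) (by linarith [hα.1]) one_pos).mono'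
      hm.aestronglyMeasurable ((ae_restrict_iff' measurableSet_Ioi).2
      (Filter.Eventually.of_forall fun r hr => ?_))
    have hr0 : 0 < r := one_pos.trans hr
    rw [Real.norm_of_nonneg (mul_nonneg (weightDiff_nonneg _ _) (by positivity))]
    exact mul_le_of_le_one_left (by positivity)
      ((weightDiff_le_gaussWeight _ _).trans (gaussWeight_le_one _ _))

/-- The truncated multiplier approximating a multiple of `κ^{2α}`. -/
def filterWeight (α ε κ : ℝ) : ℝ := ∫ r in Set.Ioi ε, weightDiff r κ * r ^ (-(1 + 2 * α))

/-- The normalization constant of `filterWeight`. -/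
def filterConst (α : ℝ) : ℝ := filterWeight α 0 1

theorem weightDiff_mul_rpow_nonneg {r : ℝ} (hr : 0 ≤ r) (κ p : ℝ) : 0 ≤ weightDiff r κ * r ^ p :=
  mul_nonneg (weightDiff_nonneg _ _) (by positivity)

theorem filterWeight_nonneg {ε : ℝ} (hε : 0 ≤ ε) (α κ : ℝ) : 0 ≤ filterWeight α ε κ :=
  setIntegral_nonneg measurableSet_Ioi fun _ hr =>
    weightDiff_mul_rpow_nonneg (hε.trans_lt hr).le _ _

theorem filterWeight_le {α ε : ℝ} (hα : α ∈ Set.Ioo (0 : ℝ) 1) (hε : 0 ≤ ε) (κ : ℝ) :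
    filterWeight α ε κ ≤ filterWeight α 0 κ :=
  setIntegral_mono_set (integrableOn_weightDiff hα κ)
    ((ae_restrict_iff' measurableSet_Ioi).2 (Filter.Eventually.of_forall fun _ hr =>
      weightDiff_mul_rpow_nonneg (le_of_lt hr) _ _))
    (Set.Ioi_subset_Ioi hε).eventuallyLE

/-- The weights depend only on `rκ`, so the substitution `r ↦ κr` extracts the power of `κ`. -/
theorem filterWeight_zero {α κ : ℝ} (hκ : 0 < κ) :
    filterWeight α 0 κ = filterConst α * κ ^ (2 * α) := by
  have h := integral_comp_mul_left_Ioi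
    (fun r : ℝ => weightDiff r 1 * r ^ (-(1 + 2 * α))) 0 hκ
  rw [mul_zero, smul_eq_mul] at h
  have h2 : ∀ r ∈ Set.Ioi (0 : ℝ), weightDiff r κ * r ^ (-(1 + 2 * α)) =
      κ ^ (1 + 2 * α) * (weightDiff (κ * r) 1 * (κ * r) ^ (-(1 + 2 * α))) := by
    intro r hr
    have hr0 : 0 < r := hr
    rw [mul_comm κ r, weightDiff_mul, mul_one, Real.mul_rpow hr0.le hκ.le, Real.rpow_neg hκ.le]
    field_simp
  rw [filterConst, filterWeight, filterWeight, setIntegral_congr_fun measurableSet_Ioi h2,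
    integral_const_mul, h, Real.rpow_add hκ, Real.rpow_one]
  field_simp

theorem filterConst_pos {α : ℝ} (hα : α ∈ Set.Ioo (0 : ℝ) 1) : 0 < filterConst α := by
  rw [filterConst, filterWeight, setIntegral_pos_iff_support_of_nonneg_ae
    ((ae_restrict_iff' measurableSet_Ioi).2 (Filter.Eventually.of_forall fun _ hr =>
      weightDiff_mul_rpow_nonneg (le_of_lt hr) _ _)) (integrableOn_weightDiff hα 1)]
  have : Set.Ioi (0 : ℝ) ⊆
      (Function.support fun r : ℝ => weightDiff r 1 * r ^ (-(1 + 2 * α))) ∩ Set.Ioi 0 := by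
    intro r hr
    have hr0 : 0 < r := hr
    refine ⟨(mul_pos ?_ (by positivity)).ne', hr⟩
    rw [weightDiff, gaussWeight, gaussWeight, sub_pos, Real.exp_lt_exp]
    nlinarith
  refine lt_of_lt_of_le ?_ (measure_mono this)
  simp

/-- For `ε > 0` the truncated multiplier inherits the decay of the Gaussian of width `ε`, so it is
summable against any polynomial growth of the flux. -/
theorem filterWeight_le_gaussWeight {α ε : ℝ} (hα : α ∈ Set.Ioo (0 : ℝ) 1) (hε : 0 < ε) {κ : ℝ}
    (hκ : 0 ≤ κ) :
    filterWeight α ε κ ≤ (∫ r in Set.Ioi ε, r ^ (-(1 + 2 * α))) * gaussWeight ε κ := by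
  rw [filterWeight, ← integral_mul_const]
  refine setIntegral_mono_on ((integrableOn_weightDiff hα κ).mono_set (Set.Ioi_subset_Ioi hε.le))
    ((integrableOn_Ioi_rpow_of_lt (by linarith [hα.1]) hε).mul_const _) measurableSet_Ioi
    fun r hr => ?_
  have hr0 : 0 < r := hε.trans hr
  rw [mul_comm]
  gcongr
  refine (weightDiff_le_gaussWeight _ _).trans (Real.exp_le_exp.2 ?_)
  have : ε * κ ≤ r * κ := by gcongr; exact le_of_lt hr
  nlinarith [mul_nonneg hε.le hκ, mul_self_le_mul_self (mul_nonneg hε.le hκ) this]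

theorem Ioi_zero_eq_iUnion : Set.Ioi (0 : ℝ) = ⋃ n : ℕ, Set.Ioi (1 / ((n : ℝ) + 1)) := by
  ext r
  simp only [Set.mem_Ioi, Set.mem_iUnion]
  exact ⟨fun hr => exists_nat_one_div_lt hr, fun ⟨n, hn⟩ => lt_trans (by positivity) hn⟩

theorem tendsto_filterWeight {α : ℝ} (hα : α ∈ Set.Ioo (0 : ℝ) 1) (κ : ℝ) :
    Filter.Tendsto (fun n : ℕ => filterWeight α (1 / ((n : ℝ) + 1)) κ) Filter.atTop
      (nhds (filterWeight α 0 κ)) := by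
  have h := integrableOn_weightDiff hα κ
  unfold filterWeight
  rw [Ioi_zero_eq_iUnion] at h ⊢
  refine tendsto_setIntegral_of_monotone (fun n => measurableSet_Ioi) (fun m n hmn => ?_) h
  exact Set.Ioi_subset_Ioi (one_div_le_one_div_of_le (by positivity) (by gcongr))

/-- Every polynomial factor is summable against the Gaussian weights. -/
theorem summable_gaussWeight_mul {ε : ℝ} (hε : 0 < ε) :
    Summable fun k : Fin 2 → ℤ => gaussWeight ε ‖freq k‖ * ‖freq k‖ ^ 2 := by
  refine Summable.of_nonneg_of_le (fun k => mul_nonneg (gaussWeight_pos _ _).le (by positivity))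
    (fun k => ?_) ((summable_norm_freq_rpow (p := 4) (by norm_num)).mul_left
      (48 * ε ^ (-6 : ℝ)))
  rcases eq_or_ne k 0 with rfl | hk
  · rw [norm_freq_zero]
    simp
  have h0 : 0 < ‖freq k‖ := by linarith [one_le_norm_freq hk]
  calc _ ≤ 48 * ‖freq k‖ ^ (-6 : ℝ) * ε ^ (-6 : ℝ) * ‖freq k‖ ^ 2 := by
        gcongr
        exact gaussWeight_le hε h0
    _ = _ := by
        have : ‖freq k‖ ^ (-4 : ℝ) = ‖freq k‖ ^ (-6 : ℝ) * ‖freq k‖ ^ 2 := by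
          rw [← Real.rpow_natCast, ← Real.rpow_add h0]; norm_num
        rw [this]
        ring

theorem summable_filterWeight_mul {α ε : ℝ} (hα : α ∈ Set.Ioo (0 : ℝ) 1) (hε : 0 < ε) :
    Summable fun k : Fin 2 → ℤ => filterWeight α ε ‖freq k‖ * ‖freq k‖ ^ 2 := by
  refine Summable.of_nonneg_of_le
    (fun k => mul_nonneg (filterWeight_nonneg hε.le _ _) (by positivity)) (fun k => ?_)
    ((summable_gaussWeight_mul hε).mul_left (∫ r in Set.Ioi ε, r ^ (-(1 + 2 * α))))
  rw [← mul_assoc]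
  gcongr
  exact filterWeight_le_gaussWeight hα hε (norm_nonneg _)

/-- The flux seen through `filterWeight`. -/
def filterFlux (α ε : ℝ) (φ : Plane → ℝ) (u : Plane → Plane) : ℝ :=
  ∑' k, filterWeight α ε ‖freq k‖ * flux φ u k

theorem le_sq_of_ne_zero (k : Fin 2 → ℤ) : ‖freq k‖ ≤ ‖freq k‖ ^ 2 := by
  rcases eq_or_ne k 0 with rfl | hk
  · simp [norm_freq_zero]
  · nlinarith [one_le_norm_freq hk]

theorem summable_gaussWeight_mul_flux {B : ℝ} {φ : Plane → ℝ} {u : Plane → Plane}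
    (hB : ∀ k, |flux φ u k| ≤ B * ‖freq k‖) {ρ : ℝ} (hρ : 0 < ρ) :
    Summable fun k => gaussWeight ρ ‖freq k‖ * flux φ u k := by
  have hB0 : 0 ≤ B := by
    have h := hB ![1, 0]
    have h1 := one_le_norm_freq (k := ![1, 0]) (by decide)
    by_contra hneg
    nlinarith [abs_nonneg (flux φ u ![1, 0])]
  refine Summable.of_norm_bounded ((summable_gaussWeight_mul hρ).mul_right B) fun k => ?_
  rw [norm_mul, Real.norm_of_nonneg (gaussWeight_pos _ _).le, mul_assoc]
  gcongr
  · exact (gaussWeight_pos _ _).le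
  · exact (hB k).trans (by rw [mul_comm]; gcongr; exact le_sq_of_ne_zero k)

theorem gaussWeight_anti {ε r κ : ℝ} (hε : 0 ≤ ε) (hr : ε ≤ r) (hκ : 0 ≤ κ) :
    gaussWeight r κ ≤ gaussWeight ε κ := by
  refine Real.exp_le_exp.2 ?_
  have : ε * κ ≤ r * κ := by gcongr
  nlinarith [mul_nonneg hε hκ, mul_self_le_mul_self (mul_nonneg hε hκ) this]

theorem continuousOn_gaussFlux {B : ℝ} {φ : Plane → ℝ} {u : Plane → Plane}
    (hB : ∀ k, |flux φ u k| ≤ B * ‖freq k‖) : ContinuousOn (gaussFlux φ u) (Set.Ioi 0) := by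
  intro r hr
  have hr0 : 0 < r := hr
  have h : ContinuousOn (gaussFlux φ u) (Set.Ici (r / 2)) := by
    refine continuousOn_tsum (u := fun k => gaussWeight (r / 2) ‖freq k‖ * |flux φ u k|)
      (fun k => ?_) ?_ fun k s hs => ?_
    · unfold gaussWeight
      fun_prop
    · refine (summable_gaussWeight_mul_flux hB (half_pos hr0)).abs.congr fun k => ?_
      rw [abs_mul, abs_of_pos (gaussWeight_pos _ _)]
    · rw [norm_mul, Real.norm_of_nonneg (gaussWeight_pos _ _).le, Real.norm_eq_abs]
      gcongr
      exact gaussWeight_anti (by positivity) hs (norm_nonneg _)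
  exact (h.continuousAt (Ici_mem_nhds (by linarith))).continuousWithinAt

/-- Fubini between frequencies and scales. The right-hand side still makes sense at `ε = 0`, where
the sum over frequencies is no longer known to converge absolutely; it is taken as the definition of
`limitFlux`. -/
theorem filterFlux_eq_integral {α ε B : ℝ} (hα : α ∈ Set.Ioo (0 : ℝ) 1) (hε : 0 < ε)
    {φ : Plane → ℝ} {u : Plane → Plane} (hB : ∀ k, |flux φ u k| ≤ B * ‖freq k‖) :
    filterFlux α ε φ u = ∫ r in Set.Ioi ε,
      r ^ (-(1 + 2 * α)) * (gaussFlux φ u r - gaussFlux φ u (2 * r)) := by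
  set F : (Fin 2 → ℤ) → ℝ → ℝ := fun k r =>
    weightDiff r ‖freq k‖ * r ^ (-(1 + 2 * α)) * flux φ u k with hF
  have hFi : ∀ k, Integrable (F k) (volume.restrict (Set.Ioi ε)) := fun k =>
    ((integrableOn_weightDiff hα _).mono_set (Set.Ioi_subset_Ioi hε.le)).mul_const _
  have hFn : ∀ k, ∫ r in Set.Ioi ε, ‖F k r‖ = filterWeight α ε ‖freq k‖ * |flux φ u k| := by
    intro k
    rw [filterWeight, ← integral_mul_const]
    refine setIntegral_congr_fun measurableSet_Ioi fun r hr => ?_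
    simp only [hF]
    rw [norm_mul, Real.norm_of_nonneg (weightDiff_mul_rpow_nonneg (hε.trans hr).le _ _),
      Real.norm_eq_abs]
  have hS : Summable fun k => ∫ r in Set.Ioi ε, ‖F k r‖ := by
    simp_rw [hFn]
    refine Summable.of_nonneg_of_le (fun k => mul_nonneg (filterWeight_nonneg hε.le _ _)
      (abs_nonneg _)) (fun k => ?_) ((summable_gaussWeight_mul_flux hB hε).abs.mul_left
        (∫ r in Set.Ioi ε, r ^ (-(1 + 2 * α))))
    rw [abs_mul, abs_of_pos (gaussWeight_pos _ _), ← mul_assoc]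
    gcongr
    exact filterWeight_le_gaussWeight hα hε (norm_nonneg _)
  have hsum : ∀ r ∈ Set.Ioi ε, ∑' k, F k r =
      r ^ (-(1 + 2 * α)) * (gaussFlux φ u r - gaussFlux φ u (2 * r)) := by
    intro r hr
    have hr0 : 0 < r := hε.trans hr
    rw [gaussFlux, gaussFlux, ← (summable_gaussWeight_mul_flux hB hr0).tsum_sub
      (summable_gaussWeight_mul_flux hB (by positivity : 0 < 2 * r)), ← tsum_mul_left]
    refine tsum_congr fun k => ?_
    simp only [hF, weightDiff]
    ring
  rw [← setIntegral_congr_fun measurableSet_Ioi hsum,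
    ← (hasSum_integral_of_summable_integral_norm hFi hS).tsum_eq, filterFlux]
  refine tsum_congr fun k => ?_
  rw [integral_mul_const, filterWeight]

/-- The flux through the multiplier `filterConst α * |k|^{2α}`. -/
def limitFlux (α : ℝ) (φ : Plane → ℝ) (u : Plane → Plane) : ℝ :=
  ∫ r in Set.Ioi (0 : ℝ), r ^ (-(1 + 2 * α)) * (gaussFlux φ u r - gaussFlux φ u (2 * r))

theorem sobolevENN_mono {σ τ : ℝ} (h : σ ≤ τ) {φ : Plane → ℝ} (hφ : MemL2 φ) :
    sobolevENN σ φ ≤ sobolevENN τ φ := by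
  refine ENNReal.tsum_le_tsum fun k => ENNReal.ofReal_le_ofReal ?_
  rcases eq_or_ne k 0 with rfl | hk
  · simp [coeff_zero_freq, hφ.mean_zero]
  · gcongr
    exact one_le_norm_freq hk

/-- The flux at width `2r` is the flux at width `r` after a dilation, which costs the factor
`2^{2α}`. -/
theorem lintegral_gaussFlux_sub_le {α β : ℝ} (hα : α ∈ Set.Ioo (0 : ℝ) 1)
    (hβ : β ∈ Set.Ioo (0 : ℝ) 1) :
    ∃ C : ℝ, 0 < C ∧ ∀ (φ : Plane → ℝ) (u : Plane → Plane) (K : ℝ), MemL2 φ →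
      HolderBound β K φ → IsRieszPerp φ u →
      ∫⁻ r in Set.Ioi (0 : ℝ), ENNReal.ofReal (r ^ (-(1 + 2 * α))) *
          ENNReal.ofReal |gaussFlux φ u r - gaussFlux φ u (2 * r)| ≤
        ENNReal.ofReal (C * K) * sobolevENN (1 + 2 * α - β) φ := by
  obtain ⟨C, hC, h⟩ := lintegral_gaussFlux_riesz_le hα hβ
  obtain ⟨C2, hC2, hfl⟩ := exists_abs_flux_le hβ
  refine ⟨(1 + 2 ^ ((1 + 2 * α) - 1)) * C, by positivity, fun φ u K hφ hK hu => ?_⟩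
  have h1 := h φ u K hφ hK hu
  have hK0 := hK.nonneg
  have h2 := lintegral_Ioi_rpow_mul_comp_two_mul le_rfl (1 + 2 * α)
    fun r => ENNReal.ofReal |gaussFlux φ u r|
  rw [mul_zero] at h2
  have hc := continuousOn_gaussFlux (hfl φ u K hφ hK hu)
  have hm : AEMeasurable (fun r => ENNReal.ofReal (r ^ (-(1 + 2 * α))) *
      ENNReal.ofReal |gaussFlux φ u r|) (volume.restrict (Set.Ioi 0)) := by
    have hp : Measurable fun r : ℝ => r ^ (-(1 + 2 * α)) := by fun_prop
    refine hp.ennreal_ofReal.aemeasurable.mul ?_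
    exact (hc.abs.aestronglyMeasurable measurableSet_Ioi).aemeasurable.ennreal_ofReal
  calc _ ≤ ∫⁻ r in Set.Ioi (0 : ℝ), (ENNReal.ofReal (r ^ (-(1 + 2 * α))) *
          ENNReal.ofReal |gaussFlux φ u r| + ENNReal.ofReal (r ^ (-(1 + 2 * α))) *
          ENNReal.ofReal |gaussFlux φ u (2 * r)|) := by
        refine lintegral_mono fun r => ?_
        rw [← mul_add, ← ENNReal.ofReal_add (abs_nonneg _) (abs_nonneg _)]
        gcongr
        exact abs_sub _ _
    _ ≤ ENNReal.ofReal (C * K) * sobolevENN (1 + 2 * α - β) φ +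
        ENNReal.ofReal (2 ^ ((1 + 2 * α) - 1)) *
          (ENNReal.ofReal (C * K) * sobolevENN (1 + 2 * α - β) φ) := by
        rw [lintegral_add_left' hm, h2]
        gcongr
    _ = _ := by
        rw [mul_assoc (1 + _ : ℝ), ENNReal.ofReal_mul (by positivity : (0:ℝ) ≤ 1 + _),
          ENNReal.ofReal_add zero_le_one (by positivity), ENNReal.ofReal_one]
        ring

/-- The filtered fluxes converge as the truncation is removed, at an algebraic rate. -/
theorem exists_abs_filterFlux_sub_le {α β δ : ℝ} (hα : 0 < α) (hδ : 0 ≤ δ) (hαδ : α + δ < 1)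
    (hβ : β ∈ Set.Ioo (0 : ℝ) 1) :
    ∃ C : ℝ, 0 < C ∧ ∀ (φ : Plane → ℝ) (u : Plane → Plane) (K Y : ℝ), MemL2 φ →
      HolderBound β K φ → IsRieszPerp φ u → 0 ≤ Y →
      sobolevENN (1 + 2 * (α + δ) - β) φ ≤ ENNReal.ofReal Y →
      |limitFlux α φ u| ≤ C * K * Y ∧
      ∀ ε : ℝ, 0 < ε → |filterFlux α ε φ u - limitFlux α φ u| ≤ C * K * Y * ε ^ (2 * δ) := by
  have hα' : α ∈ Set.Ioo (0 : ℝ) 1 := ⟨hα, by linarith⟩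
  obtain ⟨C0, hC0, h0⟩ := lintegral_gaussFlux_sub_le hα' hβ
  -- The flux differences do not depend on `α`, so the estimate is available at the order `α + δ`
  -- too. On scales `r ≤ ε` the surplus weight is a factor `r^{2δ} ≤ ε^{2δ}`.
  obtain ⟨C1, hC1, h1⟩ := lintegral_gaussFlux_sub_le
    (show α + δ ∈ Set.Ioo (0 : ℝ) 1 from ⟨by linarith, hαδ⟩) hβ
  obtain ⟨C2, hC2, hfl⟩ := exists_abs_flux_le hβ
  refine ⟨C0 + C1, by positivity, fun φ u K Y hφ hK hu hY hS => ?_⟩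
  have hK0 := hK.nonneg
  have hB := hfl φ u K hφ hK hu
  have hc := continuousOn_gaussFlux hB
  set D : ℝ → ℝ := fun r => gaussFlux φ u r - gaussFlux φ u (2 * r) with hD
  have hDc : ContinuousOn D (Set.Ioi 0) :=
    hc.sub (hc.comp (by fun_prop) fun r (hr : 0 < r) => by
      simp only [Set.mem_Ioi]; linarith)
  have hg : ContinuousOn (fun r => r ^ (-(1 + 2 * α)) * D r) (Set.Ioi 0) :=
    ContinuousOn.mul (fun r hr => (Real.continuousAt_rpow_const _ _
      (Or.inl (ne_of_gt hr))).continuousWithinAt) hDc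
  have hle0 : ∫⁻ r in Set.Ioi (0 : ℝ), ENNReal.ofReal |r ^ (-(1 + 2 * α)) * D r| ≤
      ENNReal.ofReal (C0 * K * Y) := by
    calc _ = ∫⁻ r in Set.Ioi (0 : ℝ), ENNReal.ofReal (r ^ (-(1 + 2 * α))) *
          ENNReal.ofReal |D r| := by
          refine setLIntegral_congr_fun measurableSet_Ioi fun r (hr : 0 < r) => ?_
          rw [abs_mul, abs_of_nonneg (by positivity), ENNReal.ofReal_mul (by positivity)]
      _ ≤ ENNReal.ofReal (C0 * K) * sobolevENN (1 + 2 * α - β) φ := h0 φ u K hφ hK hu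
      _ ≤ ENNReal.ofReal (C0 * K) * ENNReal.ofReal Y := by
          gcongr
          exact (sobolevENN_mono (by linarith) hφ).trans hS
      _ = _ := (ENNReal.ofReal_mul (by positivity)).symm
  have hi : IntegrableOn (fun r => r ^ (-(1 + 2 * α)) * D r) (Set.Ioi 0) := by
    refine ⟨hg.aestronglyMeasurable measurableSet_Ioi, ?_⟩
    rw [hasFiniteIntegral_iff_norm]
    exact hle0.trans_lt ENNReal.ofReal_lt_top
  constructor
  · have := (ofReal_abs_integral_le _).trans hle0
    have := (ENNReal.ofReal_le_ofReal_iff (by positivity)).1 this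
    exact this.trans (by gcongr; linarith)
  · intro ε hε
    have hsplit : limitFlux α φ u = (∫ r in Set.Ioc 0 ε, r ^ (-(1 + 2 * α)) * D r) +
        filterFlux α ε φ u := by
      rw [filterFlux_eq_integral hα' hε hB, limitFlux, ← Set.Ioc_union_Ioi_eq_Ioi hε.le]
      exact setIntegral_union (Set.Ioc_disjoint_Ioi le_rfl) measurableSet_Ioi
        (hi.mono_set Set.Ioc_subset_Ioi_self) (hi.mono_set (Set.Ioi_subset_Ioi hε.le))
    rw [hsplit, sub_add_cancel_right, abs_neg]
    have hle : ENNReal.ofReal |∫ r in Set.Ioc 0 ε, r ^ (-(1 + 2 * α)) * D r| ≤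
        ENNReal.ofReal (C1 * K * Y * ε ^ (2 * δ)) := by
      refine (ofReal_abs_integral_le _).trans ?_
      calc _ ≤ ∫⁻ r in Set.Ioc 0 ε, ENNReal.ofReal (ε ^ (2 * δ)) *
            (ENNReal.ofReal (r ^ (-(1 + 2 * (α + δ)))) * ENNReal.ofReal |D r|) := by
            refine setLIntegral_mono' measurableSet_Ioc fun r hr => ?_
            have hr0 : 0 < r := hr.1
            rw [abs_mul, abs_of_nonneg (by positivity), ← mul_assoc,
              ← ENNReal.ofReal_mul (by positivity), ← ENNReal.ofReal_mul (by positivity)]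
            refine ENNReal.ofReal_le_ofReal ?_
            gcongr
            have e : r ^ (-(1 + 2 * α)) = r ^ (2 * δ) * r ^ (-(1 + 2 * (α + δ))) := by
              rw [← Real.rpow_add hr0]
              congr 1
              ring
            rw [e]
            gcongr
            exact hr.2
        _ ≤ ENNReal.ofReal (ε ^ (2 * δ)) * ∫⁻ r in Set.Ioi (0 : ℝ),
            (ENNReal.ofReal (r ^ (-(1 + 2 * (α + δ)))) * ENNReal.ofReal |D r|) := by
            rw [lintegral_const_mul' _ _ ENNReal.ofReal_ne_top]
            gcongr
            exact Set.Ioc_subset_Ioi_self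
        _ ≤ ENNReal.ofReal (ε ^ (2 * δ)) * (ENNReal.ofReal (C1 * K) * ENNReal.ofReal Y) := by
            gcongr
            exact (h1 φ u K hφ hK hu).trans (by gcongr)
        _ = _ := by
            rw [← ENNReal.ofReal_mul (by positivity), ← ENNReal.ofReal_mul (by positivity)]
            congr 1
            ring
    have := (ENNReal.ofReal_le_ofReal_iff (by positivity)).1 hle
    exact this.trans (by gcongr; linarith)

/-! ### Hölder functions in Sobolev spaces of smaller order. -/

theorem norm_mode_sub_one_sq (k : Fin 2 → ℤ) (x : Plane) :
    ‖mode k x - 1‖ ^ 2 = 2 - 2 * (mode k x).re := by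
  have h : (mode k x).re ^ 2 + (mode k x).im ^ 2 = 1 := by
    have := Complex.normSq_eq_norm_sq (mode k x)
    rw [norm_mode, Complex.normSq_apply] at this
    linarith
  rw [← Complex.normSq_eq_norm_sq, Complex.normSq_apply, Complex.sub_re, Complex.sub_im,
    Complex.one_re, Complex.one_im]
  linarith

theorem integral_gauss : ∫ z : Plane, gauss z = 1 := by
  have h := integral_gauss_mul_mode 0
  simp only [inner_zero_left, Complex.ofReal_zero, zero_mul, Complex.exp_zero, mul_one] at h
  rw [integral_complex_ofReal] at h
  have := Complex.ofReal_injective h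
  simpa using this

theorem mode_smul (k : Fin 2 → ℤ) (r : ℝ) (z : Plane) :
    mode k (r • z) = Complex.exp (((inner ℝ (r • freq k) z : ℝ) : ℂ) * Complex.I) := by
  rw [mode, real_inner_smul_right, real_inner_smul_left]

theorem integrable_gauss_mul_mode (k : Fin 2 → ℤ) (r : ℝ) :
    Integrable fun z : Plane => (gauss z : ℂ) * mode k (r • z) := by
  refine integrable_gauss.ofReal.mul_bdd (c := 1) ?_
    (Filter.Eventually.of_forall fun z => (norm_mode _ _).le)
  have := continuous_mode k
  exact Continuous.aestronglyMeasurable (by fun_prop)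

theorem integrable_gauss_mul_sq_norm_mode (k : Fin 2 → ℤ) (r : ℝ) :
    Integrable fun z : Plane => gauss z * ‖mode k (r • z) - 1‖ ^ 2 := by
  refine integrable_gauss.mul_bdd (c := 4) ?_ (Filter.Eventually.of_forall fun z => ?_)
  · have := continuous_mode k
    exact Continuous.aestronglyMeasurable (by fun_prop)
  · rw [norm_mode_sub_one_sq, Real.norm_eq_abs, abs_le]
    have := (Complex.abs_re_le_norm (mode k (r • z)))
    rw [norm_mode, abs_le] at this
    constructor <;> linarith [this.1, this.2]

theorem integral_gauss_mul_sq_norm_mode (k : Fin 2 → ℤ) (r : ℝ) (hr : 0 ≤ r) :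
    ∫ z : Plane, gauss z * ‖mode k (r • z) - 1‖ ^ 2 = 2 * (1 - gaussWeight r ‖freq k‖) := by
  have h : ∀ z : Plane, gauss z * ‖mode k (r • z) - 1‖ ^ 2 =
      2 * gauss z - 2 * ((gauss z : ℂ) * mode k (r • z)).re := by
    intro z
    rw [norm_mode_sub_one_sq, Complex.re_ofReal_mul]
    ring
  have hre : Integrable fun z : Plane => ((gauss z : ℂ) * mode k (r • z)).re :=
    (integrable_gauss_mul_mode k r).re
  simp_rw [h]
  rw [integral_sub (integrable_gauss.const_mul 2) (hre.const_mul 2),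
    integral_const_mul, integral_const_mul, integral_gauss]
  have h2 := integral_re (integrable_gauss_mul_mode k r)
  simp only [RCLike.re_to_complex] at h2
  rw [h2]
  simp_rw [mode_smul]
  rw [integral_gauss_mul_mode, Complex.ofReal_re, norm_smul, Real.norm_of_nonneg hr, gaussWeight]
  ring

theorem HolderBound.sum_norm_mode_sub_one_le {β K : ℝ} {a : Plane → ℝ} (h : HolderBound β K a)
    (ha : BddPeriodic a) (v : Plane) (s : Finset (Fin 2 → ℤ)) :
    ∑ k ∈ s, ‖mode k v - 1‖ ^ 2 * ‖coeff a k‖ ^ 2 ≤ (K * ‖v‖ ^ β) ^ 2 := by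
  have hs := hasSum_sq_coeff ((ha.inc v).memLp 2)
  have h0 := h.nonneg
  calc _ = ∑ k ∈ s, ‖coeff (inc a v) k‖ ^ 2 := by
        refine Finset.sum_congr rfl fun k _ => ?_
        rw [ha.coeff_inc, norm_mul, mul_pow]
    _ ≤ mean fun x => inc a v x ^ 2 := sum_le_hasSum s (fun k _ => sq_nonneg _) hs
    _ ≤ _ := by
        rw [mean_eq_integral]
        refine (integral_mono ((ha.inc v).memLp 2).integrable_sq 
          (integrable_const ((K * ‖v‖ ^ β) ^ 2)) fun x => ?_).trans (by simp)
        rw [← sq_abs]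
        have := h (x + v) x
        rw [add_sub_cancel_left] at this
        exact pow_le_pow_left₀ (abs_nonneg _) this 2

/-- The Gaussian average of `|e^{ik·ρz} - 1|²` is twice one minus the Gaussian weight of width `ρ`.
With `ρ = 2r` this dominates the difference of weights, and the averaged increments are bounded by
`K² r^{2β}`. -/
theorem exists_sum_weightDiff_le {β : ℝ} (hβ : β ∈ Set.Ioo (0 : ℝ) 1) :
    ∃ C : ℝ, 0 < C ∧ ∀ (a : Plane → ℝ) (K : ℝ), BddPeriodic a → HolderBound β K a →
      ∀ r : ℝ, 0 < r → ∀ s : Finset (Fin 2 → ℤ),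
        ∑ k ∈ s, weightDiff r ‖freq k‖ * ‖coeff a k‖ ^ 2 ≤ C * K ^ 2 * r ^ (2 * β) := by
  have hi : Integrable fun z : Plane => gauss z * (1 + ‖z‖) ^ 2 := by
    have := (integrable_gauss.add (integrable_norm_mul_gauss.const_mul 2)).add
      (integrable_pow_mul_exp_mul_gauss 2 0)
    refine this.congr (Filter.Eventually.of_forall fun z => ?_)
    simp only [Pi.add_apply, zero_mul, Real.exp_zero]
    ring
  set M := ∫ z : Plane, gauss z * (1 + ‖z‖) ^ 2
  have hM : 0 ≤ M := integral_nonneg fun z => mul_nonneg (gauss_pos z).le (by positivity)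
  refine ⟨2 ^ (2 * β) * M + 1, by positivity, fun a K ha h r hr s => ?_⟩
  have hK := h.nonneg
  have h2r : 0 < 2 * r := by positivity
  have key : ∑ k ∈ s, 2 * (1 - gaussWeight (2 * r) ‖freq k‖) * ‖coeff a k‖ ^ 2 ≤
      K ^ 2 * (2 * r) ^ (2 * β) * M := by
    simp_rw [← integral_gauss_mul_sq_norm_mode _ _ h2r.le]
    simp_rw [← integral_mul_const]
    rw [← integral_finsetSum _ fun k _ => (integrable_gauss_mul_sq_norm_mode k (2 * r)).mul_const _,
      ← integral_const_mul]
    refine integral_mono (integrable_finsetSum _ fun k _ =>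
      (integrable_gauss_mul_sq_norm_mode k (2 * r)).mul_const _) (hi.const_mul _) fun z => ?_
    have h1 := h.sum_norm_mode_sub_one_le ha ((2 * r) • z) s
    have h2 : ‖z‖ ^ β ≤ 1 + ‖z‖ := by
      rcases le_total ‖z‖ 1 with h | h
      · exact (Real.rpow_le_one (norm_nonneg _) h hβ.1.le).trans (by simp)
      · calc ‖z‖ ^ β ≤ ‖z‖ ^ (1 : ℝ) := Real.rpow_le_rpow_of_exponent_le h hβ.2.le
          _ ≤ _ := by rw [Real.rpow_one]; linarith
    calc _ = gauss z * ∑ k ∈ s, ‖mode k ((2 * r) • z) - 1‖ ^ 2 * ‖coeff a k‖ ^ 2 := by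
          rw [Finset.mul_sum]
          exact Finset.sum_congr rfl fun k _ => by ring
      _ ≤ gauss z * (K * ‖(2 * r) • z‖ ^ β) ^ 2 :=
          mul_le_mul_of_nonneg_left h1 (gauss_pos z).le
      _ = K ^ 2 * (2 * r) ^ (2 * β) * (gauss z * (‖z‖ ^ β) ^ 2) := by
          rw [norm_smul, Real.norm_of_nonneg h2r.le, Real.mul_rpow h2r.le (norm_nonneg _),
            mul_comm 2 β, Real.rpow_mul h2r.le, Real.rpow_two]
          ring
      _ ≤ _ := by
          have := gauss_pos z
          gcongr
  calc _ ≤ ∑ k ∈ s, 2 * (1 - gaussWeight (2 * r) ‖freq k‖) * ‖coeff a k‖ ^ 2 := by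
        refine Finset.sum_le_sum fun k _ => ?_
        have h1 := gaussWeight_le_one r ‖freq k‖
        have h2 := gaussWeight_le_one (2 * r) ‖freq k‖
        gcongr
        rw [weightDiff]
        linarith
    _ ≤ _ := key
    _ = 2 ^ (2 * β) * M * K ^ 2 * r ^ (2 * β) := by
        rw [Real.mul_rpow (by norm_num) hr.le]
        ring
    _ ≤ _ := by gcongr; linarith

/-- Hölder functions belong to the Sobolev spaces of smaller order. -/
theorem exists_sobolevENN_le {σ β : ℝ} (hσ : 0 < σ) (hσβ : σ < β) (hβ : β < 1) :
    ∃ C : ℝ, 0 < C ∧ ∀ (φ : Plane → ℝ) (K : ℝ), MemL2 φ → HolderBound β K φ →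
      sobolevENN (2 * σ) φ ≤ ENNReal.ofReal (C * K ^ 2) := by
  have hβ' : β ∈ Set.Ioo (0 : ℝ) 1 := ⟨hσ.trans hσβ, hβ⟩
  have hσ' : σ ∈ Set.Ioo (0 : ℝ) 1 := ⟨hσ, hσβ.trans hβ⟩
  obtain ⟨C, hC, h⟩ := exists_sum_weightDiff_le hβ'
  have hc := filterConst_pos hσ'
  set A : ℝ := ∫ r in Set.Ioc (0 : ℝ) 1, r ^ (2 * β - 2 * σ - 1) with hA
  set B : ℝ := ∫ r in Set.Ioi (1 : ℝ), r ^ (-(1 + 2 * σ)) with hB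
  have hA0 : 0 ≤ A := setIntegral_nonneg measurableSet_Ioc fun r hr => by
    have := hr.1
    positivity
  have hB0 : 0 ≤ B := setIntegral_nonneg measurableSet_Ioi fun r (hr : 1 < r) => by positivity
  refine ⟨(C * A + 100 * B + 1) / filterConst σ, by positivity, fun φ K hφ hK => ?_⟩
  have hb := hφ.bddPeriodic hβ' hK
  have hK0 := hK.nonneg
  have hM := hK.abs_le hβ' hφ.periodic hb.integrable hφ.mean_zero
  rw [sobolevENN, ENNReal.tsum_eq_iSup_sum]
  refine iSup_le fun s => ?_
  rw [← ENNReal.ofReal_sum_of_nonneg fun k _ => by positivity]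
  refine ENNReal.ofReal_le_ofReal ?_
  rw [div_mul_eq_mul_div, le_div_iff₀ hc]
  -- `S` is the integrand representing the Sobolev sum through the filter multipliers. Below scale
  -- one the Hölder gain gives `r^{2β-2σ-1}`, integrable because `σ < β`; above it the `L²` norm and
  -- `σ > 0` suffice.
  set S : ℝ → ℝ := fun r => ∑ k ∈ s, weightDiff r ‖freq k‖ * r ^ (-(1 + 2 * σ)) * ‖coeff φ k‖ ^ 2
  have hSi : IntegrableOn S (Set.Ioi 0) :=
    integrable_finsetSum _ fun k _ => (integrableOn_weightDiff hσ' _).mul_const _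
  have hSe : ∀ r, S r = r ^ (-(1 + 2 * σ)) * ∑ k ∈ s, weightDiff r ‖freq k‖ * ‖coeff φ k‖ ^ 2 := by
    intro r
    rw [Finset.mul_sum]
    exact Finset.sum_congr rfl fun k _ => by ring
  have h1 : ∀ r, ∑ k ∈ s, weightDiff r ‖freq k‖ * ‖coeff φ k‖ ^ 2 ≤ 100 * K ^ 2 := by
    intro r
    have hs := hasSum_sq_coeff (hb.memLp 2)
    calc _ ≤ ∑ k ∈ s, ‖coeff φ k‖ ^ 2 := Finset.sum_le_sum fun k _ =>
          mul_le_of_le_one_left (by positivity)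
            ((weightDiff_le_gaussWeight _ _).trans (gaussWeight_le_one _ _))
      _ ≤ mean fun x => φ x ^ 2 := sum_le_hasSum s (fun k _ => sq_nonneg _) hs
      _ ≤ _ := by
        rw [mean_eq_integral]
        refine (integral_mono (hb.memLp 2).integrable_sq (integrable_const ((10 * K) ^ 2))
          fun x => ?_).trans (by simp; ring_nf; rfl)
        rw [← sq_abs]
        exact pow_le_pow_left₀ (abs_nonneg _) (hM x) 2
  have e : (∑ k ∈ s, ‖freq k‖ ^ (2 * σ) * ‖coeff φ k‖ ^ 2) * filterConst σ =
      ∫ r in Set.Ioi 0, S r := by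
    rw [integral_finsetSum _ fun k _ => (integrableOn_weightDiff hσ' _).mul_const _,
      Finset.sum_mul]
    refine Finset.sum_congr rfl fun k _ => ?_
    rw [integral_mul_const]
    change _ = filterWeight σ 0 ‖freq k‖ * _
    rcases eq_or_ne k 0 with rfl | hk
    · simp [coeff_zero_freq, hφ.mean_zero]
    · rw [filterWeight_zero (by linarith [one_le_norm_freq hk])]
      ring
  rw [e, ← Set.Ioc_union_Ioi_eq_Ioi zero_le_one, setIntegral_union (Set.Ioc_disjoint_Ioi le_rfl)
    measurableSet_Ioi (hSi.mono_set Set.Ioc_subset_Ioi_self)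
    (hSi.mono_set (Set.Ioi_subset_Ioi zero_le_one))]
  have i1 : ∫ r in Set.Ioc 0 1, S r ≤ C * K ^ 2 * A := by
    rw [hA, ← integral_const_mul]
    refine setIntegral_mono_on (hSi.mono_set Set.Ioc_subset_Ioi_self) ?_ measurableSet_Ioc
      fun r hr => ?_
    · exact (integrableOn_rpow_sub_one (β := 2 * β - 2 * σ) (by linarith) 1).const_mul _
    · have hr0 : 0 < r := hr.1
      rw [hSe]
      calc _ ≤ r ^ (-(1 + 2 * σ)) * (C * K ^ 2 * r ^ (2 * β)) := by
            gcongr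
            exact h φ K hb hK r hr0 s
        _ = _ := by
            have : r ^ (2 * β - 2 * σ - 1) = r ^ (-(1 + 2 * σ)) * r ^ (2 * β) := by
              rw [← Real.rpow_add hr0]
              congr 1
              ring
            rw [this]
            ring
  have i2 : ∫ r in Set.Ioi 1, S r ≤ 100 * K ^ 2 * B := by
    rw [hB, ← integral_const_mul]
    refine setIntegral_mono_on (hSi.mono_set (Set.Ioi_subset_Ioi zero_le_one)) ?_ measurableSet_Ioi
      fun r hr => ?_
    · exact (integrableOn_Ioi_rpow_of_lt (by linarith) one_pos).const_mul _
    · have hr0 : 0 < r := one_pos.trans hr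
      rw [hSe, mul_comm]
      gcongr
      exact h1 r
  nlinarith [sq_nonneg K]

/-! ### Interpolation and absorption of the flux. -/

/-- Young's inequality for powers of a frequency of modulus at least one. -/
theorem exists_mul_rpow_le {a m b q : ℝ} (hmb : m < b) (hq : (b - a) / (b - m) ≤ q) (hma : a ≤ m)
    (C : ℝ) (hC : 0 < C) :
    ∃ C' : ℝ, 0 < C' ∧ ∀ K κ : ℝ, 0 ≤ K → 1 ≤ κ →
      C * K * κ ^ m ≤ 1 / 2 * κ ^ b + C' * K ^ q * κ ^ a := by
  have hq0 : 1 ≤ q := by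
    refine le_trans ?_ hq
    rw [le_div_iff₀ (by linarith)]
    linarith
  refine ⟨(2 * C) ^ q, by positivity, fun K κ hK hκ => ?_⟩
  have hκ0 : 0 < κ := by linarith
  have hbm : 0 < b - m := by linarith
  -- Either the top power absorbs the middle one, or `κ` is bounded by a power of `2CK`. In the
  -- second case `κ ≥ 1` forces `2CK > 1`, which is why any exponent `q` above the sharp one is
  -- allowed.
  rcases le_or_gt (2 * C * K) (κ ^ (b - m)) with h | h
  · have : C * K * κ ^ m ≤ 1 / 2 * κ ^ b := by
      have e : κ ^ b = κ ^ (b - m) * κ ^ m := by rw [← Real.rpow_add hκ0]; congr 1; ring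
      rw [e]
      nlinarith [Real.rpow_pos_of_pos hκ0 m]
    have h2 : 0 ≤ (2 * C) ^ q * K ^ q * κ ^ a := by positivity
    linarith
  · have hL : 1 < 2 * C * K := lt_of_le_of_lt (Real.one_le_rpow hκ hbm.le) h
    have hL0 : 0 < 2 * C * K := by linarith
    have h1 : κ ≤ (2 * C * K) ^ (1 / (b - m)) := by
      rw [one_div, Real.le_rpow_inv_iff_of_pos hκ0.le hL0.le hbm]
      exact h.le
    have h2 : κ ^ (m - a) ≤ (2 * C * K) ^ ((m - a) / (b - m)) := by
      calc _ ≤ ((2 * C * K) ^ (1 / (b - m))) ^ (m - a) :=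
            Real.rpow_le_rpow hκ0.le h1 (by linarith)
        _ = _ := by rw [← Real.rpow_mul hL0.le]; congr 1; ring
    have h3 : 2 * C * K * κ ^ (m - a) ≤ (2 * C) ^ q * K ^ q := by
      calc _ ≤ 2 * C * K * (2 * C * K) ^ ((m - a) / (b - m)) := by gcongr
        _ = (2 * C * K) ^ ((b - a) / (b - m)) := by
            rw [← Real.rpow_one_add' hL0.le (by
              have : 0 ≤ (m - a) / (b - m) := div_nonneg (by linarith) hbm.le
              linarith)]
            congr 1
            field_simp
            ring
        _ ≤ (2 * C * K) ^ q := Real.rpow_le_rpow_of_exponent_le hL.le hq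
        _ = _ := Real.mul_rpow (by positivity) hK
    have e : κ ^ m = κ ^ (m - a) * κ ^ a := by rw [← Real.rpow_add hκ0]; congr 1; ring
    have h4 : 0 < κ ^ a := by positivity
    have h5 : 0 < κ ^ b := by positivity
    rw [e]
    nlinarith [mul_le_mul_of_nonneg_right h3 h4.le, mul_pos hL0 (mul_pos (Real.rpow_pos_of_pos hκ0 (m-a)) h4)]

theorem tsum_freq0 {g : (Fin 2 → ℤ) → ℝ} (h0 : g 0 = 0) : ∑' k : Freq0, g k.1 = ∑' k, g k := by
  refine tsum_subtype_eq_of_support_subset (s := {k | k ≠ 0}) fun k hk => ?_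
  rintro rfl
  exact hk h0

theorem summable_freq0_iff {g : (Fin 2 → ℤ) → ℝ} (h0 : g 0 = 0) :
    (Summable fun k : Freq0 => g k.1) ↔ Summable g := by
  refine Subtype.val_injective.summable_iff fun k hk => ?_
  have : k = 0 := by simpa using hk
  rw [this, h0]

theorem MemL2.coeff_zero {φ : Plane → ℝ} (hφ : MemL2 φ) : coeff φ 0 = 0 := by
  rw [coeff_zero_freq, hφ.mean_zero, Complex.ofReal_zero]

theorem MemL2.sobolevSq_eq {φ : Plane → ℝ} (hφ : MemL2 φ) (σ : ℝ) :
    sobolevSq σ φ = ∑' k, ‖freq k‖ ^ (2 * σ) * ‖coeff φ k‖ ^ 2 :=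
  tsum_freq0 (g := fun k => ‖freq k‖ ^ (2 * σ) * ‖coeff φ k‖ ^ 2) (by simp [hφ.coeff_zero])

theorem MemSobolev.summable_all {σ : ℝ} {φ : Plane → ℝ} (hφ : MemSobolev σ φ) :
    Summable fun k => ‖freq k‖ ^ (2 * σ) * ‖coeff φ k‖ ^ 2 :=
  (summable_freq0_iff (g := fun k => ‖freq k‖ ^ (2 * σ) * ‖coeff φ k‖ ^ 2)
    (by simp [hφ.memL2.coeff_zero])).1 hφ.summable

theorem sobolevSq_nonneg (σ : ℝ) (φ : Plane → ℝ) : 0 ≤ sobolevSq σ φ :=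
  tsum_nonneg fun _ => by positivity

theorem MemSobolev.sobolevENN_eq {σ : ℝ} {φ : Plane → ℝ} (hφ : MemSobolev σ φ) :
    sobolevENN (2 * σ) φ = ENNReal.ofReal (sobolevSq σ φ) := by
  rw [hφ.memL2.sobolevSq_eq, ENNReal.ofReal_tsum_of_nonneg (fun k => by positivity) hφ.summable_all,
    sobolevENN]

/-- The flux is absorbed by the dissipation up to a power of the Hölder seminorm. -/
theorem exists_limitFlux_le {γ α β : ℝ} (hγ : γ ∈ Set.Ioo (0 : ℝ) 2) (hα : α ∈ Set.Ioo (0 : ℝ) 1)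
    (hβ : β ∈ Set.Ioo (max (1 - γ) 0) 1) :
    ∃ C : ℝ, 0 < C ∧ ∀ (φ : Plane → ℝ) (u : Plane → Plane) (K : ℝ),
      MemSobolev (α + γ / 2) φ → HolderBound β K φ → IsRieszPerp φ u →
      2 * |limitFlux α φ u| ≤ filterConst α *
        (sobolevSq (α + γ / 2) φ + C * K ^ (4 * γ / (γ + β - 1))) := by
  have hβ0 : 0 < β := (le_max_right _ _).trans_lt hβ.1
  have hβγ : 0 < γ + β - 1 := by linarith [(le_max_left (1 - γ) 0).trans_lt hβ.1]
  have hβ' : β ∈ Set.Ioo (0 : ℝ) 1 := ⟨hβ0, hβ.2⟩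
  obtain ⟨hα0, hα1⟩ := hα
  obtain ⟨hγ0, hγ2⟩ := hγ
  have hβ1 := hβ.2
  have hc := filterConst_pos (α := α) ⟨hα0, hα1⟩
  -- Only the size of the limiting flux is needed here, so `δ = 0`.
  obtain ⟨C0, hC0, h0⟩ := exists_abs_filterFlux_sub_le hα0 le_rfl (by linarith) hβ'
  obtain ⟨C1, hC1, h1⟩ := exists_sobolevENN_le (σ := α * β) (by positivity) (by nlinarith) hβ1
  set p := 4 * γ / (γ + β - 1) with hp
  have hp4 : 4 ≤ p := by
    rw [hp, le_div_iff₀ hβγ]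
    linarith
  -- The gap `b - m` is `γ + β - 1`, and the condition on `q = p - 2` amounts to `2α(1-β) + γ ≤ 2γ +
  -- 2(1-β)`. The remaining two powers of `K` come from bounding the norm of order `αβ` by the
  -- Hölder seminorm.
  obtain ⟨C2, hC2, h2⟩ := exists_mul_rpow_le (a := 2 * (α * β)) (m := 1 + 2 * (α + 0) - β)
    (b := 2 * (α + γ / 2)) (q := p - 2) (by linarith) (by
      have e1 : 2 * (α + γ / 2) - (1 + 2 * (α + 0) - β) = γ + β - 1 := by ring
      have e2 : p - 2 = (4 * γ - 2 * (γ + β - 1)) / (γ + β - 1) := by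
        rw [hp]
        field_simp
      rw [e1, e2]
      refine div_le_div_of_nonneg_right ?_ hβγ.le
      nlinarith [mul_pos (sub_pos.2 hα1) (sub_pos.2 hβ1)]) (by nlinarith) (2 / filterConst α * C0) (by positivity)
  refine ⟨C2 * C1, by positivity, fun φ u K hφ hK hu => ?_⟩
  have hK0 := hK.nonneg
  have hX := hφ.sobolevENN_eq
  set X := sobolevSq (α + γ / 2) φ with hXdef
  have hX0 : 0 ≤ X := sobolevSq_nonneg _ _
  have hfin : sobolevENN (1 + 2 * (α + 0) - β) φ ≠ ⊤ := by
    refine ((sobolevENN_mono (τ := 2 * (α + γ / 2)) (by linarith) hφ.memL2).trans_lt ?_).ne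
    rw [hX]
    exact ENNReal.ofReal_lt_top
  set Y := (sobolevENN (1 + 2 * (α + 0) - β) φ).toReal with hY
  have hYe : sobolevENN (1 + 2 * (α + 0) - β) φ = ENNReal.ofReal Y := (ENNReal.ofReal_toReal hfin).symm
  have hN := (h0 φ u K Y hφ.memL2 hK hu ENNReal.toReal_nonneg hYe.le).1
  have hsum : ENNReal.ofReal (2 / filterConst α * C0 * K) * ENNReal.ofReal Y ≤
      ENNReal.ofReal (1 / 2) * ENNReal.ofReal X +
        ENNReal.ofReal (C2 * K ^ (p - 2)) * ENNReal.ofReal (C1 * K ^ 2) := by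
    rw [← hYe, ← hX]
    refine le_trans ?_ (add_le_add_right (mul_le_mul_right (h1 φ K hφ.memL2 hK) _) _)
    simp only [sobolevENN]
    rw [← ENNReal.tsum_mul_left, ← ENNReal.tsum_mul_left, ← ENNReal.tsum_mul_left,
      ← ENNReal.tsum_add]
    refine ENNReal.tsum_le_tsum fun k => ?_
    rcases eq_or_ne k 0 with rfl | hk
    · simp [hφ.memL2.coeff_zero]
    · rw [← ENNReal.ofReal_mul (by positivity), ← ENNReal.ofReal_mul (by positivity),
        ← ENNReal.ofReal_mul (by positivity), ← ENNReal.ofReal_add (by positivity) (by positivity)]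
      refine ENNReal.ofReal_le_ofReal ?_
      have := mul_le_mul_of_nonneg_right (h2 K ‖freq k‖ hK0 (one_le_norm_freq hk))
        (sq_nonneg ‖coeff φ k‖)
      linarith
  have hY0 : 0 ≤ Y := ENNReal.toReal_nonneg
  rw [← ENNReal.ofReal_mul (by positivity), ← ENNReal.ofReal_mul (by positivity),
    ← ENNReal.ofReal_mul (by positivity), ← ENNReal.ofReal_add (by positivity) (by positivity),
    ENNReal.ofReal_le_ofReal_iff (by positivity)] at hsum
  have hKp : K ^ p = K ^ (p - 2) * K ^ 2 := by
    rw [← Real.rpow_two, ← Real.rpow_add_of_nonneg hK0 (by linarith) (by norm_num)]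
    congr 1
    ring
  rw [hKp]
  have h3 : 2 * (C0 * K * Y) = filterConst α * (2 / filterConst α * C0 * K * Y) := by
    field_simp
  calc 2 * |limitFlux α φ u| ≤ 2 * (C0 * K * Y) := by gcongr
    _ = filterConst α * (2 / filterConst α * C0 * K * Y) := h3
    _ ≤ filterConst α * (1 / 2 * X + C2 * K ^ (p - 2) * (C1 * K ^ 2)) := by gcongr
    _ ≤ _ := by
      gcongr ?_ * ?_
      have : 0 ≤ K ^ (p - 2) := by positivity
      linarith

/-! ### Continuity in time of coefficients, products and norms. -/

/-- Cauchy-Schwarz for Fourier coefficients of products. -/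
theorem norm_coeff_mul_le {a b : Plane → ℝ} (ha : MemLp a 2 cellMeasure)
    (hb : MemLp b 2 cellMeasure) (k : Fin 2 → ℤ) :
    ‖coeff (fun x => a x * b x) k‖ ≤
      Real.sqrt (mean fun x => a x ^ 2) * Real.sqrt (mean fun x => b x ^ 2) := by
  have h := integral_mul_norm_le_Lp_mul_Lq (p := 2) (q := 2) (μ := cellMeasure) (f := a) (g := b)
    Real.HolderConjugate.two_two (by simpa using ha) (by simpa using hb)
  rw [coeff_eq_mean, mean_eq_integral]
  refine (norm_integral_le_integral_norm _).trans ?_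
  simp only [Complex.ofReal_mul, norm_mul, Complex.norm_real, RCLike.norm_conj, norm_mode, mul_one]
  refine h.trans (le_of_eq ?_)
  simp only [Real.rpow_two, ← Real.sqrt_eq_rpow, Real.norm_eq_abs, sq_abs, mean_eq_integral]

theorem MemL2.sub {a b : Plane → ℝ} (ha : MemL2 a) (hb : MemL2 b) : MemL2 (a - b) where
  periodic x k := by simp only [Pi.sub_apply, ha.periodic x k, hb.periodic x k]
  memLp := ha.memLp.sub hb.memLp
  mean_zero := by
    have h1 := ha.mean_zero
    have h2 := hb.mean_zero
    rw [mean_eq_integral] at *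
    rw [integral_sub' (integrable_of_memLp_two ha.memLp_cellMeasure)
      (integrable_of_memLp_two hb.memLp_cellMeasure), h1, h2, sub_zero]

theorem MemL2.coeff_sub {a b : Plane → ℝ} (ha : MemL2 a) (hb : MemL2 b) (k : Fin 2 → ℤ) :
    coeff (a - b) k = coeff a k - coeff b k :=
  SQG.coeff_sub (integrable_of_memLp_two ha.memLp_cellMeasure)
    (integrable_of_memLp_two hb.memLp_cellMeasure) k

theorem MemSobolev.sub {σ : ℝ} {a b : Plane → ℝ} (ha : MemSobolev σ a) (hb : MemSobolev σ b) :
    MemSobolev σ (a - b) where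
  memL2 := ha.memL2.sub hb.memL2
  summable := by
    refine Summable.of_nonneg_of_le (fun k => by positivity) (fun k => ?_)
      ((ha.summable.add hb.summable).mul_left 2)
    rw [ha.memL2.coeff_sub hb.memL2]
    have h := norm_sub_le (coeff a k.1) (coeff b k.1)
    have h2 : ‖coeff a k.1 - coeff b k.1‖ ^ 2 ≤ 2 * (‖coeff a k.1‖ ^ 2 + ‖coeff b k.1‖ ^ 2) := by
      nlinarith [pow_le_pow_left₀ (norm_nonneg _) h 2, sq_nonneg (‖coeff a k.1‖ - ‖coeff b k.1‖)]
    calc _ ≤ ‖freq k.1‖ ^ (2 * σ) * (2 * (‖coeff a k.1‖ ^ 2 + ‖coeff b k.1‖ ^ 2)) := by gcongr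
      _ = _ := by ring

theorem IsRieszPerp.sub {a b : Plane → ℝ} {u v : Plane → Plane} (ha : MemL2 a) (hb : MemL2 b)
    (hu : IsRieszPerp a u) (hv : IsRieszPerp b v) : IsRieszPerp (a - b) (u - v) where
  memL2 i := (hu.memL2 i).sub (hv.memL2 i)
  coeff_fst k := by
    have := (hu.memL2 0).coeff_sub (hv.memL2 0) k.1
    refine this.trans ?_
    rw [hu.coeff_fst, hv.coeff_fst, ha.coeff_sub hb]
    ring
  coeff_snd k := by
    have := (hu.memL2 1).coeff_sub (hv.memL2 1) k.1
    refine this.trans ?_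
    rw [hu.coeff_snd, hv.coeff_snd, ha.coeff_sub hb]
    ring

theorem IsRieszPerp.mean_sq_le {φ : Plane → ℝ} {u : Plane → Plane} (hφ : MemL2 φ)
    (hu : IsRieszPerp φ u) (j : Fin 2) : (mean fun x => u x j ^ 2) ≤ mean fun x => φ x ^ 2 := by
  refine hasSum_le (fun k => ?_) (hasSum_sq_coeff (hu.memL2 j).memLp_cellMeasure)
    (hasSum_sq_coeff hφ.memLp_cellMeasure)
  have := hu.norm_coeff_le j k
  gcongr

theorem MemSobolev.mean_sq_le {σ : ℝ} (hσ : 0 ≤ σ) {φ : Plane → ℝ} (hφ : MemSobolev σ φ) :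
    (mean fun x => φ x ^ 2) ≤ sobolevSq σ φ := by
  rw [hφ.memL2.sobolevSq_eq]
  refine hasSum_le (fun k => ?_) (hasSum_sq_coeff hφ.memL2.memLp_cellMeasure)
    hφ.summable_all.hasSum
  rcases eq_or_ne k 0 with rfl | hk
  · simp [hφ.memL2.coeff_zero]
  · exact le_mul_of_one_le_left (sq_nonneg _)
      (Real.one_le_rpow (one_le_norm_freq hk) (by positivity))

theorem norm_sq_coeff_le {φ : Plane → ℝ} (hφ : MemL2 φ) (k : Fin 2 → ℤ) :
    ‖coeff φ k‖ ^ 2 ≤ mean fun x => φ x ^ 2 :=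
  le_hasSum (hasSum_sq_coeff hφ.memLp_cellMeasure) k fun _ _ => sq_nonneg _

theorem ContinuousInSobolev.tendsto_mean_sq {σ : ℝ} (hσ : 0 ≤ σ) {θ : ℝ → Plane → ℝ}
    (h : ContinuousInSobolev σ θ) {t : ℝ} (ht : 0 ≤ t) :
    Filter.Tendsto (fun s => Real.sqrt (mean fun x => (θ s - θ t) x ^ 2))
      (nhdsWithin t (Set.Ici 0)) (nhds 0) := by
  suffices hs : Filter.Tendsto (fun s => mean fun x => (θ s - θ t) x ^ 2)
      (nhdsWithin t (Set.Ici 0)) (nhds 0) by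
    simpa using hs.sqrt
  refine squeeze_zero' (Filter.Eventually.of_forall fun s => ?_) ?_ (h.tendsto t ht)
  · rw [mean_eq_integral]
    exact integral_nonneg fun x => sq_nonneg _
  · filter_upwards [self_mem_nhdsWithin] with s hs
    exact ((h.mem s hs).sub (h.mem t ht)).mean_sq_le hσ

theorem ContinuousInSobolev.continuousOn_coeff {σ : ℝ} (hσ : 0 ≤ σ) {θ : ℝ → Plane → ℝ}
    (h : ContinuousInSobolev σ θ) (k : Fin 2 → ℤ) :
    ContinuousOn (fun t => coeff (θ t) k) (Set.Ici 0) := by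
  intro t ht
  rw [ContinuousWithinAt, tendsto_iff_norm_sub_tendsto_zero]
  refine squeeze_zero' (Filter.Eventually.of_forall fun s => norm_nonneg _) ?_
    (h.tendsto_mean_sq hσ ht)
  filter_upwards [self_mem_nhdsWithin] with s hs
  have h1 := (h.mem s hs).memL2
  have h2 := (h.mem t ht).memL2
  rw [← h1.coeff_sub h2]
  exact Real.le_sqrt_of_sq_le (norm_sq_coeff_le (h1.sub h2) k)

/-- The expansion involves only the base pair and the differences, so continuity of products at a
time needs no uniform bound at neighbouring times. -/
theorem coeff_mul_sub_mul {a b a' b' : Plane → ℝ} (ha : MemLp a 2 cellMeasure)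
    (hb : MemLp b 2 cellMeasure) (ha' : MemLp a' 2 cellMeasure) (hb' : MemLp b' 2 cellMeasure)
    (k : Fin 2 → ℤ) :
    coeff (fun x => a x * b x) k - coeff (fun x => a' x * b' x) k =
      coeff (fun x => (a - a') x * b' x) k + coeff (fun x => a' x * (b - b') x) k +
        coeff (fun x => (a - a') x * (b - b') x) k := by
  have i : ∀ {f g : Plane → ℝ}, MemLp f 2 cellMeasure → MemLp g 2 cellMeasure →
      Integrable (fun x => f x * g x) cellMeasure := fun hf hg => hf.integrable_mul hg
  have i2 : Integrable (fun x => (a - a') x * b' x + a' x * (b - b') x) cellMeasure :=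
    (i (ha.sub ha') hb').add (i ha' (hb.sub hb'))
  rw [← coeff_sub (i ha hb) (i ha' hb'), ← coeff_add (i (ha.sub ha') hb') (i ha' (hb.sub hb')),
    ← coeff_add i2 (i (ha.sub ha') (hb.sub hb'))]
  congr 1
  funext x
  simp only [Pi.sub_apply]
  ring

theorem ContinuousInSobolev.continuousOn_coeff_mul {σ : ℝ} (hσ : 0 ≤ σ) {θ : ℝ → Plane → ℝ}
    (h : ContinuousInSobolev σ θ) {u : ℝ → Plane → Plane}
    (hu : ∀ t, 0 ≤ t → IsRieszPerp (θ t) (u t)) (j : Fin 2) (k : Fin 2 → ℤ) :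
    ContinuousOn (fun t => coeff (fun x => θ t x * u t x j) k) (Set.Ici 0) := by
  intro t ht
  rw [ContinuousWithinAt, tendsto_iff_norm_sub_tendsto_zero]
  set M := Real.sqrt (mean fun x => θ t x ^ 2)
  have hd := h.tendsto_mean_sq hσ ht
  have hlim := ((hd.mul_const M).add (hd.const_mul M)).add (hd.mul hd)
  simp only [zero_mul, mul_zero, add_zero] at hlim
  refine squeeze_zero' (Filter.Eventually.of_forall fun s => norm_nonneg _) ?_ hlim
  filter_upwards [self_mem_nhdsWithin] with s hs
  have h1 := (h.mem s hs).memL2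
  have h2 := (h.mem t ht).memL2
  have v1 := (hu s hs).memL2 j
  have v2 := (hu t ht).memL2 j
  have m1 := h1.memLp_cellMeasure
  have m2 := h2.memLp_cellMeasure
  have n1 := v1.memLp_cellMeasure
  have n2 := v2.memLp_cellMeasure
  have e := coeff_mul_sub_mul m1 n1 m2 n2 k
  rw [e]
  have q1 : Real.sqrt (mean fun x => u t x j ^ 2) ≤ M :=
    Real.sqrt_le_sqrt ((hu t ht).mean_sq_le h2 j)
  have q2 : Real.sqrt (mean fun x => ((fun x => u s x j) - fun x => u t x j) x ^ 2) ≤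
      Real.sqrt (mean fun x => (θ s - θ t) x ^ 2) :=
    Real.sqrt_le_sqrt (((hu s hs).sub h1 h2 (hu t ht)).mean_sq_le (h1.sub h2) j)
  refine (norm_add₃_le).trans (add_le_add_three ?_ ?_ ?_)
  · exact (norm_coeff_mul_le (m1.sub m2) n2 k).trans (by gcongr)
  · exact (norm_coeff_mul_le m2 (n1.sub n2) k).trans (by gcongr)
  · exact (norm_coeff_mul_le (m1.sub m2) (n1.sub n2) k).trans (by gcongr)

/-- The sequence `|k|^σ φ̂_k` as an element of `ℓ²`. -/
def sobolevVec (σ : ℝ) (φ : Plane → ℝ) : lp (fun _ : Freq0 => ℂ) 2 :=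
  open scoped Classical in
  if h : Memℓp (fun k : Freq0 => ((‖freq k.1‖ ^ σ : ℝ) : ℂ) * coeff φ k.1) 2 then ⟨_, h⟩ else 0

theorem norm_sq_rpow_mul {σ : ℝ} (k : Fin 2 → ℤ) (z : ℂ) :
    ‖((‖freq k‖ ^ σ : ℝ) : ℂ) * z‖ ^ 2 = ‖freq k‖ ^ (2 * σ) * ‖z‖ ^ 2 := by
  rw [norm_mul, Complex.norm_real, Real.norm_of_nonneg (by positivity), mul_pow, mul_comm 2 σ,
    Real.rpow_mul (norm_nonneg _), Real.rpow_two]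

theorem sobolevVec_apply {σ : ℝ} {φ : Plane → ℝ}
    (h : Summable fun k : Freq0 => ‖freq k.1‖ ^ (2 * σ) * ‖coeff φ k.1‖ ^ 2) (k : Freq0) :
    sobolevVec σ φ k = ((‖freq k.1‖ ^ σ : ℝ) : ℂ) * coeff φ k.1 := by
  have : Memℓp (fun k : Freq0 => ((‖freq k.1‖ ^ σ : ℝ) : ℂ) * coeff φ k.1) 2 := by
    refine memℓp_gen ?_
    simpa only [ENNReal.toReal_ofNat, Real.rpow_two, norm_sq_rpow_mul] using h
  rw [sobolevVec, dif_pos this]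

theorem norm_sq_sobolevVec {σ : ℝ} {φ : Plane → ℝ}
    (h : Summable fun k : Freq0 => ‖freq k.1‖ ^ (2 * σ) * ‖coeff φ k.1‖ ^ 2) :
    ‖sobolevVec σ φ‖ ^ 2 = sobolevSq σ φ := by
  have := lp.norm_rpow_eq_tsum (p := 2) (by norm_num) (sobolevVec σ φ)
  simp only [ENNReal.toReal_ofNat, Real.rpow_two] at this
  rw [this, sobolevSq]
  exact tsum_congr fun k => by rw [sobolevVec_apply h, norm_sq_rpow_mul]

/-- Distances in `ℓ²` between weighted coefficient sequences are the Sobolev distances of the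
functions. Continuity of norms and pairings then follows from Hilbert space continuity. -/
theorem ContinuousInSobolev.continuousOn_sobolevVec {σ : ℝ} {θ : ℝ → Plane → ℝ}
    (h : ContinuousInSobolev σ θ) : ContinuousOn (fun t => sobolevVec σ (θ t)) (Set.Ici 0) := by
  intro t ht
  rw [ContinuousWithinAt, tendsto_iff_norm_sub_tendsto_zero]
  have h0 := (h.tendsto t ht).sqrt
  rw [Real.sqrt_zero] at h0
  refine h0.congr' ?_
  filter_upwards [self_mem_nhdsWithin] with s hs
  have hm := (h.mem s hs).sub (h.mem t ht)
  have e : sobolevVec σ (θ s) - sobolevVec σ (θ t) = sobolevVec σ (θ s - θ t) := by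
    ext k
    rw [lp.coeFn_sub, Pi.sub_apply, sobolevVec_apply (h.mem s hs).summable,
      sobolevVec_apply (h.mem t ht).summable, sobolevVec_apply hm.summable,
      (h.mem s hs).memL2.coeff_sub (h.mem t ht).memL2, mul_sub]
  rw [e, ← norm_sq_sobolevVec hm.summable, Real.sqrt_sq (norm_nonneg _)]

theorem ContinuousInSobolev.continuousOn_sobolevSq {σ : ℝ} {θ : ℝ → Plane → ℝ}
    (h : ContinuousInSobolev σ θ) : ContinuousOn (fun t => sobolevSq σ (θ t)) (Set.Ici 0) :=
  (h.continuousOn_sobolevVec.norm.pow 2).congr fun t ht => (norm_sq_sobolevVec (h.mem t ht).summable).symm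

theorem MemSobolev.mono {σ τ : ℝ} (h : σ ≤ τ) {φ : Plane → ℝ} (hφ : MemSobolev τ φ) :
    MemSobolev σ φ :=
  ⟨hφ.memL2, Summable.of_nonneg_of_le (fun k => by positivity) (fun k => by
    have := one_le_norm_freq k.2
    gcongr) hφ.summable⟩

theorem MemSobolev.sobolevSq_mono {σ τ : ℝ} (h : σ ≤ τ) {φ : Plane → ℝ} (hφ : MemSobolev τ φ) :
    sobolevSq σ φ ≤ sobolevSq τ φ :=
  Summable.tsum_le_tsum (fun k => by
    have := one_le_norm_freq k.2
    gcongr) (hφ.mono h).summable hφ.summable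

theorem MemSobolev.summable_innerLambda {σ : ℝ} {f φ : Plane → ℝ} (hf : MemSobolev σ f)
    (hφ : MemSobolev σ φ) :
    Summable fun k : Freq0 => ‖freq k.1‖ ^ (2 * σ) * ‖coeff f k.1 * conj (coeff φ k.1)‖ := by
  refine Summable.of_nonneg_of_le (fun k => by positivity) (fun k => ?_)
    (hf.summable.add hφ.summable)
  rw [norm_mul, RCLike.norm_conj, ← mul_add]
  gcongr
  nlinarith [sq_nonneg (‖coeff f k.1‖ - ‖coeff φ k.1‖), sq_nonneg (‖coeff f k.1‖),
    sq_nonneg (‖coeff φ k.1‖)]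

/-- The weight `|k|^{2σ}` is split as `|k|^{σ-s} |k|^{σ+s}`, so the stronger norm of one factor can
be used while the other needs only a weaker norm. -/
theorem innerLambda_eq_inner {σ s : ℝ} {f φ : Plane → ℝ} (hf : MemSobolev (σ - s) f)
    (hφ : MemSobolev (σ + s) φ) :
    innerLambda σ f φ = (inner ℂ (sobolevVec (σ + s) φ) (sobolevVec (σ - s) f)).re := by
  rw [innerLambda]
  have h := Complex.hasSum_re (lp.hasSum_inner (𝕜 := ℂ) (sobolevVec (σ + s) φ) (sobolevVec (σ - s) f))
  rw [← h.tsum_eq]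
  refine tsum_congr fun k => ?_
  rw [sobolevVec_apply hf.summable, sobolevVec_apply hφ.summable, RCLike.inner_apply, map_mul,
    Complex.conj_ofReal]
  have h0 : 0 < ‖freq k.1‖ := by linarith [one_le_norm_freq k.2]
  have e : ‖freq k.1‖ ^ (2 * σ) = ‖freq k.1‖ ^ (σ - s) * ‖freq k.1‖ ^ (σ + s) := by
    rw [← Real.rpow_add h0]
    congr 1
    ring
  rw [e, ← Complex.re_ofReal_mul]
  congr 1
  push_cast
  ring

theorem ContinuousInSobolev.continuousOn_innerLambda {σ s : ℝ} (hs : 0 ≤ s) {f : Plane → ℝ}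
    {θ : ℝ → Plane → ℝ} (hf : MemSobolev σ f) (h : ContinuousInSobolev (σ + s) θ) :
    ContinuousOn (fun t => innerLambda σ f (θ t)) (Set.Ici 0) := by
  have hf' := hf.mono (sub_le_self σ hs)
  have : ContinuousOn (fun t => (inner ℂ (sobolevVec (σ + s) (θ t)) (sobolevVec (σ - s) f)).re)
      (Set.Ici 0) :=
    Complex.continuous_re.comp_continuousOn (ContinuousOn.inner (𝕜 := ℂ) h.continuousOn_sobolevVec continuousOn_const)
  exact this.congr fun t ht => innerLambda_eq_inner hf' (h.mem t ht)

/-- Young's inequality mode by mode, weighted so that only half a unit of the solution's norm has to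
be absorbed by the dissipation. -/
theorem MemSobolev.two_mul_innerLambda_le {σ : ℝ} {f φ : Plane → ℝ} (hf : MemSobolev σ f)
    (hφ : MemSobolev σ φ) :
    2 * innerLambda σ f φ ≤ 2 * sobolevSq σ f + 1 / 2 * sobolevSq σ φ := by
  rw [innerLambda, sobolevSq, sobolevSq, ← tsum_mul_left, ← tsum_mul_left, ← tsum_mul_left,
    ← (hf.summable.mul_left 2).tsum_add (hφ.summable.mul_left (1 / 2))]
  refine Summable.tsum_le_tsum (fun k => ?_) (Summable.mul_left 2 ?_)
    ((hf.summable.mul_left 2).add (hφ.summable.mul_left (1 / 2)))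
  · have h1 := Complex.re_le_norm (coeff f k.1 * conj (coeff φ k.1))
    rw [norm_mul, RCLike.norm_conj] at h1
    have h2 : 2 * (coeff f k.1 * conj (coeff φ k.1)).re ≤
        2 * ‖coeff f k.1‖ ^ 2 + 1 / 2 * ‖coeff φ k.1‖ ^ 2 := by
      nlinarith [sq_nonneg (2 * ‖coeff f k.1‖ - ‖coeff φ k.1‖)]
    have h3 : 0 ≤ ‖freq k.1‖ ^ (2 * σ) := by positivity
    nlinarith [mul_le_mul_of_nonneg_left h2 h3]
  · refine Summable.of_norm_bounded (hf.summable_innerLambda hφ) fun k => ?_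
    rw [norm_mul, Real.norm_of_nonneg (by positivity : 0 ≤ ‖freq k.1‖ ^ (2 * σ))]
    gcongr
    exact Complex.abs_re_le_norm _

/-! ### Equations of the Fourier coefficients. -/

/-- The real trigonometric monomial `Re (w e^{i k·x})`. -/
def wave (w : ℂ) (k : Fin 2 → ℤ) (x : Plane) : ℝ := (w * mode k x).re

theorem wave_periodic (w : ℂ) (k : Fin 2 → ℤ) : Periodic2 (wave w k) := fun x l => by
  rw [wave, wave, mode_periodic k x l]

theorem contDiff_mode (k : Fin 2 → ℤ) : ContDiff ℝ ∞ (mode k) := by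
  unfold mode
  have : ContDiff ℝ ∞ fun x : Plane => ((inner ℝ (freq k) x : ℝ) : ℂ) :=
    Complex.ofRealCLM.contDiff.comp (innerSL ℝ (freq k)).contDiff
  exact (this.mul contDiff_const).cexp

theorem contDiff_wave (w : ℂ) (k : Fin 2 → ℤ) : ContDiff ℝ ∞ (wave w k) :=
  Complex.reCLM.contDiff.comp (contDiff_const.mul (contDiff_mode k))

theorem fderiv_wave (w : ℂ) (k : Fin 2 → ℤ) (x v : Plane) :
    fderiv ℝ (wave w k) x v = inner ℝ (freq k) v * wave (w * Complex.I) k x := by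
  have h := (Complex.reCLM.hasFDerivAt (x := w * mode k x)).comp x
    ((hasFDerivAt_cexp_inner (freq k) x).const_mul w)
  have e : fderiv ℝ (wave w k) x = _ := h.fderiv
  rw [e, wave]
  simp only [ContinuousLinearMap.comp_apply, smul_apply,
    ContinuousLinearMap.smulRight_apply, innerSL_apply_apply, Complex.reCLM_apply,
    Complex.ofRealCLM_apply, smul_eq_mul, mode]
  rw [← Complex.re_ofReal_mul]
  congr 1
  ring

theorem integrable_mode (k : Fin 2 → ℤ) : Integrable (mode k) cellMeasure :=
  (integrable_const (1 : ℝ)).mono' (continuous_mode k).aestronglyMeasurable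
    (Filter.Eventually.of_forall fun x => (norm_mode k x).le)

theorem mean_wave (w : ℂ) {k : Fin 2 → ℤ} (hk : k ≠ 0) : mean (wave w k) = 0 := by
  have h := mean_mode hk
  rw [mean_eq_integral] at h ⊢
  have h2 := integral_re ((integrable_mode k).const_mul w)
  simp only [RCLike.re_to_complex] at h2
  change ∫ x, (w * mode k x).re ∂cellMeasure = 0
  rw [h2, integral_const_mul, h, mul_zero, Complex.zero_re]

theorem innerL2_wave {g : Plane → ℝ} (hg : Integrable g cellMeasure) (w : ℂ) (k : Fin 2 → ℤ) :
    innerL2 g (wave w k) = (w * conj (coeff g k)).re := by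
  have h1 : Integrable (fun x => w * conj ((g x : ℂ) * conj (mode k x))) cellMeasure :=
    (Complex.conjCLE.toContinuousLinearMap.integrable_comp
      (integrable_mul_conj_mode hg k)).const_mul w
  rw [innerL2, mean_eq_integral, coeff_eq_mean, mean_eq_integral, ← integral_conj,
    ← integral_const_mul]
  have h2 := integral_re h1
  simp only [RCLike.re_to_complex] at h2
  rw [← h2]
  refine integral_congr_ae (Filter.Eventually.of_forall fun x => ?_)
  simp only [wave, map_mul, Complex.conj_ofReal, Complex.conj_conj]
  rw [← Complex.re_ofReal_mul]
  congr 1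
  ring

theorem coeff_wave_eq_zero (w : ℂ) {k l : Fin 2 → ℤ} (h1 : k ≠ l) (h2 : -k ≠ l) :
    coeff (wave w k) l = 0 := by
  have e : ∀ x, (wave w k x : ℂ) * conj (mode l x) =
      w / 2 * (mode k x * conj (mode l x)) + conj w / 2 * (mode (-k) x * conj (mode l x)) := by
    intro x
    rw [wave, Complex.re_eq_add_conj, map_mul, mode_neg_freq]
    ring
  have i : ∀ m : Fin 2 → ℤ, Integrable (fun x => mode m x * conj (mode l x)) cellMeasure := by
    intro m
    simp_rw [mode_mul_conj_mode]
    exact integrable_mode _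
  rw [coeff_eq_mean, mean_eq_integral]
  simp_rw [e]
  rw [integral_add ((i k).const_mul _) ((i (-k)).const_mul _), integral_const_mul,
    integral_const_mul, ← mean_eq_integral, ← mean_eq_integral, mean_mode_mul_conj_mode,
    mean_mode_mul_conj_mode, if_neg h1, if_neg h2]
  simp

theorem memL2_wave (w : ℂ) {k : Fin 2 → ℤ} (hk : k ≠ 0) : MemL2 (wave w k) where
  periodic := wave_periodic w k
  memLp := by
    refine memLp_cellMeasure_iff.1 (MemLp.of_bound
      (contDiff_wave w k).continuous.aestronglyMeasurable ‖w‖ (Filter.Eventually.of_forall fun x => ?_))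
    rw [wave, Real.norm_eq_abs]
    refine (Complex.abs_re_le_norm _).trans ?_
    rw [norm_mul, norm_mode, mul_one]
  mean_zero := mean_wave w hk

theorem norm_freq_neg (k : Fin 2 → ℤ) : ‖freq (-k)‖ = ‖freq k‖ := by
  have : freq (-k) = -freq k := by
    ext j
    simp [freq]
  rw [this, norm_neg]

/-- The wave lives on the frequencies `k` and `-k`, where the multiplier takes a single value; it
factors out and Parseval gives the rest. -/
theorem innerLambda_wave {φ : Plane → ℝ} (hφ : MemL2 φ) (s : ℝ) (w : ℂ) {k : Fin 2 → ℤ}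
    (hk : k ≠ 0) :
    innerLambda s φ (wave w k) = ‖freq k‖ ^ (2 * s) * (w * conj (coeff φ k)).re := by
  have hw := memL2_wave w hk
  have hP := Complex.hasSum_re (hasSum_coeff_mul_conj hφ.memLp_cellMeasure hw.memLp_cellMeasure)
  rw [← innerL2_wave (integrable_of_memLp_two hφ.memLp_cellMeasure), innerLambda, innerL2]
  rw [Complex.ofReal_re] at hP
  rw [← hP.tsum_eq, ← tsum_freq0 (g := fun l => (coeff φ l * conj (coeff (wave w k) l)).re)
    (by simp [hφ.coeff_zero]), ← tsum_mul_left]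
  refine tsum_congr fun l => ?_
  by_cases h1 : k = l.1
  · rw [h1]
  by_cases h2 : -k = l.1
  · rw [← h2, norm_freq_neg]
  · rw [coeff_wave_eq_zero w h1 h2]
    simp

/-- The Fourier coefficients of `-u·∇φ = -div (φ u)`. -/
def transportCoeff (φ : Plane → ℝ) (u : Plane → Plane) (k : Fin 2 → ℤ) : ℂ :=
  -(Complex.I * ∑ j, (k j : ℂ) * coeff (fun x => φ x * u x j) k)

theorem innerL2_fderiv_wave {φ : Plane → ℝ} {u : Plane → Plane} (hφ : MemL2 φ)
    (hu : ∀ j, MemL2 fun x => u x j) (w : ℂ) (k : Fin 2 → ℤ) :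
    innerL2 φ (fun x => fderiv ℝ (wave w k) x (u x)) =
      (w * conj (transportCoeff φ u k)).re := by
  have hi : ∀ j, Integrable (fun x => φ x * u x j) cellMeasure := fun j =>
    hφ.memLp_cellMeasure.integrable_mul (hu j).memLp_cellMeasure
  set W := w * Complex.I
  have hiw : ∀ j, Integrable (fun x => φ x * u x j * wave W k x) cellMeasure := fun j => by
    refine (hi j).mul_bdd (c := ‖W‖) (contDiff_wave W k).continuous.aestronglyMeasurable
      (Filter.Eventually.of_forall fun x => ?_)
    rw [wave, Real.norm_eq_abs]
    refine (Complex.abs_re_le_norm _).trans ?_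
    rw [norm_mul, norm_mode, mul_one]
  have e : ∀ x, φ x * fderiv ℝ (wave w k) x (u x) =
      ∑ j, (k j : ℝ) * (φ x * u x j * wave W k x) := by
    intro x
    rw [fderiv_wave, inner_freq, Fin.sum_univ_two]
    ring
  have h2 : innerL2 φ (fun x => fderiv ℝ (wave w k) x (u x)) =
      ∑ j, (k j : ℝ) * innerL2 (fun x => φ x * u x j) (wave W k) := by
    simp only [innerL2, mean_eq_integral]
    simp_rw [e]
    exact integral_sum_const_mul _ hiw
  rw [h2]
  simp_rw [innerL2_wave (hi _)]
  rw [transportCoeff, Fin.sum_univ_two, Fin.sum_univ_two, ← Complex.re_ofReal_mul,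
    ← Complex.re_ofReal_mul, ← Complex.add_re]
  congr 1
  simp only [map_neg, map_mul, map_add, Complex.conj_I, map_intCast, W]
  push_cast
  ring

/-- The cutoff equals one up to time `T + 1` and vanishes from `T + 2` on. On `[0, T]` the test
function is thus constant in time, and its time derivative drops out of the weak formulation. -/
theorem isTest_wave (T : ℝ) (w : ℂ) {k : Fin 2 → ℤ} (hk : k ≠ 0) :
    IsTest fun s x => Real.smoothTransition (T + 2 - s) * wave w k x where
  smooth := by
    have h1 : ContDiff ℝ ∞ fun p : ℝ × Plane => Real.smoothTransition (T + 2 - p.1) :=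
      Real.smoothTransition.contDiff.comp (contDiff_const.sub contDiff_fst)
    exact h1.mul ((contDiff_wave w k).comp contDiff_snd)
  periodic t x l := by
    simp only [wave_periodic w k x l]
  mean_zero t := by
    rw [mean_eq_integral, integral_const_mul, ← mean_eq_integral, mean_wave w hk, mul_zero]
  compact := ⟨T + 2, fun t ht => by
    funext x
    rw [Real.smoothTransition.zero_of_nonpos (by linarith), zero_mul, Pi.zero_apply]⟩

/-- The right-hand side of the evolution equation of the Fourier coefficients. -/
def modeRhs (γ : ℝ) (f φ : Plane → ℝ) (u : Plane → Plane) (k : Fin 2 → ℤ) : ℂ :=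
  -((‖freq k‖ ^ γ : ℝ) : ℂ) * coeff φ k + coeff f k + transportCoeff φ u k

theorem continuousOn_transportCoeff {σ : ℝ} (hσ : 0 ≤ σ) {θ : ℝ → Plane → ℝ}
    (h : ContinuousInSobolev σ θ) {u : ℝ → Plane → Plane}
    (hu : ∀ t, 0 ≤ t → IsRieszPerp (θ t) (u t)) (k : Fin 2 → ℤ) :
    ContinuousOn (fun t => transportCoeff (θ t) (u t) k) (Set.Ici 0) :=
  (continuousOn_const.mul (continuousOn_finsetSum _ fun j _ =>
    continuousOn_const.mul (h.continuousOn_coeff_mul hσ hu j k))).neg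

theorem continuousOn_modeRhs {σ : ℝ} (hσ : 0 ≤ σ) (γ : ℝ) (f : Plane → ℝ) {θ : ℝ → Plane → ℝ}
    (h : ContinuousInSobolev σ θ) {u : ℝ → Plane → Plane}
    (hu : ∀ t, 0 ≤ t → IsRieszPerp (θ t) (u t)) (k : Fin 2 → ℤ) :
    ContinuousOn (fun t => modeRhs γ f (θ t) (u t) k) (Set.Ici 0) :=
  ((continuousOn_const.mul (h.continuousOn_coeff hσ k)).add continuousOn_const).add
    (continuousOn_transportCoeff hσ h hu k)

/-- The evolution equation of the Fourier coefficients of a weak solution. -/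
theorem exists_velocity_coeff_sub {γ σ : ℝ} (hσ : 0 ≤ σ) {f : Plane → ℝ} (hf : MemL2 f)
    {θ : ℝ → Plane → ℝ} (hθ : IsWeakSolution γ f θ) (h : ContinuousInSobolev σ θ) :
    ∃ u : ℝ → Plane → Plane, (∀ t, 0 ≤ t → IsRieszPerp (θ t) (u t)) ∧
      ∀ k : Fin 2 → ℤ, k ≠ 0 → ∀ T : ℝ, 0 < T →
        coeff (θ T) k - coeff (θ 0) k = ∫ t in (0 : ℝ)..T, modeRhs γ f (θ t) (u t) k := by
  obtain ⟨u, hu, heq⟩ := hθ.equation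
  refine ⟨u, hu, fun k hk T hT => ?_⟩
  have hII : ∀ {E : Type} [NormedAddCommGroup E] {g : ℝ → E}, ContinuousOn g (Set.Ici 0) →
      IntervalIntegrable g volume 0 T := fun hg =>
    (hg.mono (by rw [Set.uIcc_of_le hT.le]; exact Set.Icc_subset_Ici_self)).intervalIntegrable
  have hH := hII (continuousOn_modeRhs hσ γ f h hu k)
  have hc := h.continuousOn_coeff hσ k
  have key : ∀ w : ℂ, (w * conj (coeff (θ T) k - coeff (θ 0) k -
      ∫ t in (0 : ℝ)..T, modeRhs γ f (θ t) (u t) k)).re = 0 := by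
    intro w
    set L : ℂ →L[ℝ] ℝ := Complex.reCLM.comp
      ((ContinuousLinearMap.mul ℝ ℂ w).comp (Complex.conjCLE : ℂ →L[ℝ] ℂ)) with hL
    have hLe : ∀ z, (w * conj z).re = L z := fun z => rfl
    have hφ : ∀ t, t ≤ T + 1 →
        (fun x => Real.smoothTransition (T + 2 - t) * wave w k x) = wave w k := by
      intro t ht
      funext x
      rw [Real.smoothTransition.one_of_one_le (by linarith), one_mul]
    have hd : ∀ t ∈ Set.uIcc 0 T,
        innerL2 (θ t) (fun x => deriv (fun s => Real.smoothTransition (T + 2 - s) * wave w k x) t) =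
          0 := by
      intro t ht
      rw [Set.uIcc_of_le hT.le] at ht
      have : (fun x => deriv (fun s => Real.smoothTransition (T + 2 - s) * wave w k x) t) =
          fun _ => 0 := by
        funext x
        have : (fun s => Real.smoothTransition (T + 2 - s) * wave w k x) =ᶠ[nhds t]
            fun _ => wave w k x := by
          filter_upwards [Iio_mem_nhds (show t < T + 1 by linarith [ht.2])] with s hs
          exact congrFun (hφ s (le_of_lt hs)) x
        rw [this.deriv_eq, deriv_const]
      rw [this, innerL2]
      simp [mean_eq_integral]
    have hm : ∀ t, 0 ≤ t → MemL2 (θ t) := hθ.memL2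
    have E := heq _ (isTest_wave T w hk) T hT
    have hd2 : ∀ t ∈ Set.uIcc 0 T, innerL2 (θ t) (fun x => fderiv ℝ
        (fun x => Real.smoothTransition (T + 2 - t) * wave w k x) x (u t x)) =
          L (transportCoeff (θ t) (u t) k) := fun t ht => by
      rw [Set.uIcc_of_le hT.le] at ht
      rw [hφ t (by linarith [ht.2])]
      exact innerL2_fderiv_wave (hm t ht.1) (hu t ht.1).memL2 w k
    have hd3 : ∀ t ∈ Set.uIcc 0 T, innerLambda (γ / 2) (θ t)
        (fun x => Real.smoothTransition (T + 2 - t) * wave w k x) =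
          ‖freq k‖ ^ γ * L (coeff (θ t) k) := fun t ht => by
      rw [Set.uIcc_of_le hT.le] at ht
      rw [hφ t (by linarith [ht.2]), innerLambda_wave (hm t ht.1) _ w hk, hLe,
        mul_div_cancel₀ γ two_ne_zero]
    have hd4 : ∀ t ∈ Set.uIcc 0 T, innerL2 f
        (fun x => Real.smoothTransition (T + 2 - t) * wave w k x) = L (coeff f k) := fun t ht => by
      rw [Set.uIcc_of_le hT.le] at ht
      rw [hφ t (by linarith [ht.2])]
      exact innerL2_wave (integrable_of_memLp_two hf.memLp_cellMeasure) w k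
    rw [intervalIntegral.integral_congr hd, intervalIntegral.integral_congr hd2,
      intervalIntegral.integral_congr hd3, intervalIntegral.integral_congr hd4,
      hφ 0 (by linarith), hφ T (by linarith),
      innerL2_wave (integrable_of_memLp_two (hm 0 le_rfl).memLp_cellMeasure),
      innerL2_wave (integrable_of_memLp_two (hm T hT.le).memLp_cellMeasure), hLe, hLe] at E
    rw [hLe, map_sub, map_sub, ← L.intervalIntegral_comp_comm hH]
    have hLc : IntervalIntegrable (fun t => -(‖freq k‖ ^ γ * L (coeff (θ t) k))) volume 0 T :=
      ((hII (L.continuous.comp_continuousOn hc)).const_mul _).neg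
    have hLt : IntervalIntegrable (fun t => L (transportCoeff (θ t) (u t) k)) volume 0 T :=
      hII (L.continuous.comp_continuousOn (continuousOn_transportCoeff hσ h hu k))
    have e : ∀ t, L (modeRhs γ f (θ t) (u t) k) =
        -(‖freq k‖ ^ γ * L (coeff (θ t) k)) + L (coeff f k) + L (transportCoeff (θ t) (u t) k) := by
      intro t
      rw [modeRhs, map_add, map_add, neg_mul, map_neg, ← Complex.real_smul, map_smul, smul_eq_mul]
    simp_rw [e]
    rw [intervalIntegral.integral_add (hLc.add intervalIntegrable_const) hLt,
      intervalIntegral.integral_add hLc intervalIntegrable_const,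
      intervalIntegral.integral_neg]
    simp only [intervalIntegral.integral_zero] at E
    linarith
  -- Choosing `w` to be the defect itself turns the vanishing real part into the vanishing of its
  -- squared modulus.
  have := key (coeff (θ T) k - coeff (θ 0) k - ∫ t in (0 : ℝ)..T, modeRhs γ f (θ t) (u t) k)
  rw [Complex.mul_conj, Complex.ofReal_re, Complex.normSq_eq_zero] at this
  exact sub_eq_zero.1 this

/-! ### Calculus in time and filtered energies. -/

theorem hasDerivWithinAt_Ici_of_integral {E : Type*} [NormedAddCommGroup E] [NormedSpace ℝ E]
    [CompleteSpace E] {c H : ℝ → E} (hH : ContinuousOn H (Set.Ici 0))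
    (h : ∀ T : ℝ, 0 < T → c T - c 0 = ∫ t in (0 : ℝ)..T, H t) {t : ℝ} (ht : 0 ≤ t) :
    HasDerivWithinAt c (H t) (Set.Ici 0) t := by
  -- The integrand is extended to negative times by its value at zero, so the two-sided fundamental
  -- theorem applies also at `t = 0`; restriction then gives the one-sided derivative.
  have hG : Continuous fun s => H (max s 0) :=
    hH.comp_continuous (continuous_id.max continuous_const) fun s =>
      Set.mem_Ici.2 (le_max_right s 0)
  have h1 : HasDerivAt (fun T => c 0 + ∫ s in (0 : ℝ)..T, H (max s 0)) (H (max t 0)) t :=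
    (intervalIntegral.integral_hasDerivAt_right (hG.intervalIntegrable _ _)
      (hG.stronglyMeasurableAtFilter _ _) hG.continuousAt).const_add _
  rw [max_eq_left ht] at h1
  have h2 : ∀ T ∈ Set.Ici (0 : ℝ), c T = c 0 + ∫ s in (0 : ℝ)..T, H (max s 0) := by
    intro T hT
    have e : ∫ s in (0 : ℝ)..T, H (max s 0) = ∫ s in (0 : ℝ)..T, H s := by
      refine intervalIntegral.integral_congr fun s hs => ?_
      rw [Set.uIcc_of_le hT] at hs
      simp only [max_eq_left hs.1]
    rcases (Set.mem_Ici.1 hT).eq_or_lt with rfl | hT'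
    · simp
    · rw [e, ← h T hT', add_sub_cancel]
  exact h1.hasDerivWithinAt.congr h2 (h2 t ht)

theorem integral_eq_sub_of_hasDerivWithinAt_Ici {E : Type*} [NormedAddCommGroup E]
    [NormedSpace ℝ E] [CompleteSpace E] {c H : ℝ → E} (hH : ContinuousOn H (Set.Ici 0))
    (h : ∀ t : ℝ, 0 ≤ t → HasDerivWithinAt c (H t) (Set.Ici 0) t) {T : ℝ} (hT : 0 ≤ T) :
    ∫ t in (0 : ℝ)..T, H t = c T - c 0 := by
  refine intervalIntegral.integral_eq_sub_of_hasDerivAt_of_le hT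
    (fun t ht => (h t ht.1).continuousWithinAt.mono Set.Icc_subset_Ici_self)
    (fun t ht => (h t ht.1.le).hasDerivAt (Ici_mem_nhds ht.1)) ?_
  refine ContinuousOn.intervalIntegrable (hH.mono ?_)
  rw [Set.uIcc_of_le hT]
  exact Set.Icc_subset_Ici_self

section FilterSum

variable {α : ℝ} {g : (Fin 2 → ℤ) → ℝ}

/-- Truncation only decreases the multiplier, so there is a majorant independent of `ε`, as
dominated convergence requires. -/
theorem abs_filterWeight_mul_le (hα : α ∈ Set.Ioo (0 : ℝ) 1) (hg : g 0 = 0) {ε : ℝ} (hε : 0 ≤ ε)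
    (k : Fin 2 → ℤ) :
    |filterWeight α ε ‖freq k‖ * g k| ≤ filterConst α * (‖freq k‖ ^ (2 * α) * |g k|) := by
  rcases eq_or_ne k 0 with rfl | hk
  · simp [hg]
  rw [abs_mul, abs_of_nonneg (filterWeight_nonneg hε _ _), ← mul_assoc,
    ← filterWeight_zero (by linarith [one_le_norm_freq hk])]
  gcongr
  exact filterWeight_le hα hε _

theorem summable_filterWeight_mul_of_summable (hα : α ∈ Set.Ioo (0 : ℝ) 1) (hg : g 0 = 0)
    (hs : Summable fun k => ‖freq k‖ ^ (2 * α) * |g k|) {ε : ℝ} (hε : 0 ≤ ε) :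
    Summable fun k => filterWeight α ε ‖freq k‖ * g k :=
  Summable.of_norm_bounded (hs.mul_left (filterConst α)) fun k => abs_filterWeight_mul_le hα hg hε k

theorem abs_tsum_filterWeight_mul_le (hα : α ∈ Set.Ioo (0 : ℝ) 1) (hg : g 0 = 0)
    (hs : Summable fun k => ‖freq k‖ ^ (2 * α) * |g k|) {ε : ℝ} (hε : 0 ≤ ε) :
    |∑' k, filterWeight α ε ‖freq k‖ * g k| ≤
      filterConst α * ∑' k, ‖freq k‖ ^ (2 * α) * |g k| := by
  rw [← tsum_mul_left, ← Real.norm_eq_abs]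
  exact tsum_of_norm_bounded (f := fun k => filterWeight α ε ‖freq k‖ * g k)
    (hs.mul_left (filterConst α)).hasSum fun k => abs_filterWeight_mul_le hα hg hε k

theorem tendsto_tsum_filterWeight_mul (hα : α ∈ Set.Ioo (0 : ℝ) 1) (hg : g 0 = 0)
    (hs : Summable fun k => ‖freq k‖ ^ (2 * α) * |g k|) :
    Filter.Tendsto (fun n : ℕ => ∑' k, filterWeight α (1 / ((n : ℝ) + 1)) ‖freq k‖ * g k)
      Filter.atTop (nhds (filterConst α * ∑' k, ‖freq k‖ ^ (2 * α) * g k)) := by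
  have e : filterConst α * ∑' k, ‖freq k‖ ^ (2 * α) * g k =
      ∑' k, filterWeight α 0 ‖freq k‖ * g k := by
    rw [← tsum_mul_left]
    refine tsum_congr fun k => ?_
    rcases eq_or_ne k 0 with rfl | hk
    · simp [hg]
    · rw [filterWeight_zero (by linarith [one_le_norm_freq hk]), mul_assoc]
  rw [e]
  refine tendsto_tsum_of_dominated_convergence (hs.mul_left (filterConst α))
    (fun k => (tendsto_filterWeight hα _).mul_const _) (Filter.Eventually.of_forall fun n k => ?_)
  exact abs_filterWeight_mul_le hα hg (by positivity) k

end FilterSum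

/-- The rate of change of `|φ̂_k|²` due to dissipation and forcing. -/
def linearRate (γ : ℝ) (f φ : Plane → ℝ) (k : Fin 2 → ℤ) : ℝ :=
  -2 * ‖freq k‖ ^ γ * ‖coeff φ k‖ ^ 2 + 2 * (coeff f k * conj (coeff φ k)).re

theorem two_mul_re_modeRhs (γ : ℝ) (f φ : Plane → ℝ) (u : Plane → Plane) (k : Fin 2 → ℤ) :
    2 * (modeRhs γ f φ u k * conj (coeff φ k)).re = linearRate γ f φ k + 2 * flux φ u k := by
  rw [modeRhs, linearRate, add_mul, add_mul, Complex.add_re, Complex.add_re, mul_assoc,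
    Complex.mul_conj, Complex.normSq_eq_norm_sq, neg_mul, Complex.neg_re, Complex.re_ofReal_mul,
    Complex.ofReal_re]
  change _ = _ + 2 * (transportCoeff φ u k * conj (coeff φ k)).re
  ring

theorem linearRate_zero_freq {φ : Plane → ℝ} (hφ : MemL2 φ) (γ : ℝ) (f : Plane → ℝ) :
    linearRate γ f φ 0 = 0 := by
  simp [linearRate, hφ.coeff_zero]

theorem flux_zero_freq (φ : Plane → ℝ) (u : Plane → Plane) : flux φ u 0 = 0 := by
  simp [flux]

theorem abs_linearRate_le (γ : ℝ) (f φ : Plane → ℝ) (k : Fin 2 → ℤ) :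
    |linearRate γ f φ k| ≤ 2 * ‖freq k‖ ^ γ * ‖coeff φ k‖ ^ 2 + 2 * (‖coeff f k‖ * ‖coeff φ k‖) := by
  have h := Complex.abs_re_le_norm (coeff f k * conj (coeff φ k))
  rw [norm_mul, RCLike.norm_conj, abs_le] at h
  have h2 : 0 ≤ ‖freq k‖ ^ γ * ‖coeff φ k‖ ^ 2 := by positivity
  rw [linearRate, abs_le]
  constructor <;> linarith [h.1, h.2]

/-- Since `|k| ≥ 1` on nonzero modes, the part of the forcing term quadratic in `φ` is dominated by
the dissipation, which turns the factor two into three. -/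
theorem rpow_mul_abs_linearRate_le {γ α : ℝ} (hγ : 0 ≤ γ) {f φ : Plane → ℝ}
    (hφ : MemL2 φ) (k : Fin 2 → ℤ) :
    ‖freq k‖ ^ (2 * α) * |linearRate γ f φ k| ≤
      3 * (‖freq k‖ ^ (2 * (α + γ / 2)) * ‖coeff φ k‖ ^ 2) +
        ‖freq k‖ ^ (2 * α) * ‖coeff f k‖ ^ 2 := by
  rcases eq_or_ne k 0 with rfl | hk
  · rw [linearRate_zero_freq hφ, abs_zero, mul_zero]
    positivity
  have h1 := one_le_norm_freq hk
  have h0 : 0 < ‖freq k‖ := by linarith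
  have e : ‖freq k‖ ^ (2 * (α + γ / 2)) = ‖freq k‖ ^ (2 * α) * ‖freq k‖ ^ γ := by
    rw [← Real.rpow_add h0]
    congr 1
    ring
  have h2 : 1 ≤ ‖freq k‖ ^ γ := Real.one_le_rpow h1 hγ
  have h3 : |linearRate γ f φ k| ≤ 3 * (‖freq k‖ ^ γ * ‖coeff φ k‖ ^ 2) + ‖coeff f k‖ ^ 2 := by
    refine (abs_linearRate_le γ f φ k).trans ?_
    nlinarith [sq_nonneg (‖coeff f k‖ - ‖coeff φ k‖), sq_nonneg (‖coeff φ k‖),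
      mul_le_mul_of_nonneg_right h2 (sq_nonneg ‖coeff φ k‖)]
  rw [e]
  calc _ ≤ ‖freq k‖ ^ (2 * α) *
        (3 * (‖freq k‖ ^ γ * ‖coeff φ k‖ ^ 2) + ‖coeff f k‖ ^ 2) := by gcongr
    _ = _ := by ring

section

variable {γ α : ℝ} {f φ : Plane → ℝ}

theorem summable_rpow_mul_abs_linearRate (hγ : 0 ≤ γ) (hf : MemSobolev α f)
    (hφ : MemSobolev (α + γ / 2) φ) :
    Summable fun k => ‖freq k‖ ^ (2 * α) * |linearRate γ f φ k| :=
  Summable.of_nonneg_of_le (fun _ => by positivity)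
    (rpow_mul_abs_linearRate_le hγ hφ.memL2)
    ((hφ.summable_all.mul_left 3).add hf.summable_all)

theorem tsum_rpow_mul_abs_linearRate_le (hγ : 0 ≤ γ) (hf : MemSobolev α f)
    (hφ : MemSobolev (α + γ / 2) φ) :
    ∑' k, ‖freq k‖ ^ (2 * α) * |linearRate γ f φ k| ≤
      3 * sobolevSq (α + γ / 2) φ + sobolevSq α f := by
  rw [hφ.memL2.sobolevSq_eq, hf.memL2.sobolevSq_eq, ← tsum_mul_left,
    ← (hφ.summable_all.mul_left 3).tsum_add hf.summable_all]
  exact Summable.tsum_le_tsum (rpow_mul_abs_linearRate_le hγ hφ.memL2)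
    (summable_rpow_mul_abs_linearRate hγ hf hφ)
    ((hφ.summable_all.mul_left 3).add hf.summable_all)

theorem tsum_rpow_mul_linearRate (hγ : 0 ≤ γ) (hf : MemSobolev α f)
    (hφ : MemSobolev (α + γ / 2) φ) :
    ∑' k, ‖freq k‖ ^ (2 * α) * linearRate γ f φ k =
      -2 * sobolevSq (α + γ / 2) φ + 2 * innerLambda α f φ := by
  have hφ' := hφ.mono (σ := α) (by linarith)
  have hi : Summable fun k : Freq0 => ‖freq k.1‖ ^ (2 * α) * (coeff f k.1 * conj (coeff φ k.1)).re :=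
    Summable.of_norm_bounded (hf.summable_innerLambda hφ') fun k => by
      rw [norm_mul, Real.norm_of_nonneg (by positivity : 0 ≤ ‖freq k.1‖ ^ (2 * α))]
      gcongr
      exact Complex.abs_re_le_norm _
  rw [← tsum_freq0 (g := fun k => ‖freq k‖ ^ (2 * α) * linearRate γ f φ k)
    (by simp [linearRate_zero_freq hφ.memL2]), sobolevSq, innerLambda, ← tsum_mul_left,
    ← tsum_mul_left, ← (hφ.summable.mul_left (-2)).tsum_add (hi.mul_left 2)]
  refine tsum_congr fun k => ?_
  have h0 : 0 < ‖freq k.1‖ := by linarith [one_le_norm_freq k.2]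
  have e : ‖freq k.1‖ ^ (2 * (α + γ / 2)) = ‖freq k.1‖ ^ (2 * α) * ‖freq k.1‖ ^ γ := by
    rw [← Real.rpow_add h0]
    congr 1
    ring
  rw [e, linearRate]
  ring

end

theorem summable_filterWeight_mul_flux {α ε B : ℝ} (hα : α ∈ Set.Ioo (0 : ℝ) 1) (hε : 0 < ε)
    {φ : Plane → ℝ} {u : Plane → Plane} (hB : ∀ k, |flux φ u k| ≤ B * ‖freq k‖) :
    Summable fun k => filterWeight α ε ‖freq k‖ * flux φ u k := by
  refine Summable.of_norm_bounded ((summable_gaussWeight_mul_flux hB hε).abs.mul_left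
    (∫ r in Set.Ioi ε, r ^ (-(1 + 2 * α)))) fun k => ?_
  rw [norm_mul, Real.norm_of_nonneg (filterWeight_nonneg hε.le _ _), Real.norm_eq_abs, abs_mul,
    abs_of_pos (gaussWeight_pos _ _), ← mul_assoc]
  gcongr
  exact filterWeight_le_gaussWeight hα hε (norm_nonneg _)

/-- The balance of the filtered energies of a family of amplitudes. -/
theorem tsum_filterWeight_mul_sub {α ε M : ℝ} (hα : α ∈ Set.Ioo (0 : ℝ) 1) (hε : 0 < ε)
    {e g : (Fin 2 → ℤ) → ℝ → ℝ} (hg : ∀ k, ContinuousOn (g k) (Set.Ici 0))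
    (he : ∀ k t, 0 ≤ t → HasDerivWithinAt (e k) (g k t) (Set.Ici 0) t)
    (hgM : ∀ k t, 0 ≤ t → |g k t| ≤ M * ‖freq k‖ ^ 2)
    (heM : ∀ t, 0 ≤ t → Summable fun k => filterWeight α ε ‖freq k‖ * e k t) {T : ℝ} (hT : 0 ≤ T) :
    ∑' k, filterWeight α ε ‖freq k‖ * e k T - ∑' k, filterWeight α ε ‖freq k‖ * e k 0 =
      ∫ t in (0 : ℝ)..T, ∑' k, filterWeight α ε ‖freq k‖ * g k t := by
  have hb : Summable fun k => M * (filterWeight α ε ‖freq k‖ * ‖freq k‖ ^ 2) :=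
    (summable_filterWeight_mul hα hε).mul_left M
  have hbd : ∀ k t, t ∈ Set.uIoc 0 T → ‖filterWeight α ε ‖freq k‖ * g k t‖ ≤
      M * (filterWeight α ε ‖freq k‖ * ‖freq k‖ ^ 2) := by
    intro k t ht
    rw [Set.uIoc_of_le hT] at ht
    rw [norm_mul, Real.norm_of_nonneg (filterWeight_nonneg hε.le _ _), Real.norm_eq_abs]
    calc _ ≤ filterWeight α ε ‖freq k‖ * (M * ‖freq k‖ ^ 2) := by
          gcongr
          · exact filterWeight_nonneg hε.le _ _
          · exact hgM k t ht.1.le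
      _ = _ := by ring
  have h := intervalIntegral.hasSum_integral_of_dominated_convergence (μ := volume) (a := 0) (b := T)
    (F := fun k t => filterWeight α ε ‖freq k‖ * g k t)
    (fun k _ => M * (filterWeight α ε ‖freq k‖ * ‖freq k‖ ^ 2))
    (fun k => by
      rw [Set.uIoc_of_le hT]
      exact ((continuousOn_const.mul (hg k)).mono fun t ht =>
        Set.mem_Ici.2 ht.1.le).aestronglyMeasurable measurableSet_Ioc)
    (fun k => Filter.Eventually.of_forall (hbd k))
    (Filter.Eventually.of_forall fun _ _ => hb) intervalIntegrable_const
    (Filter.Eventually.of_forall fun t ht =>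
      (Summable.of_norm_bounded hb fun k => hbd k t ht).hasSum)
  rw [← h.tsum_eq, ← (heM T hT).tsum_sub (heM 0 le_rfl)]
  refine tsum_congr fun k => ?_
  rw [intervalIntegral.integral_const_mul,
    integral_eq_sub_of_hasDerivWithinAt_Ici (hg k) (he k) hT, mul_sub]

theorem continuousOn_tsum_filterWeight_mul {α ε M : ℝ} (hα : α ∈ Set.Ioo (0 : ℝ) 1) (hε : 0 < ε)
    {g : (Fin 2 → ℤ) → ℝ → ℝ} (hg : ∀ k, ContinuousOn (g k) (Set.Ici 0))
    (hgM : ∀ k t, 0 ≤ t → |g k t| ≤ M * ‖freq k‖ ^ 2) :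
    ContinuousOn (fun t => ∑' k, filterWeight α ε ‖freq k‖ * g k t) (Set.Ici 0) := by
  refine continuousOn_tsum (fun k => continuousOn_const.mul (hg k))
    ((summable_filterWeight_mul hα hε).mul_left M) fun k t ht => ?_
  rw [norm_mul, Real.norm_of_nonneg (filterWeight_nonneg hε.le _ _), Real.norm_eq_abs]
  calc _ ≤ filterWeight α ε ‖freq k‖ * (M * ‖freq k‖ ^ 2) := by
        gcongr
        · exact filterWeight_nonneg hε.le _ _
        · exact hgM k t ht
    _ = _ := by ring

/-! ### The energy balance of a solution. -/

section Solution

variable {γ α β K : ℝ} {f : Plane → ℝ} {θ : ℝ → Plane → ℝ} {u : ℝ → Plane → Plane}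

theorem hasDerivWithinAt_sq_coeff {σ : ℝ} (hσ : 0 ≤ σ) (h : ContinuousInSobolev σ θ)
    (hu : ∀ t, 0 ≤ t → IsRieszPerp (θ t) (u t))
    (hode : ∀ k : Fin 2 → ℤ, k ≠ 0 → ∀ T : ℝ, 0 < T →
      coeff (θ T) k - coeff (θ 0) k = ∫ t in (0 : ℝ)..T, modeRhs γ f (θ t) (u t) k)
    (k : Fin 2 → ℤ) {t : ℝ} (ht : 0 ≤ t) :
    HasDerivWithinAt (fun s => ‖coeff (θ s) k‖ ^ 2)
      (linearRate γ f (θ t) k + 2 * flux (θ t) (u t) k) (Set.Ici 0) t := by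
  rcases eq_or_ne k 0 with rfl | hk
  · rw [linearRate_zero_freq (h.mem t ht).memL2, flux_zero_freq, mul_zero, add_zero]
    refine (hasDerivWithinAt_const t (Set.Ici 0) (0 : ℝ)).congr (fun s hs => ?_) ?_
    · simp [(h.mem s hs).memL2.coeff_zero]
    · simp [(h.mem t ht).memL2.coeff_zero]
  have := (hasDerivWithinAt_Ici_of_integral (continuousOn_modeRhs hσ γ f h hu k) (hode k hk)
    ht).norm_sq
  rw [← two_mul_re_modeRhs]
  rwa [Complex.inner] at this

theorem continuousOn_flux {σ : ℝ} (hσ : 0 ≤ σ) (h : ContinuousInSobolev σ θ)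
    (hu : ∀ t, 0 ≤ t → IsRieszPerp (θ t) (u t)) (k : Fin 2 → ℤ) :
    ContinuousOn (fun t => flux (θ t) (u t) k) (Set.Ici 0) :=
  Complex.continuous_re.comp_continuousOn ((continuousOn_transportCoeff hσ h hu k).mul
    (Complex.continuous_conj.comp_continuousOn (h.continuousOn_coeff hσ k)))

theorem continuousOn_linearRate {σ : ℝ} (hσ : 0 ≤ σ) (h : ContinuousInSobolev σ θ)
    (γ : ℝ) (f : Plane → ℝ) (k : Fin 2 → ℤ) :
    ContinuousOn (fun t => linearRate γ f (θ t) k) (Set.Ici 0) := by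
  have hc := h.continuousOn_coeff hσ k
  refine (continuousOn_const.mul (hc.norm.pow 2)).add (continuousOn_const.mul ?_)
  exact Complex.continuous_re.comp_continuousOn (continuousOn_const.mul
    (Complex.continuous_conj.comp_continuousOn hc))

/-- A bound uniform in time whose quadratic growth, allowed by `γ ≤ 2`, is summable against the
truncated multipliers at fixed `ε`. -/
theorem abs_linearRate_le_sq (hγ : γ ≤ 2) {φ : Plane → ℝ} (hf : MemL2 f) (hφ : MemL2 φ) {A : ℝ}
    (hA : ∀ x, |φ x| ≤ A) (k : Fin 2 → ℤ) :
    |linearRate γ f φ k| ≤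
      (2 * A ^ 2 + 2 * (Real.sqrt (mean fun x => f x ^ 2) * A)) * ‖freq k‖ ^ 2 := by
  have hA0 : 0 ≤ A := (abs_nonneg _).trans (hA 0)
  rcases eq_or_ne k 0 with rfl | hk
  · rw [linearRate_zero_freq hφ, abs_zero]
    positivity
  have h1 := one_le_norm_freq hk
  have h2 : ‖freq k‖ ^ γ ≤ ‖freq k‖ ^ 2 := by
    rw [← Real.rpow_two]
    exact Real.rpow_le_rpow_of_exponent_le h1 hγ
  have h3 : (1 : ℝ) ≤ ‖freq k‖ ^ 2 := one_le_pow₀ h1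
  have h4 := norm_coeff_le hA k
  have h5 : ‖coeff f k‖ ≤ Real.sqrt (mean fun x => f x ^ 2) :=
    Real.le_sqrt_of_sq_le (norm_sq_coeff_le hf k)
  calc _ ≤ 2 * ‖freq k‖ ^ γ * ‖coeff φ k‖ ^ 2 + 2 * (‖coeff f k‖ * ‖coeff φ k‖) * 1 := by
        rw [mul_one]
        exact abs_linearRate_le γ f φ k
    _ ≤ 2 * ‖freq k‖ ^ 2 * A ^ 2 +
        2 * (Real.sqrt (mean fun x => f x ^ 2) * A) * ‖freq k‖ ^ 2 := by gcongr
    _ = _ := by ring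

/-- The energy balance in `H^α`. -/
theorem hasDerivWithinAt_sobolevSq (hγ : γ ∈ Set.Ioo (0 : ℝ) 2) (hα : α ∈ Set.Ioo (0 : ℝ) 1)
    (hβ : β ∈ Set.Ioo (max (1 - γ) 0) 1) (hf : MemSobolev α f)
    (h : ContinuousInSobolev (α + γ / 2) θ) (hK : ∀ t, 0 ≤ t → HolderBound β K (θ t))
    (hu : ∀ t, 0 ≤ t → IsRieszPerp (θ t) (u t))
    (hode : ∀ k : Fin 2 → ℤ, k ≠ 0 → ∀ T : ℝ, 0 < T →
      coeff (θ T) k - coeff (θ 0) k = ∫ t in (0 : ℝ)..T, modeRhs γ f (θ t) (u t) k)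
    {t : ℝ} (ht : 0 ≤ t) :
    HasDerivWithinAt (fun s => sobolevSq α (θ s))
      (-2 * sobolevSq (α + γ / 2) (θ t) + 2 * innerLambda α f (θ t) +
        2 * limitFlux α (θ t) (u t) / filterConst α) (Set.Ici 0) t := by
  have hβ0 : 0 < β := (le_max_right _ _).trans_lt hβ.1
  have hβγ : 0 < γ + β - 1 := by linarith [(le_max_left (1 - γ) 0).trans_lt hβ.1]
  have hβ' : β ∈ Set.Ioo (0 : ℝ) 1 := ⟨hβ0, hβ.2⟩
  have hγ0 := hγ.1
  have hα0 := hα.1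
  have hα1 := hα.2
  have hσ : 0 ≤ α + γ / 2 := by positivity
  have hc := filterConst_pos hα
  have hK0 : 0 ≤ K := (hK 0 le_rfl).nonneg
  obtain ⟨C0, hC0, hfl⟩ := exists_abs_flux_le hβ'
  -- The first entry keeps `1 + 2(α+δ) - β ≤ 2α + γ`, so the dissipation norm controls the flux at
  -- order `α + δ`; the second keeps `α + δ < 1`.
  set δ := min ((γ + β - 1) / 2) ((1 - α) / 2) with hδdef
  have hδ : 0 < δ := lt_min (by linarith) (by linarith)
  have hδ1 : δ ≤ (γ + β - 1) / 2 := min_le_left _ _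
  have hδ2 : δ ≤ (1 - α) / 2 := min_le_right _ _
  obtain ⟨C1, hC1, hlim⟩ := exists_abs_filterFlux_sub_le hα0 hδ.le (by linarith) hβ'
  set X : ℝ → ℝ := fun t => sobolevSq (α + γ / 2) (θ t) with hX
  set N : ℝ → ℝ := fun t => limitFlux α (θ t) (u t) with hN
  have hX0 : ∀ t, 0 ≤ X t := fun t => sobolevSq_nonneg _ _
  have hXc : ContinuousOn X (Set.Ici 0) := h.continuousOn_sobolevSq
  have hm : ∀ t, 0 ≤ t → MemL2 (θ t) := fun t ht => (h.mem t ht).memL2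
  have hB : ∀ t, 0 ≤ t → ∀ k, |flux (θ t) (u t) k| ≤ C0 * K ^ 3 * ‖freq k‖ := fun t ht =>
    hfl _ _ K (hm t ht) (hK t ht) (hu t ht)
  have hB2 : ∀ k t, 0 ≤ t → |flux (θ t) (u t) k| ≤ C0 * K ^ 3 * ‖freq k‖ ^ 2 := fun k t ht =>
    (hB t ht k).trans (by gcongr; exact le_sq_of_ne_zero k)
  have hNF : ∀ t, 0 ≤ t → |N t| ≤ C1 * K * X t ∧
      ∀ ε : ℝ, 0 < ε → |filterFlux α ε (θ t) (u t) - N t| ≤ C1 * K * X t * ε ^ (2 * δ) :=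
    fun t ht => hlim _ _ K (X t) (hm t ht) (hK t ht) (hu t ht) (hX0 t) (by
      rw [← (h.mem t ht).sobolevENN_eq]
      exact sobolevENN_mono (by linarith) (hm t ht))
  have hεn : ∀ n : ℕ, 0 < 1 / ((n : ℝ) + 1) := fun n => by positivity
  have hεt : Filter.Tendsto (fun n : ℕ => (1 / ((n : ℝ) + 1)) ^ (2 * δ)) Filter.atTop (nhds 0) := by
    have h1 := tendsto_one_div_add_atTop_nhds_zero_nat (𝕜 := ℝ)
    have := h1.rpow_const (p := 2 * δ) (Or.inr (by positivity))
    rwa [Real.zero_rpow (by positivity)] at this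
  have hFt : ∀ t, 0 ≤ t → Filter.Tendsto (fun n : ℕ => filterFlux α (1 / ((n : ℝ) + 1)) (θ t) (u t))
      Filter.atTop (nhds (N t)) := by
    intro t ht
    rw [tendsto_iff_norm_sub_tendsto_zero]
    refine squeeze_zero (fun n => norm_nonneg _) (fun n => (hNF t ht).2 _ (hεn n)) ?_
    simpa using hεt.const_mul (C1 * K * X t)
  -- The rate of convergence is proportional to the dissipation norm, which is bounded on compact
  -- time intervals. The limiting flux is therefore a locally uniform limit of continuous functions.
  have hNc : ContinuousOn N (Set.Ici 0) := by
    have hIcc : ∀ T : ℝ, ContinuousOn N (Set.Icc 0 T) := by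
      intro T
      obtain ⟨M, hM⟩ := isCompact_Icc.exists_bound_of_continuousOn
        (hXc.mono (Set.Icc_subset_Ici_self : Set.Icc 0 T ⊆ Set.Ici 0))
      have hU : TendstoUniformlyOn (fun (n : ℕ) t => filterFlux α (1 / ((n : ℝ) + 1)) (θ t) (u t)) N
          Filter.atTop (Set.Icc 0 T) := by
        rw [Metric.tendstoUniformlyOn_iff]
        intro η hη
        have h0 := hεt.const_mul (C1 * K * M)
        rw [mul_zero] at h0
        filter_upwards [h0.eventually (gt_mem_nhds hη)] with n hn s hs
        rw [dist_comm, Real.dist_eq]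
        refine lt_of_le_of_lt ((hNF s hs.1).2 _ (hεn n)) (lt_of_le_of_lt ?_ hn)
        have := (le_abs_self _).trans (hM s hs)
        gcongr
      refine hU.continuousOn (Filter.Frequently.of_forall fun n => ?_)
      exact (continuousOn_tsum_filterWeight_mul hα (hεn n) (continuousOn_flux hσ h hu) hB2).mono
        Set.Icc_subset_Ici_self
    intro s hs
    refine ((hIcc (s + 1)) s ⟨hs, by linarith⟩).mono_of_mem_nhdsWithin ?_
    exact mem_nhdsWithin.2 ⟨Set.Iio (s + 1), isOpen_Iio, by simp, fun r hr => ⟨hr.2, hr.1.le⟩⟩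
  set D : ℝ → ℝ := fun t => -2 * X t + 2 * innerLambda α f (θ t) + 2 * N t / filterConst α with hD
  have hDc : ContinuousOn D (Set.Ici 0) :=
    ((continuousOn_const.mul hXc).add (continuousOn_const.mul
      (ContinuousInSobolev.continuousOn_innerLambda (by positivity) hf h))).add
      ((continuousOn_const.mul hNc).div_const _)
  refine hasDerivWithinAt_Ici_of_integral hDc (fun T hT => ?_) ht
  -- `g k` is the time derivative of the squared modulus of the `k`-th coefficient. The balance is
  -- proved for truncated multipliers first, and the truncation is then removed.
  set g : (Fin 2 → ℤ) → ℝ → ℝ := fun k t =>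
    linearRate γ f (θ t) k + 2 * flux (θ t) (u t) k with hg
  have hgc : ∀ k, ContinuousOn (g k) (Set.Ici 0) := fun k =>
    (continuousOn_linearRate hσ h γ f k).add (continuousOn_const.mul (continuousOn_flux hσ h hu k))
  obtain ⟨M, hgM⟩ : ∃ M : ℝ, ∀ k t, 0 ≤ t → |g k t| ≤ M * ‖freq k‖ ^ 2 := by
    refine ⟨2 * (10 * K) ^ 2 + 2 * (Real.sqrt (mean fun x => f x ^ 2) * (10 * K)) +
      2 * (C0 * K ^ 3), fun k t ht => ?_⟩
    have h1 := abs_linearRate_le_sq hγ.2.le hf.memL2 (hm t ht) ((hK t ht).abs_le hβ'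
      (hm t ht).periodic (integrable_of_memLp_two (hm t ht).memLp_cellMeasure)
      (hm t ht).mean_zero) k
    have h2 := hB2 k t ht
    calc |g k t| ≤ |linearRate γ f (θ t) k| + 2 * |flux (θ t) (u t) k| := by
          refine (abs_add_le _ _).trans_eq ?_
          rw [abs_mul, abs_two]
      _ ≤ _ := by linarith
  have hss : ∀ t, 0 ≤ t → Summable fun k => ‖freq k‖ ^ (2 * α) * |‖coeff (θ t) k‖ ^ 2| := by
    intro t ht
    simpa only [abs_pow, abs_norm] using ((h.mem t ht).mono (σ := α) (by linarith)).summable_all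
  have hs0 : ∀ t, 0 ≤ t → ‖coeff (θ t) 0‖ ^ 2 = 0 := fun t ht => by simp [(hm t ht).coeff_zero]
  have hbal : ∀ n : ℕ, ∑' k, filterWeight α (1 / ((n : ℝ) + 1)) ‖freq k‖ * ‖coeff (θ T) k‖ ^ 2 -
      ∑' k, filterWeight α (1 / ((n : ℝ) + 1)) ‖freq k‖ * ‖coeff (θ 0) k‖ ^ 2 =
      ∫ t in (0 : ℝ)..T, ∑' k, filterWeight α (1 / ((n : ℝ) + 1)) ‖freq k‖ * g k t := fun n =>
    tsum_filterWeight_mul_sub hα (hεn n) (e := fun k t => ‖coeff (θ t) k‖ ^ 2) hgc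
      (fun k t ht => hasDerivWithinAt_sq_coeff hσ h hu hode k ht) hgM
      (fun t ht => summable_filterWeight_mul_of_summable hα
        (g := fun k => ‖coeff (θ t) k‖ ^ 2) (hs0 t ht) (hss t ht) (hεn n).le) hT.le
  have hE : ∀ t, 0 ≤ t → Filter.Tendsto
      (fun n : ℕ => ∑' k, filterWeight α (1 / ((n : ℝ) + 1)) ‖freq k‖ * ‖coeff (θ t) k‖ ^ 2)
      Filter.atTop (nhds (filterConst α * sobolevSq α (θ t))) := by
    intro t ht
    rw [(hm t ht).sobolevSq_eq]
    exact tendsto_tsum_filterWeight_mul hα (g := fun k => ‖coeff (θ t) k‖ ^ 2) (hs0 t ht) (hss t ht)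
  have hsplit : ∀ t, 0 ≤ t → ∀ n : ℕ, ∑' k, filterWeight α (1 / ((n : ℝ) + 1)) ‖freq k‖ * g k t =
      ∑' k, filterWeight α (1 / ((n : ℝ) + 1)) ‖freq k‖ * linearRate γ f (θ t) k +
        2 * filterFlux α (1 / ((n : ℝ) + 1)) (θ t) (u t) := by
    intro t ht n
    rw [filterFlux, ← tsum_mul_left, ← Summable.tsum_add
      (summable_filterWeight_mul_of_summable hα (linearRate_zero_freq (hm t ht) γ f)
        (summable_rpow_mul_abs_linearRate hγ0.le hf (h.mem t ht)) (hεn n).le)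
      ((summable_filterWeight_mul_flux hα (hεn n) (hB t ht)).mul_left 2)]
    exact tsum_congr fun k => by simp only [hg]; ring
  have hG : ∀ t, 0 ≤ t → Filter.Tendsto
      (fun n : ℕ => ∑' k, filterWeight α (1 / ((n : ℝ) + 1)) ‖freq k‖ * g k t)
      Filter.atTop (nhds (filterConst α * D t)) := by
    intro t ht
    simp_rw [hsplit t ht]
    have h1 := (tendsto_tsum_filterWeight_mul hα (linearRate_zero_freq (hm t ht) γ f)
      (summable_rpow_mul_abs_linearRate hγ0.le hf (h.mem t ht))).add ((hFt t ht).const_mul 2)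
    rw [tsum_rpow_mul_linearRate hγ0.le hf (h.mem t ht)] at h1
    have e : filterConst α * D t =
        filterConst α * (-2 * X t + 2 * innerLambda α f (θ t)) + 2 * N t := by
      rw [mul_add _ (_ + _), mul_div_cancel₀ _ hc.ne']
    rwa [e]
  have hGb : ∀ t, 0 ≤ t → ∀ n : ℕ, ‖∑' k, filterWeight α (1 / ((n : ℝ) + 1)) ‖freq k‖ * g k t‖ ≤
      filterConst α * (3 * X t + sobolevSq α f) + 4 * (C1 * K * X t) := by
    intro t ht n
    rw [hsplit t ht, Real.norm_eq_abs]
    have h1 := abs_tsum_filterWeight_mul_le hα (linearRate_zero_freq (hm t ht) γ f)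
      (summable_rpow_mul_abs_linearRate hγ0.le hf (h.mem t ht)) (hεn n).le
    have h2 := mul_le_mul_of_nonneg_left
      (tsum_rpow_mul_abs_linearRate_le hγ0.le hf (h.mem t ht)) hc.le
    have h3 := (hNF t ht).2 _ (hεn n)
    have h4 : C1 * K * X t * (1 / ((n : ℝ) + 1)) ^ (2 * δ) ≤ C1 * K * X t := by
      refine mul_le_of_le_one_right (by have := hX0 t; positivity)
        (Real.rpow_le_one (hεn n).le ?_ (by positivity))
      rw [div_le_one (by positivity)]
      linarith [(Nat.cast_nonneg n : (0 : ℝ) ≤ n)]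
    have h5 := (hNF t ht).1
    have h6 : |filterFlux α (1 / ((n : ℝ) + 1)) (θ t) (u t)| ≤ 2 * (C1 * K * X t) := by
      have := abs_add_le (filterFlux α (1 / ((n : ℝ) + 1)) (θ t) (u t) - N t) (N t)
      rw [sub_add_cancel] at this
      linarith
    refine (abs_add_le _ _).trans ?_
    rw [abs_mul, abs_two]
    linarith
  -- Dominated convergence in time: the majorant depends on time only through the continuous
  -- dissipation norm, since `ε^{2δ} ≤ 1`.
  have hI : Filter.Tendsto
      (fun n : ℕ => ∫ t in (0 : ℝ)..T, ∑' k, filterWeight α (1 / ((n : ℝ) + 1)) ‖freq k‖ * g k t)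
      Filter.atTop (nhds (∫ t in (0 : ℝ)..T, filterConst α * D t)) := by
    refine intervalIntegral.tendsto_integral_filter_of_dominated_convergence
      (fun t => filterConst α * (3 * X t + sobolevSq α f) + 4 * (C1 * K * X t))
      (Filter.Eventually.of_forall fun n => ?_)
      (Filter.Eventually.of_forall fun n => Filter.Eventually.of_forall fun t ht => ?_) ?_
      (Filter.Eventually.of_forall fun t ht => ?_)
    · rw [Set.uIoc_of_le hT.le]
      exact ((continuousOn_tsum_filterWeight_mul hα (hεn n) hgc hgM).mono fun t ht =>
        Set.mem_Ici.2 ht.1.le).aestronglyMeasurable measurableSet_Ioc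
    · rw [Set.uIoc_of_le hT.le] at ht
      exact hGb t ht.1.le n
    · refine ContinuousOn.intervalIntegrable ?_
      rw [Set.uIcc_of_le hT.le]
      have := hXc.mono (Set.Icc_subset_Ici_self : Set.Icc 0 T ⊆ Set.Ici 0)
      fun_prop
    · rw [Set.uIoc_of_le hT.le] at ht
      exact hG t ht.1.le
  -- Both limits carry the factor `filterConst α`, which is cancelled at the end.
  have heq := tendsto_nhds_unique ((hE T hT.le).sub (hE 0 le_rfl)) (hI.congr fun n => (hbal n).symm)
  rw [intervalIntegral.integral_const_mul, ← mul_sub] at heq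
  exact mul_left_cancel₀ hc.ne' heq

end Solution

end SQG

end

/-! ### The differential inequality. -/

theorem theoremB1 (γ α β : ℝ) (hγ : γ ∈ Set.Ioo (0 : ℝ) 2) (hα : α ∈ Set.Ioo (0 : ℝ) 1)
    (hβ : β ∈ Set.Ioo (max (1 - γ) 0) 1) :
    ∃ c : ℝ, 0 < c ∧
      ∀ (f : SQG.Plane → ℝ) (θ : ℝ → SQG.Plane → ℝ) (K : ℝ),
        SQG.MemSobolev α f →
        SQG.IsWeakSolution γ f θ →
        SQG.ContinuousInSobolev (α + γ / 2) θ →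
        (∀ t : ℝ, 0 ≤ t → SQG.HolderBound β K (θ t)) →
        ∀ t : ℝ, 0 ≤ t →
          ∃ D : ℝ,
            HasDerivWithinAt (fun s => SQG.sobolevSq α (θ s)) D (Set.Ici 0) t ∧
            D + 1 / 4 * SQG.sobolevSq (α + γ / 2) (θ t)
              ≤ c * K ^ (4 * γ / (γ + β - 1)) + c * SQG.sobolevSq α f := by
  obtain ⟨C, hC, hflux⟩ := SQG.exists_limitFlux_le hγ hα hβ
  have hc := SQG.filterConst_pos hα
  -- `C` pays for the flux and `2` for the forcing.
  refine ⟨C + 2, by positivity, fun f θ K hf hθ h hK t ht => ?_⟩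
  have hγ0 := hγ.1
  have hα0 := hα.1
  have hK0 : 0 ≤ K := (hK 0 le_rfl).nonneg
  obtain ⟨u, hu, hode⟩ := SQG.exists_velocity_coeff_sub (by positivity) hf.memL2 hθ h
  refine ⟨_, SQG.hasDerivWithinAt_sobolevSq hγ hα hβ hf h hK hu hode ht, ?_⟩
  have h1 := hflux (θ t) (u t) K (h.mem t ht) (hK t ht) (hu t ht)
  have h2 := hf.two_mul_innerLambda_le ((h.mem t ht).mono (σ := α) (by linarith))
  have h3 := (h.mem t ht).sobolevSq_mono (σ := α) (by linarith)
  have h4 : 2 * SQG.limitFlux α (θ t) (u t) / SQG.filterConst α ≤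
      SQG.sobolevSq (α + γ / 2) (θ t) + C * K ^ (4 * γ / (γ + β - 1)) := by
    rw [div_le_iff₀ hc]
    linarith [le_abs_self (SQG.limitFlux α (θ t) (u t))]
  have h5 : 0 ≤ K ^ (4 * γ / (γ + β - 1)) := by positivity
  have h6 := SQG.sobolevSq_nonneg (α + γ / 2) (θ t)
  have h7 := SQG.sobolevSq_nonneg α f
  -- The coefficients of the dissipation norm add up to `-2 + 1 + 1/2 + 1/4 < 0`, from dissipation,
  -- flux, forcing and the term kept in the conclusion.
  nlinarith [mul_nonneg hC.le h7]
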